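/- Let $\mathcal F$ be a foliation of codimension $2n$ on a smooth (Hausdorff, second countable) manifold $M$, with tangent bundle $P\subseteq TM$, and let $\omega$ be a closed $2$-form on $M$ whose kernel at each point $x$ is $P_x$ (so that $(M,\mathcal F,\omega)$ is a transversely symplectic foliation). Let $0\le s\le n-1$. Let $\Omega^k_{\mathrm{bas}}(M)$ be the space of smooth $k$-forms $\alpha$ with $\iota_X\alpha=0$ and $\mathcal L_X\alpha=0$ for all smooth sections $X$ of $P$, and let $H_B^k(M,\mathbb R)$ be the cohomology of the basic de Rham complex $(\Omega^*_{\mathrm{bas}}(M),d)$. For $0\le k\le n$ let $$L^{n-k}\colon H_B^k(M,\mathbb R)\to H_B^{2n-k}(M,\mathbb R),\qquad [\alpha]\mapsto[\omega^{n-k}\wedge\alpha].$$ Let $\star$ be the symplectic Hodge star, mapping forms $\alpha$ of degree $k$ on the symplectic vector spaces $(T_xM/P_x,\omega_x)$ (identified with the $k$-forms on $T_xM$ vanishing whenever an argument lies in $P_x$) to forms of degree $2n-k$, determined by $\beta\wedge\star\alpha=B(\beta,\alpha)\,\omega_x^n/n!$ for all $k$-forms $\beta$ on $T_xM/P_x$,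 where $B(\beta,\alpha)=\langle\sharp\beta,\alpha\rangle$ and $\sharp$ is the multiplicative extension of the inverse of $X\mapsto\iota_X\omega_x$. Put $\delta\alpha=(-1)^{k+1}\star d\star\alpha$ for $\alpha\in\Omega^k_{\mathrm{bas}}(M)$. A basic form $\alpha$ is called symplectic harmonic if $d\alpha=\delta\alpha=0$, and $H^k_{\mathrm{hr}}(M,\mathbb R)\subseteq H^k_B(M,\mathbb R)$ denotes the set of the classes that have a symplectic harmonic representative. Then the following three statements are equivalent. (0) For every $0\le k\le s$ the map $L^{n-k}\colon H_B^k(M,\mathbb R)\to H_B^{2n-k}(M,\mathbb R)$ is surjective. (1) $H^k_{\mathrm{hr}}(M,\mathbb R)=H^k_B(M,\mathbb R)$ for every $0\le k\le s+2$, and $H^{2n-k}_{\mathrm{hr}}(M,\mathbb R)=H^{2n-k}_B(M,\mathbb R)$ for every $0\le k\le s$. (2) $H^{2n-k}_{\mathrm{hr}}(M,\mathbb R)=H^{2n-k}_B(M,\mathbb R)$ for every $0\le k\le s$. -/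

import Mathlib

open scoped Manifold ContDiff

namespace TransverseLefschetz

section LinearAlgebra

variable {V : Type*} [AddCommGroup V] [Module ℝ V] [TopologicalSpace V]

theorem continuous_domCoprod_summand {k l : ℕ} (α : V [⋀^Fin k]→L[ℝ] ℝ) (β : V [⋀^Fin l]→L[ℝ] ℝ)
    (σ : Equiv.Perm.ModSumCongr (Fin k) (Fin l)) :
    Continuous fun v : Fin k ⊕ Fin l → V => LinearMap.mul' ℝ ℝ
      (AlternatingMap.domCoprod.summand α.toAlternatingMap β.toAlternatingMap σ v) := by
  induction σ using Quotient.inductionOn' with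
  | h σ =>
    have h : ∀ v : Fin k ⊕ Fin l → V, LinearMap.mul' ℝ ℝ
        (AlternatingMap.domCoprod.summand α.toAlternatingMap β.toAlternatingMap
          (Quotient.mk'' σ) v) = ((Equiv.Perm.sign σ : ℤ) : ℝ) *
            (α (fun i => v (σ (Sum.inl i))) * β (fun j => v (σ (Sum.inr j)))) := by
      intro v
      rw [AlternatingMap.domCoprod.summand_mk'', Units.smul_def, ← Int.cast_smul_eq_zsmul ℝ,
        _root_.smul_apply, map_smul, MultilinearMap.domDomCongr_apply,
        MultilinearMap.domCoprod_apply, LinearMap.mul'_apply, smul_eq_mul]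
      rfl
    simp only [h]
    refine continuous_const.mul (Continuous.mul ?_ ?_)
    · exact α.coe_continuous.comp (by fun_prop)
    · exact β.coe_continuous.comp (by fun_prop)

/-- The exterior product of two alternating forms (sum over shuffles, so that
`dx ∧ dy` evaluated on the coordinate frame is `1`). -/
noncomputable def wedge {k l : ℕ} (α : V [⋀^Fin k]→L[ℝ] ℝ) (β : V [⋀^Fin l]→L[ℝ] ℝ) :
    V [⋀^Fin (k + l)]→L[ℝ] ℝ :=
  { ((LinearMap.mul' ℝ ℝ).compAlternatingMap
      (α.toAlternatingMap.domCoprod β.toAlternatingMap)).domDomCongr finSumFinEquiv with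
    cont := by
      change Continuous fun v : Fin (k + l) → V => LinearMap.mul' ℝ ℝ
        ((∑ σ, AlternatingMap.domCoprod.summand α.toAlternatingMap β.toAlternatingMap σ)
          (fun i => v (finSumFinEquiv i)))
      simp only [_root_.sum_apply, map_sum]
      exact continuous_finsetSum _ fun σ _ =>
        (continuous_domCoprod_summand α β σ).comp (by fun_prop) }

/-- The antisymmetrising sum of a function of `N` vectors. -/
def altSum {V : Type*} {N : ℕ} (f : (Fin N → V) → ℝ) (v : Fin N → V) : ℝ :=
  ∑ σ : Equiv.Perm (Fin N), ((Equiv.Perm.sign σ : ℤ) : ℝ) * f (v ∘ σ)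

theorem altSum_perm {V : Type*} {N : ℕ} (f : (Fin N → V) → ℝ) (ρ : Equiv.Perm (Fin N))
    (v : Fin N → V) :
    altSum (fun w => f (w ∘ ρ)) v = ((Equiv.Perm.sign ρ : ℤ) : ℝ) * altSum f v := by
  unfold altSum
  rw [Finset.mul_sum, ← Equiv.sum_comp (Equiv.mulRight ρ)
    (fun σ : Equiv.Perm (Fin N) => ((Equiv.Perm.sign ρ : ℤ) : ℝ) *
      (((Equiv.Perm.sign σ : ℤ) : ℝ) * f (v ∘ σ)))]
  refine Finset.sum_congr rfl fun σ _ => ?_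
  have h1 : ((Equiv.Perm.sign ρ : ℤ) : ℝ) * ((Equiv.Perm.sign ρ : ℤ) : ℝ) = 1 := by
    rcases Int.units_eq_one_or (Equiv.Perm.sign ρ) with h | h <;> simp [h]
  simp only [Equiv.coe_mulRight, Equiv.Perm.sign_mul, Units.val_mul, Int.cast_mul,
    Equiv.Perm.coe_mul, ← Function.comp_assoc]
  linear_combination (-((Equiv.Perm.sign σ : ℤ) : ℝ) * f ((v ∘ σ) ∘ ρ)) * h1

theorem altSum_sum {V : Type*} {N : ℕ} {ι : Type*} (s : Finset ι) (f : ι → (Fin N → V) → ℝ)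
    (v : Fin N → V) : altSum (fun w => ∑ i ∈ s, f i w) v = ∑ i ∈ s, altSum (f i) v := by
  unfold altSum
  simp only [Finset.mul_sum]
  exact Finset.sum_comm

theorem altSum_mul {V : Type*} {N : ℕ} (c : ℝ) (f : (Fin N → V) → ℝ)
    (v : Fin N → V) : altSum (fun w => c * f w) v = c * altSum f v := by
  unfold altSum
  rw [Finset.mul_sum]
  exact Finset.sum_congr rfl fun σ _ => by ring

theorem altSum_alt {N : ℕ} (f : V [⋀^Fin N]→L[ℝ] ℝ) (v : Fin N → V) :
    altSum f v = (N.factorial : ℝ) * f v := by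
  unfold altSum
  have h : ∀ σ : Equiv.Perm (Fin N), ((Equiv.Perm.sign σ : ℤ) : ℝ) * f (v ∘ σ) = f v := by
    intro σ
    have := f.toAlternatingMap.map_perm v σ
    rcases Int.units_eq_one_or (Equiv.Perm.sign σ) with h | h <;> simp [h] at this ⊢ <;> simp [this]
  simp [h, Fintype.card_perm]

theorem wedge_apply {k l : ℕ} (α : V [⋀^Fin k]→L[ℝ] ℝ) (β : V [⋀^Fin l]→L[ℝ] ℝ)
    (v : Fin (k + l) → V) :
    wedge α β v = ((k.factorial : ℝ) * (l.factorial : ℝ))⁻¹ *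
      altSum (fun w => α (w ∘ Fin.castAdd l) * β (w ∘ Fin.natAdd k)) v := by
  have h := congrArg (fun f => LinearMap.mul' ℝ ℝ (f (v ∘ finSumFinEquiv)))
    (MultilinearMap.domCoprod_alternization_eq α.toAlternatingMap β.toAlternatingMap)
  simp only [MultilinearMap.alternatization_apply, map_sum, Fintype.card_fin] at h
  have h2 : LinearMap.mul' ℝ ℝ ((α.toAlternatingMap.domCoprod β.toAlternatingMap)
      (v ∘ finSumFinEquiv)) = wedge α β v := rfl
  rw [AlternatingMap.smul_apply, map_nsmul, h2, nsmul_eq_mul] at h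
  push_cast at h
  have h3 : altSum (fun w => α (w ∘ Fin.castAdd l) * β (w ∘ Fin.natAdd k)) v =
      (k.factorial : ℝ) * (l.factorial : ℝ) * wedge α β v := by
    rw [← h]
    unfold altSum
    rw [← Equiv.sum_comp (finSumFinEquiv (m := k) (n := l)).permCongr]
    refine Finset.sum_congr rfl fun σ _ => ?_
    rw [Units.smul_def, ← Int.cast_smul_eq_zsmul ℝ, map_smul, smul_eq_mul]
    simp [Function.comp_def]
  rw [h3]
  field_simp

theorem wedge_eq_zero {k l : ℕ} (α : V [⋀^Fin k]→L[ℝ] ℝ) (β : V [⋀^Fin l]→L[ℝ] ℝ) (X : V)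
    (hα : ∀ v : Fin k → V, (∃ i, v i = X) → α v = 0)
    (hβ : ∀ v : Fin l → V, (∃ i, v i = X) → β v = 0)
    (v : Fin (k + l) → V) (hv : ∃ i, v i = X) : wedge α β v = 0 := by
  obtain ⟨i, hi⟩ := hv
  rw [wedge_apply, altSum, Finset.sum_eq_zero, mul_zero]
  intro σ _
  obtain ⟨j, rfl⟩ := σ.surjective i
  refine Fin.addCases (fun j hj => ?_) (fun j hj => ?_) j hi
  · rw [hα _ ⟨j, hj⟩]; simp
  · rw [hβ _ ⟨j, hj⟩]; simp

theorem wedge_comp {W : Type*} [AddCommGroup W] [Module ℝ W] [TopologicalSpace W] {k l : ℕ}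
    (α : V [⋀^Fin k]→L[ℝ] ℝ) (β : V [⋀^Fin l]→L[ℝ] ℝ) (f : W →L[ℝ] V) :
    (wedge α β).compContinuousLinearMap f =
      wedge (α.compContinuousLinearMap f) (β.compContinuousLinearMap f) := by
  ext v
  rw [ContinuousAlternatingMap.compContinuousLinearMap_apply, wedge_apply, wedge_apply]
  rfl

theorem wedge_add_left {k l : ℕ} (α α' : V [⋀^Fin k]→L[ℝ] ℝ) (β : V [⋀^Fin l]→L[ℝ] ℝ) :
    wedge (α + α') β = wedge α β + wedge α' β := by
  ext v
  simp only [wedge_apply, altSum, ContinuousAlternatingMap.add_apply, add_mul, mul_add,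
    Finset.sum_add_distrib]

theorem wedge_smul_left {k l : ℕ} (c : ℝ) (α : V [⋀^Fin k]→L[ℝ] ℝ) (β : V [⋀^Fin l]→L[ℝ] ℝ) :
    wedge (c • α) β = c • wedge α β := by
  ext v
  simp only [wedge_apply, ContinuousAlternatingMap.smul_apply, smul_eq_mul, mul_assoc,
    altSum_mul]
  ring

theorem wedge_add_right {k l : ℕ} (α : V [⋀^Fin k]→L[ℝ] ℝ) (β β' : V [⋀^Fin l]→L[ℝ] ℝ) :
    wedge α (β + β') = wedge α β + wedge α β' := by
  ext v
  simp only [wedge_apply, altSum, ContinuousAlternatingMap.add_apply, mul_add,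
    Finset.sum_add_distrib]

theorem wedge_smul_right {k l : ℕ} (c : ℝ) (α : V [⋀^Fin k]→L[ℝ] ℝ) (β : V [⋀^Fin l]→L[ℝ] ℝ) :
    wedge α (c • β) = c • wedge α β := by
  ext v
  simp only [wedge_apply, ContinuousAlternatingMap.smul_apply, smul_eq_mul, mul_left_comm _ c,
    altSum_mul]

/-- The `j`-th exterior power `σ^j = σ ∧ ⋯ ∧ σ` of a two-form `σ`. -/
noncomputable def wedgePow (σ : V [⋀^Fin 2]→L[ℝ] ℝ) : (j : ℕ) → V [⋀^Fin (2 * j)]→L[ℝ] ℝ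
  | 0 => ContinuousAlternatingMap.constOfIsEmpty ℝ V (Fin 0) 1
  | j + 1 => wedge (wedgePow σ j) σ

/-- `ι_X σ`, as a covector. -/
noncomputable def flat (σ : V [⋀^Fin 2]→L[ℝ] ℝ) (X : V) : V →ₗ[ℝ] ℝ :=
  σ.toMultilinearMap.toLinearMap ![X, 0] 1

theorem continuous_flat (σ : V [⋀^Fin 2]→L[ℝ] ℝ) (X : V) : Continuous (flat σ X) :=
  σ.coe_continuous.comp (by fun_prop)

theorem flat_apply (σ : V [⋀^Fin 2]→L[ℝ] ℝ) (X Y : V) : flat σ X Y = σ ![X, Y] := by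
  change σ (Function.update ![X, 0] 1 Y) = σ ![X, Y]
  congr 1
  ext i
  fin_cases i <;> simp

/-- The decomposable form `ι_{X₁}σ ∧ ⋯ ∧ ι_{Xₖ}σ`, i.e. `v ↦ det (σ(Xᵢ, vⱼ))`. -/
noncomputable def flatWedge {k : ℕ} (σ : V [⋀^Fin 2]→L[ℝ] ℝ) (X : Fin k → V) :
    V [⋀^Fin k]→L[ℝ] ℝ :=
  { Matrix.detRowAlternating.compLinearMap (LinearMap.pi fun i => flat σ (X i)) with
    cont := by
      change Continuous fun v : Fin k → V => Matrix.det fun j i => flat σ (X i) (v j)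
      refine Continuous.matrix_det (continuous_matrix fun j i => ?_)
      exact (continuous_flat σ (X i)).comp (continuous_apply j) }

/-- A form is horizontal with respect to `σ` if it vanishes as soon as one of its arguments lies in
the kernel of `σ`; equivalently, it is the pullback of a form on `V / ker σ`. -/
def IsHorizontalFor {k : ℕ} (σ : V [⋀^Fin 2]→L[ℝ] ℝ) (α : V [⋀^Fin k]→L[ℝ] ℝ) : Prop :=
  ∀ v : Fin k → V, (∃ i, ∀ Y, σ ![v i, Y] = 0) → α v = 0

/-- `α'` is the symplectic Hodge star of the horizontal `k`-form `α`, where `σ` is a two-form on `V`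
which induces a symplectic form on the `2n`-dimensional quotient `Q = V / ker σ`, and forms on `Q`
are identified with horizontal forms on `V`:
`β ∧ α' = B(β, α) σⁿ / n!` for every `k`-form `β` on `Q`, where `B(β, α) = ⟨♯β, α⟩` and
`♯ : Λᵏ Q* → Λᵏ Q` extends the inverse of `X ↦ ι_X σ`.

Both sides are linear in `β` and `Λᵏ Q*` is spanned by the forms
`β = ι_{X₁}σ ∧ ⋯ ∧ ι_{Xₖ}σ`, for which `♯β = X₁ ∧ ⋯ ∧ Xₖ` and so `B(β, α) = α(X₁, …, Xₖ)`. -/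
def IsHodgeStar {k l : ℕ} (n : ℕ) (h : k + l = 2 * n) (σ : V [⋀^Fin 2]→L[ℝ] ℝ)
    (α : V [⋀^Fin k]→L[ℝ] ℝ) (α' : V [⋀^Fin l]→L[ℝ] ℝ) : Prop :=
  IsHorizontalFor σ α' ∧ ∀ (X : Fin k → V) (v : Fin (2 * n) → V),
    wedge (flatWedge σ X) α' (v ∘ Fin.cast h) =
      α X * ((n.factorial : ℝ)⁻¹ * wedgePow σ n v)

open Classical in
/-- The symplectic Hodge star of a horizontal `k`-form, a horizontal form of degree
`l = 2n - k`; it is uniquely determined by `IsHodgeStar`. -/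
noncomputable def hodgeStar {k l : ℕ} (n : ℕ) (h : k + l = 2 * n) (σ : V [⋀^Fin 2]→L[ℝ] ℝ)
    (α : V [⋀^Fin k]→L[ℝ] ℝ) : V [⋀^Fin l]→L[ℝ] ℝ :=
  if hα : ∃ α', IsHodgeStar n h σ α α' then hα.choose else 0

end LinearAlgebra

section Leibniz

variable {V : Type*} [NormedAddCommGroup V] [NormedSpace ℝ V]

theorem alternatizeUncurryFin_eq_altSum {N : ℕ} (A : V →L[ℝ] V [⋀^Fin N]→L[ℝ] ℝ)
    (v : Fin (N + 1) → V) :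
    ContinuousAlternatingMap.alternatizeUncurryFin A v =
      (N.factorial : ℝ)⁻¹ * altSum (fun w => A (w 0) (w ∘ Fin.succ)) v := by
  have h := altSum_alt (ContinuousAlternatingMap.alternatizeUncurryFin A) v
  have h2 : (⇑(ContinuousAlternatingMap.alternatizeUncurryFin A) : (Fin (N + 1) → V) → ℝ) =
      fun w => ∑ i : Fin (N + 1), (-1 : ℝ) ^ (i : ℕ) *
        (fun u : Fin (N + 1) → V => A (u 0) (u ∘ Fin.succ)) (w ∘ (i.cycleRange.symm)) := by
    ext w
    rw [ContinuousAlternatingMap.alternatizeUncurryFin_apply]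
    refine Finset.sum_congr rfl fun i _ => ?_
    simp only [zsmul_eq_mul, Int.cast_pow, Int.cast_neg, Int.cast_one, Function.comp_apply,
      Fin.cycleRange_symm_zero]
    congr 2
    ext j
    simp [Fin.removeNth, Fin.cycleRange_symm_succ]
  have h3 : altSum (⇑(ContinuousAlternatingMap.alternatizeUncurryFin A)) v =
      (N + 1 : ℝ) * altSum (fun w => A (w 0) (w ∘ Fin.succ)) v := by
    rw [h2, altSum_sum]
    have : ∀ i : Fin (N + 1), altSum (fun w => (-1 : ℝ) ^ (i : ℕ) *
        (fun u : Fin (N + 1) → V => A (u 0) (u ∘ Fin.succ)) (w ∘ (i.cycleRange.symm))) v =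
        altSum (fun w => A (w 0) (w ∘ Fin.succ)) v := by
      intro i
      rw [altSum_mul, altSum_perm (fun u : Fin (N + 1) → V => A (u 0) (u ∘ Fin.succ))]
      rw [Equiv.Perm.sign_symm, Fin.sign_cycleRange]
      push_cast
      rw [← mul_assoc, ← pow_add, Even.neg_one_pow ⟨_, rfl⟩, one_mul]
    simp_rw [this]
    simp
  rw [h3, Nat.factorial_succ] at h
  push_cast at h
  have hN : (N.factorial : ℝ) ≠ 0 := by positivity
  have hN' : (N + 1 : ℝ) ≠ 0 := by positivity
  rw [eq_inv_mul_iff_mul_eq₀ hN]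
  apply mul_left_cancel₀ hN'
  rw [h]; ring

theorem altSum_altSum {V : Type*} {K N : ℕ} (F : (Fin N → V) → ℝ)
    (e : Equiv.Perm (Fin K) → Equiv.Perm (Fin N))
    (he : ∀ σ, Equiv.Perm.sign (e σ) = Equiv.Perm.sign σ) (v : Fin N → V) :
    altSum (fun w => ∑ σ : Equiv.Perm (Fin K), ((Equiv.Perm.sign σ : ℤ) : ℝ) * F (w ∘ e σ)) v =
      (K.factorial : ℝ) * altSum F v := by
  rw [altSum_sum]
  have : ∀ σ : Equiv.Perm (Fin K), altSum (fun w => ((Equiv.Perm.sign σ : ℤ) : ℝ) *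
      F (w ∘ e σ)) v = altSum F v := by
    intro σ
    rw [altSum_mul, altSum_perm, he]
    rcases Int.units_eq_one_or (Equiv.Perm.sign σ) with h | h <;> simp [h]
  simp_rw [this]
  simp [Fintype.card_perm]

theorem altSum_succ {V : Type*} {N : ℕ} (G : V → (Fin N → V) → ℝ) (v : Fin (N + 1) → V) :
    altSum (fun w => altSum (G (w 0)) (w ∘ Fin.succ)) v =
      (N.factorial : ℝ) * altSum (fun w => G (w 0) (w ∘ Fin.succ)) v := by
  rw [← altSum_altSum (K := N) _ (fun σ => Equiv.Perm.decomposeFin.symm (0, σ)) (by simp)]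
  rfl

theorem altSum_castAdd {V : Type*} {k l : ℕ} (f : (Fin k → V) → ℝ) (g : (Fin l → V) → ℝ)
    (v : Fin (k + l) → V) :
    altSum (fun w => altSum f (w ∘ Fin.castAdd l) * g (w ∘ Fin.natAdd k)) v =
      (k.factorial : ℝ) * altSum (fun w => f (w ∘ Fin.castAdd l) * g (w ∘ Fin.natAdd k)) v := by
  rw [← altSum_altSum (K := k) _ (fun σ => finSumFinEquiv.permCongr (Equiv.sumCongr σ 1))
    (by simp [Equiv.Perm.sign_permCongr])]
  congr 1
  ext w
  rw [altSum, Finset.sum_mul]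
  refine Finset.sum_congr rfl fun σ _ => ?_
  rw [mul_assoc]
  congr 3
  · ext i; simp
  · ext i; simp

theorem altSum_natAdd {V : Type*} {k l : ℕ} (f : (Fin k → V) → ℝ) (g : (Fin l → V) → ℝ)
    (v : Fin (k + l) → V) :
    altSum (fun w => f (w ∘ Fin.castAdd l) * altSum g (w ∘ Fin.natAdd k)) v =
      (l.factorial : ℝ) * altSum (fun w => f (w ∘ Fin.castAdd l) * g (w ∘ Fin.natAdd k)) v := by
  rw [← altSum_altSum (K := l) _ (fun σ => finSumFinEquiv.permCongr (Equiv.sumCongr 1 σ))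
    (by simp [Equiv.Perm.sign_permCongr])]
  congr 1
  ext w
  rw [altSum, Finset.mul_sum]
  refine Finset.sum_congr rfl fun σ _ => ?_
  rw [mul_left_comm]
  congr 3
  · ext i; simp
  · ext i; simp

theorem altSum_add {V : Type*} {N : ℕ} (f g : (Fin N → V) → ℝ) (v : Fin N → V) :
    altSum (fun w => f w + g w) v = altSum f v + altSum g v := by
  unfold altSum
  rw [← Finset.sum_add_distrib]
  exact Finset.sum_congr rfl fun σ _ => by ring

/-- The algebraic form of `d(α ∧ β) = dα ∧ β` for a closed two-form `β`. -/
theorem alternatizeUncurryFin_wedge {k : ℕ} (α : V [⋀^Fin k]→L[ℝ] ℝ) (β : V [⋀^Fin 2]→L[ℝ] ℝ)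
    (A : V →L[ℝ] V [⋀^Fin k]→L[ℝ] ℝ) (B : V →L[ℝ] V [⋀^Fin 2]→L[ℝ] ℝ)
    (C : V →L[ℝ] V [⋀^Fin (k + 2)]→L[ℝ] ℝ) (hC : ∀ v, C v = wedge (A v) β + wedge α (B v))
    (hB : ContinuousAlternatingMap.alternatizeUncurryFin B = 0) :
    ContinuousAlternatingMap.alternatizeUncurryFin C =
      (wedge (ContinuousAlternatingMap.alternatizeUncurryFin A) β :
        V [⋀^Fin (k + 1 + 2)]→L[ℝ] ℝ) := by
  ext v
  have hk : (k.factorial : ℝ) ≠ 0 := by positivity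
  have hk1 : ((k + 1).factorial : ℝ) ≠ 0 := by positivity
  have hk2 : ((k + 2).factorial : ℝ) ≠ 0 := by positivity
  have h2 : ((2).factorial : ℝ) ≠ 0 := by positivity
  have hzero : altSum (fun w : Fin (k + 2 + 1) → V =>
      α ((w ∘ Fin.succ) ∘ Fin.castAdd 2) * B (w 0) ((w ∘ Fin.succ) ∘ Fin.natAdd k)) v = 0 := by
    have h := altSum_natAdd (k := k) (l := 3) α
      (fun u : Fin 3 → V => B (u 0) (u ∘ Fin.succ)) v
    have hz : ∀ u : Fin 3 → V, altSum (fun u : Fin 3 → V => B (u 0) (u ∘ Fin.succ)) u = 0 := by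
      intro u
      have h1 := alternatizeUncurryFin_eq_altSum B u
      rw [hB] at h1
      have h1' := h1.symm
      change _ = (0 : ℝ) at h1'
      rw [mul_eq_zero] at h1'
      exact h1'.resolve_left (inv_ne_zero h2)
    simp only [hz, mul_zero] at h
    have h0 : altSum (fun _ : Fin (k + 3) → V => (0 : ℝ)) v = 0 := by simp [altSum]
    rw [h0] at h
    have h3 := ((mul_eq_zero.mp h.symm).resolve_left (by positivity))
    have h4 := altSum_perm (fun w : Fin (k + 2 + 1) → V =>
      α ((w ∘ Fin.succ) ∘ Fin.castAdd 2) * B (w 0) ((w ∘ Fin.succ) ∘ Fin.natAdd k))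
      (Fin.cycleRange (⟨k, by omega⟩ : Fin (k + 2 + 1))).symm v
    have h5 : altSum (fun w : Fin (k + 2 + 1) → V => (fun w : Fin (k + 2 + 1) → V =>
      α ((w ∘ Fin.succ) ∘ Fin.castAdd 2) * B (w 0) ((w ∘ Fin.succ) ∘ Fin.natAdd k))
      (w ∘ (Fin.cycleRange (⟨k, by omega⟩ : Fin (k + 2 + 1))).symm)) v = 0 := by
      rw [← h3]
      congr 1
      ext w
      dsimp only
      congr 2
      · ext i
        simp only [Function.comp_apply, Fin.cycleRange_symm_succ]
        congr 1
        ext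
        simp [Fin.succAbove, Fin.lt_def]
      · simp only [Function.comp_apply, Fin.cycleRange_symm_zero]
        rfl
      · ext i
        simp only [Function.comp_apply, Fin.cycleRange_symm_succ]
        congr 1
        ext
        simp [Fin.succAbove, Fin.lt_def]
        try omega
    rw [h5] at h4
    refine (mul_eq_zero.mp h4.symm).resolve_left ?_
    rcases Int.units_eq_one_or (Equiv.Perm.sign
      (Fin.cycleRange (⟨k, by omega⟩ : Fin (k + 2 + 1))).symm) with h | h <;> simp [h]
  have hL : ContinuousAlternatingMap.alternatizeUncurryFin C v =
      ((k.factorial : ℝ) * ((2).factorial : ℝ))⁻¹ * altSum (fun w : Fin (k + 2 + 1) → V =>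
        A (w 0) ((w ∘ Fin.succ) ∘ Fin.castAdd 2) * β ((w ∘ Fin.succ) ∘ Fin.natAdd k)) v := by
    rw [alternatizeUncurryFin_eq_altSum]
    simp only [hC, ContinuousAlternatingMap.add_apply, wedge_apply]
    rw [altSum_add, altSum_mul, altSum_mul,
      altSum_succ (fun x (u : Fin (k + 2) → V) =>
        A x (u ∘ Fin.castAdd 2) * β (u ∘ Fin.natAdd k)),
      altSum_succ (fun x (u : Fin (k + 2) → V) =>
        α (u ∘ Fin.castAdd 2) * B x (u ∘ Fin.natAdd k)), hzero]
    field_simp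
    ring
  rw [hL]
  change _ = wedge (k := k + 1) (l := 2) (ContinuousAlternatingMap.alternatizeUncurryFin A) β v
  rw [wedge_apply]
  simp only [alternatizeUncurryFin_eq_altSum, mul_assoc]
  rw [altSum_mul, altSum_castAdd (k := k + 1) (l := 2)
    (fun w => A (w 0) (w ∘ Fin.succ)) (fun u => β u)]
  have hF : altSum (fun w : Fin (k + 2 + 1) → V =>
        A (w 0) ((w ∘ Fin.succ) ∘ Fin.castAdd 2) * β ((w ∘ Fin.succ) ∘ Fin.natAdd k)) v =
      altSum (fun w : Fin (k + 1 + 2) → V => A ((w ∘ Fin.castAdd 2) 0)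
        ((w ∘ Fin.castAdd 2) ∘ Fin.succ) * β (w ∘ Fin.natAdd (k + 1))) v := by
    congr 1
    ext w
    congr 2
    ext i
    simp only [Function.comp_apply]
    congr 1
    ext
    simp
    omega
  rw [hF]
  field_simp

end Leibniz

section Smooth

variable {V : Type*} [NormedAddCommGroup V] [NormedSpace ℝ V] [FiniteDimensional ℝ V]

theorem finiteDimensional_continuousAlternatingMap (k : ℕ) :
    FiniteDimensional ℝ (V [⋀^Fin k]→L[ℝ] ℝ) := by
  let f : (V [⋀^Fin k]→L[ℝ] ℝ) →ₗ[ℝ] MultilinearMap ℝ (fun _ : Fin k => V) ℝ :=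
    { toFun := fun α => α.toMultilinearMap
      map_add' := fun _ _ => rfl
      map_smul' := fun _ _ => rfl }
  refine Module.Finite.of_injective f fun α β h => ?_
  ext v
  exact congrArg (fun g : MultilinearMap ℝ (fun _ : Fin k => V) ℝ => g v) h

/-- The exterior product as a continuous bilinear map. -/
noncomputable def wedgeL (V : Type*) [NormedAddCommGroup V] [NormedSpace ℝ V]
    [FiniteDimensional ℝ V] (k l : ℕ) :
    (V [⋀^Fin k]→L[ℝ] ℝ) →L[ℝ] (V [⋀^Fin l]→L[ℝ] ℝ) →L[ℝ] (V [⋀^Fin (k + l)]→L[ℝ] ℝ) :=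
  haveI := finiteDimensional_continuousAlternatingMap (V := V) k
  haveI := finiteDimensional_continuousAlternatingMap (V := V) l
  LinearMap.toContinuousBilinearMap
    (LinearMap.mk₂ ℝ wedge wedge_add_left wedge_smul_left wedge_add_right wedge_smul_right)

theorem wedgeL_apply {k l : ℕ} (α : V [⋀^Fin k]→L[ℝ] ℝ) (β : V [⋀^Fin l]→L[ℝ] ℝ) :
    wedgeL V k l α β = wedge α β := rfl

theorem extDeriv_wedge {k : ℕ} {f : V → V [⋀^Fin k]→L[ℝ] ℝ} {g : V → V [⋀^Fin 2]→L[ℝ] ℝ} {x : V}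
    (hf : DifferentiableAt ℝ f x) (hg : DifferentiableAt ℝ g x) (hdg : extDeriv g x = 0) :
    extDeriv (fun y => wedge (f y) (g y)) x =
      (wedge (extDeriv f x) (g x) : V [⋀^Fin (k + 1 + 2)]→L[ℝ] ℝ) := by
  have h := (wedgeL V k 2).hasFDerivAt_of_bilinear hf.hasFDerivAt hg.hasFDerivAt
  refine alternatizeUncurryFin_wedge (f x) (g x) (fderiv ℝ f x) (fderiv ℝ g x) _ (fun v => ?_) hdg
  have h' : HasFDerivAt (fun y => wedge (f y) (g y)) _ x := h
  rw [h'.fderiv]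
  simp [wedgeL_apply, add_comm]

end Smooth

section Manifold

/-- The model space `ℝᵐ`. -/
abbrev Coord (m : ℕ) : Type := EuclideanSpace ℝ (Fin m)

/-- (Not necessarily smooth) differential `k`-forms on an `m`-dimensional manifold. The tangent space
`T_x M` is by definition the model space, by means of the preferred chart at `x`. -/
def Form (m k : ℕ) (M : Type*) : Type _ := M → Coord m [⋀^Fin k]→L[ℝ] ℝ

noncomputable instance (m k : ℕ) (M : Type*) : AddCommGroup (Form m k M) :=
  inferInstanceAs (AddCommGroup (M → Coord m [⋀^Fin k]→L[ℝ] ℝ))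

noncomputable instance (m k : ℕ) (M : Type*) : Module ℝ (Form m k M) :=
  inferInstanceAs (Module ℝ (M → Coord m [⋀^Fin k]→L[ℝ] ℝ))

variable {m k : ℕ} {M : Type*} [TopologicalSpace M] [ChartedSpace (Coord m) M]
  [IsManifold (𝓡 m) ∞ M]

/-- The expression of a form in the chart around `x₀`, i.e. its pullback under the inverse chart. -/
noncomputable def Form.inChart (α : Form m k M) (x₀ : M) :
    Coord m → Coord m [⋀^Fin k]→L[ℝ] ℝ := fun y =>
  (α ((extChartAt (𝓡 m) x₀).symm y)).compContinuousLinearMap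
    (tangentCoordChange (𝓡 m) x₀ ((extChartAt (𝓡 m) x₀).symm y) ((extChartAt (𝓡 m) x₀).symm y))

/-- Smoothness of a form: its expressions in the charts are smooth. -/
def Form.Smooth (α : Form m k M) : Prop :=
  ∀ x₀ : M, ContDiffOn ℝ ∞ (α.inChart x₀) (extChartAt (𝓡 m) x₀).target

/-- The exterior derivative, computed at `x` in the preferred chart at `x`, by means of which
`T_x M` is identified with `ℝᵐ`. -/
noncomputable def Form.d (α : Form m k M) : Form m (k + 1) M := fun x =>
  extDeriv (α.inChart x) (extChartAt (𝓡 m) x x)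

/-- The exterior product of two forms. -/
noncomputable def Form.wedge {l : ℕ} (α : Form m k M) (β : Form m l M) : Form m (k + l) M :=
  fun x => TransverseLefschetz.wedge (α x) (β x)

/-- The contraction `ι_X α` of a form of positive degree with a vector field. -/
noncomputable def Form.interior (X : (x : M) → TangentSpace (𝓡 m) x) (α : Form m (k + 1) M) :
    Form m k M :=
  fun x => (α x).curryLeft (X x)

/-- The contraction `ι_X α` of a form with a vector field, which is zero on functions. -/
noncomputable def Form.contract (X : (x : M) → TangentSpace (𝓡 m) x) :
    {k : ℕ} → Form m k M → Form m (k - 1) M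
  | 0, _ => 0
  | _ + 1, α => Form.interior X α

/-- The Lie derivative `ℒ_X α = d ι_X α + ι_X d α`. -/
noncomputable def Form.lieDeriv (X : (x : M) → TangentSpace (𝓡 m) x) :
    {k : ℕ} → Form m k M → Form m k M
  | 0, f => Form.interior X f.d
  | _ + 1, α => (Form.interior X α).d + Form.interior X α.d

theorem Form.inChart_add (α β : Form m k M) (x₀ : M) :
    (α + β).inChart x₀ = α.inChart x₀ + β.inChart x₀ := rfl

theorem Form.inChart_smul (c : ℝ) (α : Form m k M) (x₀ : M) :
    (c • α).inChart x₀ = c • α.inChart x₀ := rfl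

theorem Form.inChart_wedge {l : ℕ} (α : Form m k M) (β : Form m l M) (x₀ : M) :
    (α.wedge β).inChart x₀ =
      fun y => TransverseLefschetz.wedge (α.inChart x₀ y) (β.inChart x₀ y) :=
  funext fun _ => wedge_comp _ _ _

theorem Form.inChart_self (α : Form m k M) (x : M) :
    α.inChart x (extChartAt (𝓡 m) x x) = α x := by
  unfold Form.inChart
  rw [extChartAt_to_inv]
  ext v
  rw [ContinuousAlternatingMap.compContinuousLinearMap_apply]
  congr 1
  ext1 i
  exact tangentCoordChange_self (mem_extChartAt_source x)

theorem Form.Smooth.differentiableAt {α : Form m k M} (hα : α.Smooth) (x : M) :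
    DifferentiableAt ℝ (α.inChart x) (extChartAt (𝓡 m) x x) :=
  ((hα x).contDiffAt (extChartAt_target_mem_nhds x)).differentiableAt (by simp)

theorem Form.Smooth.zero : (0 : Form m k M).Smooth := fun x₀ => by
  have : (0 : Form m k M).inChart x₀ = fun _ => 0 := rfl
  rw [this]
  exact contDiffOn_const

theorem Form.Smooth.add {α β : Form m k M} (hα : α.Smooth) (hβ : β.Smooth) : (α + β).Smooth :=
  fun x₀ => (hα x₀).add (hβ x₀)

theorem Form.Smooth.smul (c : ℝ) {α : Form m k M} (hα : α.Smooth) : (c • α).Smooth :=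
  fun x₀ => (hα x₀).const_smul c

theorem Form.Smooth.wedge {l : ℕ} {α : Form m k M} {β : Form m l M} (hα : α.Smooth)
    (hβ : β.Smooth) : (α.wedge β).Smooth := fun x₀ => by
  rw [Form.inChart_wedge]
  exact ((wedgeL (Coord m) k l).contDiff.comp_contDiffOn (hα x₀)).clm_apply (hβ x₀)

theorem Form.d_add {α β : Form m k M} (hα : α.Smooth) (hβ : β.Smooth) :
    (α + β).d = α.d + β.d :=
  funext fun x => extDeriv_add (hα.differentiableAt x) (hβ.differentiableAt x)

theorem Form.d_smul (c : ℝ) (α : Form m k M) : (c • α).d = c • α.d :=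
  funext fun x => extDeriv_smul c (α.inChart x)

theorem Form.d_zero : (0 : Form m k M).d = 0 := by
  rw [← zero_smul ℝ (0 : Form m k M), Form.d_smul, zero_smul]

theorem Form.d_wedge {α : Form m k M} {β : Form m 2 M} (hα : α.Smooth) (hβ : β.Smooth)
    (hdβ : β.d = 0) : (α.wedge β).d = (α.d.wedge β : Form m (k + 1 + 2) M) := by
  funext x
  unfold Form.d
  rw [Form.inChart_wedge]
  have h := extDeriv_wedge (hα.differentiableAt x) (hβ.differentiableAt x) (congrFun hdβ x)
  rw [h, Form.inChart_self]
  rfl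

end Manifold

section Foliation

/-- A foliation with `p`-dimensional leaves and of codimension `q` on a `(p + q)`-dimensional
manifold: a distribution `tangent` (the tangent spaces of the leaves) such that around every point
there is a foliation chart `e : U → ℝᵖ × ℝ^q`, i.e. a chart of the smooth structure for which, at
every `z ∈ U`, a vector is tangent to the foliation if and only if its image under the differential
of `e` is tangent to the plaque, that is, has vanishing last `q` coordinates. -/
structure Foliation (p q : ℕ) (M : Type*) [TopologicalSpace M] [ChartedSpace (Coord (p + q)) M]
    [IsManifold (𝓡 (p + q)) ∞ M] where
  /-- The tangent space of the leaf through a point. -/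
  tangent : (x : M) → Submodule ℝ (TangentSpace (𝓡 (p + q)) x)
  exists_chart : ∀ x : M, ∃ e ∈ IsManifold.maximalAtlas (𝓡 (p + q)) ∞ M, x ∈ e.source ∧
    ∀ z ∈ e.source, ∀ v : TangentSpace (𝓡 (p + q)) z, v ∈ tangent z ↔
      ∀ i : Fin q,
        EuclideanSpace.proj (𝕜 := ℝ) (Fin.natAdd p i)
          (mfderiv (𝓡 (p + q)) (𝓡 (p + q)) e z v) = 0

namespace Foliation

variable {p q : ℕ} {M : Type*} [TopologicalSpace M] [ChartedSpace (Coord (p + q)) M]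
  [IsManifold (𝓡 (p + q)) ∞ M] (F : Foliation p q M)

/-- `X ∈ Γ(P)`: smooth vector fields tangent to the leaves. -/
def IsTangentField (X : (x : M) → TangentSpace (𝓡 (p + q)) x) : Prop :=
  ContMDiff (𝓡 (p + q)) (𝓡 (p + q)).tangent ∞
    (fun x => (⟨x, X x⟩ : TangentBundle (𝓡 (p + q)) M)) ∧ ∀ x, X x ∈ F.tangent x

/-- Basic forms: smooth forms with `ι_X α = 0` and `ℒ_X α = 0` for all `X ∈ Γ(P)`. -/
def IsBasic {k : ℕ} (α : Form (p + q) k M) : Prop :=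
  α.Smooth ∧ ∀ X, F.IsTangentField X → α.contract X = 0 ∧ α.lieDeriv X = 0

variable {F}

theorem isBasic_iff {k : ℕ} {α : Form (p + q) k M} : F.IsBasic α ↔
    α.Smooth ∧ ∀ X, F.IsTangentField X → α.contract X = 0 ∧ α.d.contract X = 0 := by
  unfold IsBasic
  refine and_congr_right fun _ => forall₂_congr fun X _ => and_congr_right fun h => ?_
  cases k with
  | zero => exact Iff.rfl
  | succ k =>
    change (Form.interior X α).d + Form.interior X α.d = 0 ↔ Form.interior X α.d = 0
    have h' : Form.interior X α = 0 := h
    rw [h', Form.d_zero, zero_add]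

theorem contract_zero {m k : ℕ} {M : Type*} [TopologicalSpace M] [ChartedSpace (Coord m) M]
    (X : (x : M) → TangentSpace (𝓡 m) x) : (0 : Form m k M).contract X = 0 := by
  cases k <;> rfl

theorem contract_add {m k : ℕ} {M : Type*} [TopologicalSpace M] [ChartedSpace (Coord m) M]
    (X : (x : M) → TangentSpace (𝓡 m) x) (α β : Form m k M) :
    (α + β).contract X = α.contract X + β.contract X := by
  cases k
  · exact (add_zero _).symm
  · rfl

theorem contract_smul {m k : ℕ} {M : Type*} [TopologicalSpace M] [ChartedSpace (Coord m) M]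
    (X : (x : M) → TangentSpace (𝓡 m) x) (c : ℝ) (α : Form m k M) :
    (c • α).contract X = c • α.contract X := by
  cases k
  · exact (smul_zero _).symm
  · rfl

theorem contract_eq_zero_iff {m k : ℕ} {M : Type*} [TopologicalSpace M] [ChartedSpace (Coord m) M]
    (X : (x : M) → TangentSpace (𝓡 m) x) (α : Form m k M) :
    α.contract X = 0 ↔ ∀ (x : M) (v : Fin k → Coord m), (∃ i, v i = X x) → α x v = 0 := by
  cases k with
  | zero => exact ⟨fun _ x v ⟨i, _⟩ => i.elim0, fun _ => rfl⟩
  | succ k =>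
    constructor
    · rintro h x v ⟨i, hi⟩
      have h1 := congrArg (fun f => f (i.removeNth v)) (congrFun h x)
      have h2 := (α x).toAlternatingMap.map_insertNth i (X x) (i.removeNth v)
      rw [← hi, Fin.insertNth_self_removeNth, hi] at h2
      have h3 : (α x).toAlternatingMap (Matrix.vecCons (X x) (i.removeNth v)) = 0 := h1
      rw [h3, smul_zero] at h2
      exact h2
    · intro h
      funext x
      ext v
      exact h x (Matrix.vecCons (X x) v) ⟨0, rfl⟩

theorem IsBasic.zero {k : ℕ} : F.IsBasic (0 : Form (p + q) k M) :=
  isBasic_iff.2 ⟨Form.Smooth.zero, fun X _ => ⟨contract_zero X, by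
    rw [Form.d_zero, contract_zero]⟩⟩

theorem IsBasic.add {k : ℕ} {α β : Form (p + q) k M} (hα : F.IsBasic α) (hβ : F.IsBasic β) :
    F.IsBasic (α + β) := by
  rw [isBasic_iff] at *
  refine ⟨hα.1.add hβ.1, fun X hX => ⟨?_, ?_⟩⟩
  · rw [contract_add, (hα.2 X hX).1, (hβ.2 X hX).1, add_zero]
  · rw [Form.d_add hα.1 hβ.1, contract_add, (hα.2 X hX).2, (hβ.2 X hX).2, add_zero]

theorem IsBasic.smul {k : ℕ} (c : ℝ) {α : Form (p + q) k M} (hα : F.IsBasic α) :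
    F.IsBasic (c • α) := by
  rw [isBasic_iff] at *
  refine ⟨hα.1.smul c, fun X hX => ⟨?_, ?_⟩⟩
  · rw [contract_smul, (hα.2 X hX).1, smul_zero]
  · rw [Form.d_smul, contract_smul, (hα.2 X hX).2, smul_zero]

variable (F)

/-- The closed basic `k`-forms. -/
noncomputable def closedBasic (k : ℕ) : Submodule ℝ (Form (p + q) k M) where
  carrier := {α | F.IsBasic α ∧ α.d = 0}
  zero_mem' := ⟨IsBasic.zero, Form.d_zero⟩
  add_mem' := fun hα hβ => ⟨hα.1.add hβ.1, by
    rw [Form.d_add hα.1.1 hβ.1.1, hα.2, hβ.2, add_zero]⟩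
  smul_mem' := fun c α hα => ⟨hα.1.smul c, by rw [Form.d_smul, hα.2, smul_zero]⟩

/-- The exterior derivatives of basic `(k - 1)`-forms. -/
noncomputable def exactBasic : (k : ℕ) → Submodule ℝ (Form (p + q) k M)
  | 0 => ⊥
  | k + 1 =>
    { carrier := {β | ∃ γ : Form (p + q) k M, F.IsBasic γ ∧ γ.d = β}
      zero_mem' := ⟨0, IsBasic.zero, Form.d_zero⟩
      add_mem' := by
        rintro _ _ ⟨γ, hγ, rfl⟩ ⟨γ', hγ', rfl⟩
        exact ⟨γ + γ', hγ.add hγ', Form.d_add hγ.1 hγ'.1⟩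
      smul_mem' := by
        rintro c _ ⟨γ, hγ, rfl⟩
        exact ⟨c • γ, hγ.smul c, Form.d_smul c γ⟩ }

/-- The basic de Rham cohomology `H_B^k(M, ℝ)`. -/
abbrev HB (k : ℕ) : Type _ :=
  F.closedBasic k ⧸ (F.exactBasic k).comap (F.closedBasic k).subtype

/-- The identification of basic cohomology groups in equal degrees. -/
noncomputable def castHB {k l : ℕ} (h : k = l) : F.HB k ≃ₗ[ℝ] F.HB l := by
  subst h
  exact LinearEquiv.refl ℝ _

end Foliation

/-- A transversely symplectic foliation of codimension `2n`: a foliation together with a closed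
two-form whose kernel at each point is the tangent space of the leaf. -/
structure TransverselySymplecticFoliation (p n : ℕ) (M : Type*) [TopologicalSpace M]
    [ChartedSpace (Coord (p + 2 * n)) M] [IsManifold (𝓡 (p + 2 * n)) ∞ M]
    extends Foliation p (2 * n) M where
  /-- The transversely symplectic form. -/
  sympl : Form (p + 2 * n) 2 M
  smooth_sympl : sympl.Smooth
  closed_sympl : sympl.d = 0
  ker_sympl : ∀ (x : M) (X : TangentSpace (𝓡 (p + 2 * n)) x),
    X ∈ tangent x ↔ ∀ Y : TangentSpace (𝓡 (p + 2 * n)) x, sympl x ![X, Y] = 0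

namespace TransverselySymplecticFoliation

variable {p n : ℕ} {M : Type*} [TopologicalSpace M] [ChartedSpace (Coord (p + 2 * n)) M]
  [IsManifold (𝓡 (p + 2 * n)) ∞ M] (T : TransverselySymplecticFoliation p n M)

theorem contract_sympl {X : (x : M) → TangentSpace (𝓡 (p + 2 * n)) x}
    (hX : T.IsTangentField X) : T.sympl.contract X = 0 := by
  funext x
  ext v
  have h := (T.ker_sympl x (X x)).1 (hX.2 x) (v 0)
  change T.sympl x (Matrix.vecCons (X x) v) = 0
  rw [← h]
  congr 1
  ext1 i
  fin_cases i <;> rfl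

theorem contract_wedge_sympl {k : ℕ} {X : (x : M) → TangentSpace (𝓡 (p + 2 * n)) x}
    (hX : T.IsTangentField X) {α : Form (p + 2 * n) k M} (hα : α.contract X = 0) :
    (α.wedge T.sympl).contract X = 0 := by
  have hω := T.contract_sympl hX
  rw [Foliation.contract_eq_zero_iff] at *
  exact fun x => wedge_eq_zero _ _ _ (hα x) (hω x)

/-- The Lefschetz operator `α ↦ α ∧ ω` on forms. -/
noncomputable def L (k : ℕ) : Form (p + 2 * n) k M →ₗ[ℝ] Form (p + 2 * n) (k + 2) M where
  toFun α := α.wedge T.sympl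
  map_add' α β := funext fun x => wedge_add_left (α x) (β x) (T.sympl x)
  map_smul' c α := funext fun x => wedge_smul_left c (α x) (T.sympl x)

theorem isBasic_L {k : ℕ} {α : Form (p + 2 * n) k M} (hα : T.IsBasic α) :
    T.IsBasic (T.L k α) := by
  rw [Foliation.isBasic_iff] at *
  refine ⟨hα.1.wedge T.smooth_sympl, fun X hX => ⟨T.contract_wedge_sympl hX (hα.2 X hX).1, ?_⟩⟩
  have h := T.contract_wedge_sympl hX (hα.2 X hX).2
  rw [← Form.d_wedge hα.1 T.smooth_sympl T.closed_sympl] at h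
  exact h

theorem d_L {k : ℕ} {α : Form (p + 2 * n) k M} (hα : T.IsBasic α) :
    (T.L k α).d = T.L (k + 1) α.d :=
  Form.d_wedge hα.1 T.smooth_sympl T.closed_sympl

theorem L_mem_closedBasic {k : ℕ} (α : Form (p + 2 * n) k M) (hα : α ∈ T.closedBasic k) :
    T.L k α ∈ T.closedBasic (k + 2) :=
  ⟨T.isBasic_L hα.1, by rw [T.d_L hα.1, hα.2, map_zero]⟩

/-- The map `[α] ↦ [α ∧ ω]` on basic cohomology. -/
noncomputable def lefschetzStep (k : ℕ) : T.HB k →ₗ[ℝ] T.HB (k + 2) :=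
  Submodule.mapQ _ _ ((T.L k).restrict T.L_mem_closedBasic) (by
    rintro ⟨α, hα⟩ h
    cases k with
    | zero =>
      have h0 : α = 0 := h
      subst h0
      exact Submodule.mem_comap.2 (by
        rw [show ((⟨0, hα⟩ : T.closedBasic 0)) = 0 from rfl, map_zero]
        exact Submodule.zero_mem _)
    | succ k =>
      obtain ⟨γ, hγ, rfl⟩ := h
      exact ⟨T.L k γ, T.isBasic_L hγ, T.d_L hγ⟩)

/-- The map `L^j : [α] ↦ [α ∧ ω^j]` on basic cohomology. -/
noncomputable def lefschetzPow (k : ℕ) : (j : ℕ) → T.HB k →ₗ[ℝ] T.HB (k + 2 * j)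
  | 0 => LinearMap.id
  | j + 1 => T.lefschetzStep (k + 2 * j) ∘ₗ lefschetzPow k j

/-- The Lefschetz map `L^{n-k} : H_B^k(M, ℝ) → H_B^{2n-k}(M, ℝ)` for `k ≤ n`. -/
noncomputable def lefschetz (k : ℕ) (hk : k ≤ n) : T.HB k →ₗ[ℝ] T.HB (2 * n - k) :=
  (T.castHB (by omega : k + 2 * (n - k) = 2 * n - k)).toLinearMap ∘ₗ T.lefschetzPow k (n - k)

/-- The symplectic Hodge star on horizontal forms, from degree `k` to degree `l = 2n - k`. -/
noncomputable def star {k l : ℕ} (h : k + l = 2 * n) (α : Form (p + 2 * n) k M) :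
    Form (p + 2 * n) l M :=
  fun x => hodgeStar n h (T.sympl x) (α x)

/-- The symplectic adjoint `δ α = (-1)^{k+1} ⋆ d ⋆ α` of the exterior derivative, for a basic
`k`-form `α`. It vanishes on functions, and in degrees above `2n`, where there are no nonzero
horizontal forms. -/
noncomputable def δ : {k : ℕ} → Form (p + 2 * n) k M → Form (p + 2 * n) (k - 1) M
  | 0, _ => 0
  | k + 1, α =>
    if h : k + 1 ≤ 2 * n then
      (-1 : ℝ) ^ (k + 1 + 1) •
        T.star (k := 2 * n - (k + 1) + 1) (l := k) (by omega)
          (T.star (k := k + 1) (l := 2 * n - (k + 1)) (by omega) α).d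
    else 0

/-- The symplectic harmonic basic forms. -/
def IsHarmonic {k : ℕ} (α : Form (p + 2 * n) k M) : Prop :=
  T.IsBasic α ∧ α.d = 0 ∧ T.δ α = 0

/-- `H_hr^k(M, ℝ) ⊆ H_B^k(M, ℝ)`: the basic cohomology classes with a symplectic harmonic
representative. -/
def Hhr (k : ℕ) : Set (T.HB k) :=
  {c | ∃ α : T.closedBasic k, T.IsHarmonic (α : Form (p + 2 * n) k M) ∧ Submodule.Quotient.mk α = c}

end TransverselySymplecticFoliation

end Foliation

end TransverseLefschetz

/-!
The proof is pointwise linear algebra, a regularity argument which makes the linear algebra available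
for basic forms, and a comparison of coefficients in primitive decompositions.

Linear algebra. Let `σ` be a two-form of rank `2n` and `L a = a ∧ σ`. From
`ι_X L^(j+1) = L^(j+1) ι_X + (j+1) (ι_X σ ∧ ·) L^j` (`contr_lef_pow_succ`) it follows that `L^j` is
injective on `k`-forms for `k + j ≤ n` (`lef_pow_injective`), and that the horizontal forms are spanned
by the forms `L^j a` with `a` primitive (`mem_primSpan`); hence every horizontal form of degree `n + j`
is some `L^j b` (`exists_lef_pow_eq`). The star of a primitive form times a power of `σ` is given by
Weil's formula (`isHodgeStar_weil`): for `a` primitive of degree `k` and `k + j + r = n`,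
`⋆ L^j a = (-1)^(k(k+1)/2) (j! / r!) L^r a`. It is proved by induction on the degree of `L^j a`, since
the contraction `ι_X` before the star corresponds to `ι_X σ ∧ ·` after it.

Regularity. A smooth form is basic if and only if it and its differential are pointwise horizontal
(`isBasic_iff_isHorizontalFor`), because every vector tangent to a leaf extends to a global leafwise
field. If `L^j a` is basic, `a` is horizontal of degree `k` and `k + j ≤ n`, then `a` is basic
(`mem_basic_of_lefF_pow`). So the pointwise decompositions consist of basic forms, the star of a basic
form is basic, and a closed basic form is harmonic if and only if its star is closed
(`isHarmonic_iff`).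

Cohomology. Assume that `L^(n-k)` is surjective in degrees `k ≤ s`. For a closed basic form `α` of
degree `k ≤ min(s + 2, n)`, surjectivity in degree `k - 2` gives `L^(n-k+1) α = L^(n-k+2) b + d γ` with
`b` closed, and `γ = L^(n-k+1) θ`; then `α - L b - d θ` is closed and primitive. By induction, `α` is
cohomologous to a sum of forms `L^j a` with `a` closed and primitive (`exists_eq_harSpan_add`), which
is harmonic by Weil's formula; a class of degree `2n - k` is the image under
`L^(n-k)` of such a class.

Conversely, let `L^(n-k) β` be harmonic with `k < n` and `β = ∑ L^r α_r` the primitive decomposition.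
Then `d α_r = a_r + L b_r` with primitive `a_r` and `b_r`. Closedness of `L^(n-k) β` gives
`a_(r+1) + b_r = 0`, and closedness of its star gives `c_(r+1) a_(r+1) + c_r b_r = 0` and `a_0 = 0`,
where the coefficients `c_r` of Weil's formula alternate in sign. Hence all terms vanish and `β` is
closed (`d_eq_zero_of_isHarmonic`), so that the class of `L^(n-k) β` is in the image of `L^(n-k)`.
-/

/-! ### Graded alternating forms, interior products and the Lefschetz operator -/

namespace TransverseLefschetz

section Operators

variable {V : Type*} [NormedAddCommGroup V] [NormedSpace ℝ V]

/-- Sequences of alternating forms, with one form in each degree. Operators which shift the degree act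
on the product of all degrees, so that no casts between form spaces are needed. -/
def AltForms (V : Type*) [NormedAddCommGroup V] [NormedSpace ℝ V] : Type _ :=
  (k : ℕ) → V [⋀^Fin k]→L[ℝ] ℝ

noncomputable instance : AddCommGroup (AltForms V) :=
  inferInstanceAs (AddCommGroup ((k : ℕ) → V [⋀^Fin k]→L[ℝ] ℝ))

noncomputable instance : Module ℝ (AltForms V) :=
  inferInstanceAs (Module ℝ ((k : ℕ) → V [⋀^Fin k]→L[ℝ] ℝ))

namespace AltForms

theorem zero_apply (k : ℕ) : (0 : AltForms V) k = 0 := rfl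

theorem add_apply (a b : AltForms V) (k : ℕ) : (a + b) k = a k + b k := rfl

theorem smul_apply (c : ℝ) (a : AltForms V) (k : ℕ) : (c • a) k = c • a k := rfl

theorem sum_apply {ι : Type*} (s : Finset ι) (f : ι → AltForms V) (k : ℕ) :
    (∑ i ∈ s, f i) k = ∑ i ∈ s, f i k :=
  Finset.sum_apply k s f

/-- A form of degree `k`, as a sequence of forms. -/
noncomputable def single (k : ℕ) (x : V [⋀^Fin k]→L[ℝ] ℝ) : AltForms V := Pi.single k x

theorem single_same (k : ℕ) (x : V [⋀^Fin k]→L[ℝ] ℝ) : single k x k = x :=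
  Pi.single_eq_same (M := fun k => V [⋀^Fin k]→L[ℝ] ℝ) k x

theorem single_of_ne {k l : ℕ} (h : l ≠ k) (x : V [⋀^Fin k]→L[ℝ] ℝ) : single k x l = 0 :=
  Pi.single_eq_of_ne (M := fun k => V [⋀^Fin k]→L[ℝ] ℝ) h x

end AltForms

/-- The forms of degree `k`. The degree is an integer, so that there are no nonzero forms of negative
degree. -/
def altDegree (V : Type*) [NormedAddCommGroup V] [NormedSpace ℝ V] (k : ℤ) :
    Submodule ℝ (AltForms V) where
  carrier := {a | ∀ j : ℕ, (j : ℤ) ≠ k → a j = 0}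
  zero_mem' := fun _ _ => rfl
  add_mem' := fun {a b} ha hb j hj => by
    rw [AltForms.add_apply, ha j hj, hb j hj, add_zero]
  smul_mem' := fun c a ha j hj => by
    rw [AltForms.smul_apply, ha j hj, smul_zero]

theorem single_mem_altDegree {j : ℕ} {k : ℤ} (h : (j : ℤ) = k) (x : V [⋀^Fin j]→L[ℝ] ℝ) :
    AltForms.single j x ∈ altDegree V k := fun _ hi =>
  AltForms.single_of_ne (fun h' => hi (by rw [h', h])) x

theorem eq_single_of_mem_altDegree {j : ℕ} {k : ℤ} (h : (j : ℤ) = k) {a : AltForms V}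
    (ha : a ∈ altDegree V k) : a = AltForms.single j (a j) := by
  funext i
  by_cases hi : i = j
  · subst hi; rw [AltForms.single_same]
  · rw [AltForms.single_of_ne hi]
    exact ha i fun h' => hi (by omega)

theorem eq_zero_of_mem_altDegree_neg {k : ℤ} (hk : k < 0) {a : AltForms V}
    (ha : a ∈ altDegree V k) : a = 0 :=
  funext fun i => ha i (by omega)

/-- The interior product `ι_X`. -/
noncomputable def contr : V →ₗ[ℝ] AltForms V →ₗ[ℝ] AltForms V :=
  LinearMap.mk₂ ℝ (fun X a k => (a (k + 1)).curryLeft X)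
    (fun _ _ _ => funext fun _ => map_add _ _ _)
    (fun _ _ _ => funext fun _ => map_smul _ _ _)
    (fun _ _ _ => funext fun _ => rfl)
    (fun _ _ _ => funext fun _ => rfl)

theorem contr_apply (X : V) (a : AltForms V) (k : ℕ) :
    contr X a k = (a (k + 1)).curryLeft X := rfl

/-- The values of the exterior product `ξ ∧ ·` with a covector. -/
noncomputable def extMulFun (ξ : V →L[ℝ] ℝ) (a : AltForms V) : AltForms V
  | 0 => 0
  | k + 1 => ContinuousAlternatingMap.alternatizeUncurryFin (ξ.smulRight (a k))

theorem extMulFun_apply (ξ : V →L[ℝ] ℝ) (a : AltForms V) (k : ℕ) (v : Fin (k + 1) → V) :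
    extMulFun ξ a (k + 1) v =
      ∑ i : Fin (k + 1), (-1 : ℝ) ^ (i : ℕ) * (ξ (v i) * a k (i.removeNth v)) := by
  rw [extMulFun, ContinuousAlternatingMap.alternatizeUncurryFin_apply]
  refine Finset.sum_congr rfl fun i _ => ?_
  simp

/-- The exterior product `ξ ∧ ·` with a covector. -/
noncomputable def extMul : (V →L[ℝ] ℝ) →ₗ[ℝ] AltForms V →ₗ[ℝ] AltForms V :=
  LinearMap.mk₂ ℝ extMulFun
    (fun ξ ξ' a => funext fun k => by
      cases k with
      | zero => exact (add_zero _).symm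
      | succ k =>
        ext v
        change _ = extMulFun ξ a (k + 1) v + extMulFun ξ' a (k + 1) v
        simp only [extMulFun_apply, _root_.add_apply, add_mul, mul_add,
          Finset.sum_add_distrib])
    (fun c ξ a => funext fun k => by
      cases k with
      | zero => exact (smul_zero c).symm
      | succ k =>
        ext v
        change _ = c * extMulFun ξ a (k + 1) v
        simp only [extMulFun_apply, _root_.smul_apply, smul_eq_mul, Finset.mul_sum]
        exact Finset.sum_congr rfl fun i _ => by ring)
    (fun ξ a b => funext fun k => by
      cases k with
      | zero => exact (add_zero _).symm
      | succ k =>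
        ext v
        change _ = extMulFun ξ a (k + 1) v + extMulFun ξ b (k + 1) v
        simp only [extMulFun_apply, AltForms.add_apply, ContinuousAlternatingMap.add_apply, mul_add,
          Finset.sum_add_distrib])
    (fun c ξ a => funext fun k => by
      cases k with
      | zero => exact (smul_zero c).symm
      | succ k =>
        ext v
        change _ = c * extMulFun ξ a (k + 1) v
        simp only [extMulFun_apply, AltForms.smul_apply, ContinuousAlternatingMap.smul_apply,
          smul_eq_mul, Finset.mul_sum]
        exact Finset.sum_congr rfl fun i _ => by ring)

theorem extMul_zero (ξ : V →L[ℝ] ℝ) (a : AltForms V) : extMul ξ a 0 = 0 := rfl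

theorem extMul_succ (ξ : V →L[ℝ] ℝ) (a : AltForms V) (k : ℕ) : extMul ξ a (k + 1) =
    ContinuousAlternatingMap.alternatizeUncurryFin (ξ.smulRight (a k)) := rfl

theorem extMul_apply (ξ : V →L[ℝ] ℝ) (a : AltForms V) (k : ℕ) (v : Fin (k + 1) → V) :
    extMul ξ a (k + 1) v =
      ∑ i : Fin (k + 1), (-1 : ℝ) ^ (i : ℕ) * (ξ (v i) * a k (i.removeNth v)) :=
  extMulFun_apply ξ a k v

/-- Linear combinations of the operators `f w` are operators `f w`, for a linear family `f`. -/
theorem sum_smul_apply {W A ι : Type*} [AddCommGroup W] [Module ℝ W] [AddCommGroup A] [Module ℝ A]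
    (f : W →ₗ[ℝ] A →ₗ[ℝ] A) (s : Finset ι) (c : ι → ℝ) (w : ι → W) (a : A) :
    ∑ i ∈ s, c i • f (w i) a = f (∑ i ∈ s, c i • w i) a := by
  rw [map_sum, LinearMap.sum_apply]
  exact Finset.sum_congr rfl fun i _ => by rw [map_smul]; rfl

theorem extMul_eq_altSum (ξ : V →L[ℝ] ℝ) (a : AltForms V) (k : ℕ) (v : Fin (k + 1) → V) :
    extMul ξ a (k + 1) v =
      (k.factorial : ℝ)⁻¹ * altSum (fun w => ξ (w 0) * a k (w ∘ Fin.succ)) v := by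
  rw [extMul_succ, alternatizeUncurryFin_eq_altSum]
  rfl

/-- The relation `ι_X (ξ ∧ a) = ξ(X) a - ξ ∧ ι_X a`. -/
theorem contr_extMul (X : V) (ξ : V →L[ℝ] ℝ) (a : AltForms V) :
    contr X (extMul ξ a) = ξ X • a - extMul ξ (contr X a) := by
  funext k
  ext v
  change extMul ξ a (k + 1) (Matrix.vecCons X v) = ξ X * a k v - extMul ξ (contr X a) k v
  rw [extMul_apply, Fin.sum_univ_succ]
  congr 1
  · simp [Matrix.vecCons]
  · cases k with
    | zero => simp [extMul_zero]
    | succ k =>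
      rw [extMul_apply, ← Finset.sum_neg_distrib]
      refine Finset.sum_congr rfl fun i _ => ?_
      have : contr X a k (i.removeNth v) = a (k + 1) (i.succ.removeNth (Matrix.vecCons X v)) := by
        rw [contr_apply, ContinuousAlternatingMap.curryLeft_apply_apply]
        congr 1
        ext1 j
        refine Fin.cases ?_ (fun j => ?_) j
        · simp [Fin.removeNth]
        · simp [Fin.removeNth]
      rw [this]
      simp [pow_succ]

/-- A form of nonzero degree vanishes if its contractions with all vectors vanish. -/
theorem eq_zero_of_contr_eq_zero {k : ℤ} (hk : k ≠ 0) {a : AltForms V} (ha : a ∈ altDegree V k)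
    (h : ∀ X, contr X a = 0) : a = 0 := by
  funext j
  cases j with
  | zero => exact ha 0 fun h => hk (by simpa using h.symm)
  | succ j =>
    ext v
    have h1 := congrArg (fun f => f (Matrix.vecTail v)) (congrFun (h (Matrix.vecHead v)) j)
    rw [← Matrix.cons_head_tail v]
    exact h1

theorem contr_mem_altDegree {k l : ℤ} (h : l + 1 = k) (X : V) {a : AltForms V}
    (ha : a ∈ altDegree V k) : contr X a ∈ altDegree V l := fun j hj => by
  rw [contr_apply, ha (j + 1) (by push_cast; omega)]
  rfl

theorem extMul_mem_altDegree {k l : ℤ} (h : k + 1 = l) (ξ : V →L[ℝ] ℝ) {a : AltForms V}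
    (ha : a ∈ altDegree V k) : extMul ξ a ∈ altDegree V l := fun j hj => by
  cases j with
  | zero => rfl
  | succ j =>
    ext v
    rw [extMul_apply, ha j (by push_cast at hj; omega)]
    simp

theorem contr_eq_zero_of_degree_zero (X : V) {a : AltForms V} (ha : a ∈ altDegree V 0) :
    contr X a = 0 :=
  eq_zero_of_mem_altDegree_neg (k := -1) (by norm_num) (contr_mem_altDegree (by norm_num) X ha)

end Operators

section Lefschetz

variable {V : Type*} [NormedAddCommGroup V] [NormedSpace ℝ V]

theorem two_form_swap (σ : V [⋀^Fin 2]→L[ℝ] ℝ) (X Y : V) : σ ![X, Y] = -σ ![Y, X] := by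
  have h := σ.toAlternatingMap.map_swap ![Y, X] (i := 0) (j := 1) (by decide)
  have h2 : (![Y, X] ∘ Equiv.swap (0 : Fin 2) 1) = ![X, Y] := by
    ext i; fin_cases i <;> simp
  rw [h2] at h
  exact h

/-- The map `X ↦ ι_X σ`, with values in the continuous covectors. -/
noncomputable def flatL (σ : V [⋀^Fin 2]→L[ℝ] ℝ) : V →ₗ[ℝ] (V →L[ℝ] ℝ) where
  toFun X := ⟨flat σ X, continuous_flat σ X⟩
  map_add' X X' := by
    ext Y
    change flat σ (X + X') Y = flat σ X Y + flat σ X' Y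
    simp only [flat_apply]
    rw [two_form_swap, two_form_swap σ X, two_form_swap σ X']
    simp only [← flat_apply, map_add]
    ring
  map_smul' c X := by
    ext Y
    change flat σ (c • X) Y = c * flat σ X Y
    simp only [flat_apply]
    rw [two_form_swap, two_form_swap σ X]
    simp only [← flat_apply, map_smul, smul_eq_mul]
    ring

theorem flatL_apply (σ : V [⋀^Fin 2]→L[ℝ] ℝ) (X Y : V) : flatL σ X Y = σ ![X, Y] :=
  flat_apply σ X Y

theorem flatL_swap (σ : V [⋀^Fin 2]→L[ℝ] ℝ) (X Y : V) : flatL σ X Y = -flatL σ Y X := by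
  rw [flatL_apply, flatL_apply, two_form_swap]

/-- The Lefschetz operator `a ↦ a ∧ σ`. -/
noncomputable def lef (σ : V [⋀^Fin 2]→L[ℝ] ℝ) : AltForms V →ₗ[ℝ] AltForms V where
  toFun a k := match k with
    | 0 => 0
    | 1 => 0
    | k + 2 => wedge (a k) σ
  map_add' a b := funext fun k => by
    match k with
    | 0 => exact (add_zero _).symm
    | 1 => exact (add_zero _).symm
    | k + 2 => exact wedge_add_left _ _ _
  map_smul' c a := funext fun k => by
    match k with
    | 0 => exact (smul_zero c).symm
    | 1 => exact (smul_zero c).symm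
    | k + 2 => exact wedge_smul_left _ _ _

theorem lef_add_two (σ : V [⋀^Fin 2]→L[ℝ] ℝ) (a : AltForms V) (k : ℕ) :
    lef σ a (k + 2) = wedge (a k) σ := rfl

theorem lef_mem_altDegree (σ : V [⋀^Fin 2]→L[ℝ] ℝ) {k l : ℤ} (h : k + 2 = l) {a : AltForms V}
    (ha : a ∈ altDegree V k) : lef σ a ∈ altDegree V l := fun j hj => by
  match j with
  | 0 => rfl
  | 1 => rfl
  | j + 2 =>
    rw [lef_add_two, ha j (by push_cast at hj; omega), ← zero_smul ℝ (0 : V [⋀^Fin j]→L[ℝ] ℝ),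
      wedge_smul_left, zero_smul]

theorem lef_pow_mem_altDegree (σ : V [⋀^Fin 2]→L[ℝ] ℝ) (j : ℕ) {k l : ℤ} (h : k + 2 * j = l)
    {a : AltForms V} (ha : a ∈ altDegree V k) : (lef σ ^ j) a ∈ altDegree V l := by
  induction j generalizing l with
  | zero => obtain rfl : k = l := by simpa using h
            simpa using ha
  | succ j ih =>
    rw [pow_succ', Module.End.mul_apply]
    exact lef_mem_altDegree σ (by push_cast at h; omega) (ih rfl)

/-- The antisymmetrisations over the first covector and over the remaining arguments merge into one. -/
theorem extMul_extMul_apply (ξ η : V →L[ℝ] ℝ) (a : AltForms V) (k : ℕ) (v : Fin (k + 2) → V) :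
    extMul ξ (extMul η a) (k + 2) v = (k.factorial : ℝ)⁻¹ *
      altSum (fun w : Fin (k + 1 + 1) → V => ξ (w 0) * (η (w 1) * a k ((w ∘ Fin.succ) ∘ Fin.succ))) v := by
  rw [extMul_eq_altSum]
  simp only [extMul_eq_altSum]
  have hk : ((k + 1).factorial : ℝ) ≠ 0 := by positivity
  have h := altSum_succ (fun x (u : Fin (k + 1) → V) => ξ x * (η (u 0) * a k (u ∘ Fin.succ))) v
  have h2 : (fun w : Fin (k + 1 + 1) → V => ξ (w 0) * ((k.factorial : ℝ)⁻¹ *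
      altSum (fun u : Fin (k + 1) → V => η (u 0) * a k (u ∘ Fin.succ)) (w ∘ Fin.succ))) =
      fun w => (k.factorial : ℝ)⁻¹ * altSum (fun u : Fin (k + 1) → V =>
        ξ (w 0) * (η (u 0) * a k (u ∘ Fin.succ))) (w ∘ Fin.succ) := by
    ext w
    rw [altSum_mul]
    ring
  rw [h2, altSum_mul, h]
  field_simp
  rfl

/-- The value of `α ∧ σ`, with the arguments of `σ` moved to the front: a two-fold cyclic rotation of
the arguments is an even permutation. -/
theorem wedge_two_form_apply {k : ℕ} (α : V [⋀^Fin k]→L[ℝ] ℝ) (σ : V [⋀^Fin 2]→L[ℝ] ℝ)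
    (v : Fin (k + 2) → V) : wedge α σ v = (k.factorial : ℝ)⁻¹ * 2⁻¹ *
      altSum (fun w : Fin (k + 1 + 1) → V => σ ![w 0, w 1] * α ((w ∘ Fin.succ) ∘ Fin.succ)) v := by
  rw [wedge_apply, mul_inv, Nat.factorial_two, Nat.cast_ofNat]
  congr 1
  have h := altSum_perm (fun w : Fin (k + 2) → V =>
    α (w ∘ Fin.castAdd 2) * σ (w ∘ Fin.natAdd k)) (finRotate (k + 2) * finRotate (k + 2)) v
  rw [Equiv.Perm.sign_mul, Int.units_mul_self, Units.val_one, Int.cast_one, one_mul] at h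
  rw [← h]
  congr 1
  ext w
  rw [mul_comm]
  congr 2
  · ext i
    fin_cases i
    · change w _ = w 0
      congr 1
      change finRotate (k + 1 + 1) (finRotate (k + 1 + 1) _) = 0
      change finRotate (k + 1 + 1) (finRotate (k + 1 + 1) ⟨k, by omega⟩) = 0
      rw [finRotate_of_lt (by omega : k < k + 1)]
      exact finRotate_last
    · change w _ = w 1
      congr 1
      change finRotate (k + 1 + 1) (finRotate (k + 1 + 1) (Fin.last (k + 1))) = 1
      rw [finRotate_last]
      simp
  · ext i
    change w _ = w _
    congr 1
    have hi := i.2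
    change finRotate (k + 1 + 1) (finRotate (k + 1 + 1) ⟨i, by omega⟩) = _
    rw [finRotate_of_lt (by omega : (i : ℕ) < k + 1),
      finRotate_of_lt (by omega : (i : ℕ) + 1 < k + 1)]
    rfl

end Lefschetz

end TransverseLefschetz

/-! ### Commutation relations and injectivity of the Lefschetz operator -/

namespace TransverseLefschetz

section Commutation

variable {V : Type*} [NormedAddCommGroup V] [NormedSpace ℝ V]

/-- An operator on forms which commutes with the contractions up to scalars vanishes as soon as its
values have no component of degree zero. -/
theorem eq_zero_of_contr_comm {N : AltForms V → AltForms V} (c : ℝ)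
    (h : ∀ X a, contr X (N a) = c • N (contr X a)) (h0 : ∀ a, N a 0 = 0) (a : AltForms V) :
    N a = 0 := by
  have key : ∀ k a, N a k = 0 := by
    intro k
    induction k with
    | zero => exact h0
    | succ k ih =>
      intro a
      ext v
      have h1 := congrArg (fun f => f (Matrix.vecTail v)) (congrFun (h (Matrix.vecHead v) a) k)
      rw [AltForms.smul_apply, ih, smul_zero] at h1
      rw [← Matrix.cons_head_tail v]
      exact h1
  exact funext fun k => key k a

theorem contr_contr (X Y : V) (a : AltForms V) : contr X (contr Y a) = -contr Y (contr X a) := by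
  funext k
  ext v
  have h := (a (k + 2)).toAlternatingMap.map_swap (Matrix.vecCons X (Matrix.vecCons Y v))
    (i := 0) (j := 1) (by simp)
  have h2 : (Matrix.vecCons X (Matrix.vecCons Y v) ∘ Equiv.swap 0 1) =
      Matrix.vecCons Y (Matrix.vecCons X v) := by
    ext1 i
    refine Fin.cases ?_ (fun i => Fin.cases ?_ (fun i => ?_) i) i
    · simp
    · change Matrix.vecCons X (Matrix.vecCons Y v) (Equiv.swap 0 1 1) = _
      simp
    · rw [Function.comp_apply, Equiv.swap_apply_of_ne_of_ne (Fin.succ_ne_zero _)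
        (fun h => by simp [Fin.ext_iff] at h)]
      simp
  rw [h2] at h
  exact h

theorem extMul_extMul (ξ η : V →L[ℝ] ℝ) (a : AltForms V) :
    extMul ξ (extMul η a) = -extMul η (extMul ξ a) := by
  rw [eq_neg_iff_add_eq_zero]
  refine eq_zero_of_contr_comm (N := fun a => extMul ξ (extMul η a) + extMul η (extMul ξ a)) 1
    (fun X a => ?_) (fun a => ?_) a
  · simp only [map_add, contr_extMul, map_sub, map_smul, one_smul]
    abel
  · change extMul ξ (extMul η a) 0 + extMul η (extMul ξ a) 0 = 0
    rw [extMul_zero, extMul_zero, add_zero]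

variable [FiniteDimensional ℝ V]

/-- In a basis, `a ∧ σ` is half the sum of the forms `bᵢ* ∧ ι_{bᵢ}σ ∧ a`. -/
theorem lef_eq_sum (σ : V [⋀^Fin 2]→L[ℝ] ℝ) {ι : Type*} [Fintype ι] (b : Module.Basis ι ℝ V)
    (a : AltForms V) : lef σ a = (2 : ℝ)⁻¹ • ∑ i,
      extMul (LinearMap.toContinuousLinearMap (b.coord i)) (extMul (flatL σ (b i)) a) := by
  funext k
  match k with
  | 0 =>
    rw [AltForms.smul_apply, AltForms.sum_apply, Finset.sum_eq_zero fun i _ => extMul_zero _ _,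
      smul_zero]
    rfl
  | 1 =>
    rw [AltForms.smul_apply, AltForms.sum_apply, Finset.sum_eq_zero, smul_zero]
    · rfl
    · intro i _
      ext v
      rw [extMul_apply]
      simp [extMul_zero]
  | k + 2 =>
    ext v
    rw [lef_add_two, wedge_two_form_apply, AltForms.smul_apply, AltForms.sum_apply,
      ContinuousAlternatingMap.smul_apply, ContinuousAlternatingMap.sum_apply]
    simp only [extMul_extMul_apply]
    rw [← Finset.mul_sum, ← altSum_sum, smul_eq_mul, mul_comm _ (2 : ℝ)⁻¹, mul_assoc]
    congr 3
    ext w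
    simp only [← mul_assoc]
    rw [← Finset.sum_mul]
    congr 1
    rw [← flatL_apply]
    conv_lhs => rw [← b.sum_repr (w 0), map_sum, _root_.sum_apply]
    simp

/-- The relation `ι_X (a ∧ σ) = ι_X a ∧ σ + ι_X σ ∧ a`. -/
theorem contr_lef (σ : V [⋀^Fin 2]→L[ℝ] ℝ) (X : V) (a : AltForms V) :
    contr X (lef σ a) = lef σ (contr X a) + extMul (flatL σ X) a := by
  let b := Module.finBasis ℝ V
  have h1 : ∑ i, b.coord i X • extMul (flatL σ (b i)) a = extMul (flatL σ X) a := by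
    rw [sum_smul_apply extMul]
    congr 2
    conv_rhs => rw [← b.sum_repr X, map_sum]
    exact Finset.sum_congr rfl fun i _ => by rw [map_smul, Module.Basis.coord_apply]
  have h2 : ∑ i, flatL σ (b i) X • extMul (LinearMap.toContinuousLinearMap (b.coord i)) a =
      -extMul (flatL σ X) a := by
    rw [sum_smul_apply extMul, ← LinearMap.neg_apply, ← map_neg]
    congr 2
    ext Y
    rw [_root_.neg_apply]
    conv_rhs => rw [← b.sum_repr Y]
    simp only [_root_.sum_apply, map_sum, map_smul, smul_eq_mul,
      _root_.smul_apply, LinearMap.coe_toContinuousLinearMap', Module.Basis.coord_apply]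
    rw [← Finset.sum_neg_distrib]
    refine Finset.sum_congr rfl fun i _ => ?_
    rw [flatL_swap σ X]
    ring
  rw [lef_eq_sum σ b, lef_eq_sum σ b, map_smul, map_sum]
  simp only [contr_extMul, map_sub, map_smul, Finset.sum_sub_distrib, sub_sub_eq_add_sub]
  simp only [LinearMap.coe_toContinuousLinearMap']
  rw [Finset.sum_add_distrib, h1, h2]
  module

theorem extMul_lef (σ : V [⋀^Fin 2]→L[ℝ] ℝ) (ξ : V →L[ℝ] ℝ) (a : AltForms V) :
    extMul ξ (lef σ a) = lef σ (extMul ξ a) := by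
  rw [← sub_eq_zero]
  refine eq_zero_of_contr_comm (N := fun a => extMul ξ (lef σ a) - lef σ (extMul ξ a)) (-1)
    (fun X a => ?_) (fun a => ?_) a
  · simp only [map_add, map_sub, contr_extMul, contr_lef, map_smul]
    rw [extMul_extMul ξ]
    module
  · exact sub_self (0 : V [⋀^Fin 0]→L[ℝ] ℝ)

theorem extMul_lef_pow (σ : V [⋀^Fin 2]→L[ℝ] ℝ) (ξ : V →L[ℝ] ℝ) (j : ℕ) (a : AltForms V) :
    extMul ξ ((lef σ ^ j) a) = (lef σ ^ j) (extMul ξ a) := by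
  induction j with
  | zero => simp
  | succ j ih => rw [pow_succ', Module.End.mul_apply, extMul_lef, ih, Module.End.mul_apply]

/-- The relation `ι_X (a ∧ σ^(j+1)) = ι_X a ∧ σ^(j+1) + (j+1) ι_X σ ∧ a ∧ σ^j`. -/
theorem contr_lef_pow_succ (σ : V [⋀^Fin 2]→L[ℝ] ℝ) (X : V) (j : ℕ) (a : AltForms V) :
    contr X ((lef σ ^ (j + 1)) a) = (lef σ ^ (j + 1)) (contr X a) +
      ((j : ℝ) + 1) • (lef σ ^ j) (extMul (flatL σ X) a) := by
  induction j with
  | zero => simp [contr_lef]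
  | succ j ih =>
    rw [pow_succ' _ (j + 1), Module.End.mul_apply, contr_lef, ih, map_add, map_smul, extMul_lef_pow,
      Module.End.mul_apply, pow_succ' _ j, Module.End.mul_apply, Module.End.mul_apply]
    push_cast
    module

end Commutation

section Horizontal

variable {V : Type*} [NormedAddCommGroup V] [NormedSpace ℝ V]

/-- The forms whose contractions with the vectors in the kernel of `σ` vanish. -/
def horizontal (σ : V [⋀^Fin 2]→L[ℝ] ℝ) : Submodule ℝ (AltForms V) where
  carrier := {a | ∀ X, flatL σ X = 0 → contr X a = 0}
  zero_mem' := fun X _ => map_zero _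
  add_mem' := fun ha hb X hX => by rw [map_add, ha X hX, hb X hX, add_zero]
  smul_mem' := fun c a ha X hX => by rw [map_smul, ha X hX, smul_zero]

theorem contr_mem_horizontal {σ : V [⋀^Fin 2]→L[ℝ] ℝ} {a : AltForms V} (ha : a ∈ horizontal σ)
    (X : V) : contr X a ∈ horizontal σ := fun Y hY => by
  rw [contr_contr, ha Y hY, map_zero, neg_zero]

theorem extMul_mem_horizontal {σ : V [⋀^Fin 2]→L[ℝ] ℝ} {a : AltForms V} (ha : a ∈ horizontal σ)
    (X : V) : extMul (flatL σ X) a ∈ horizontal σ := fun Y hY => by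
  rw [contr_extMul, ha Y hY, map_zero, flatL_swap, hY]
  simp

/-- The constant function `1`, as a form of degree zero. -/
noncomputable def oneForm (V : Type*) [NormedAddCommGroup V] [NormedSpace ℝ V] : AltForms V :=
  AltForms.single 0 (ContinuousAlternatingMap.constOfIsEmpty ℝ V (Fin 0) 1)

theorem oneForm_mem_altDegree : oneForm V ∈ altDegree V 0 :=
  single_mem_altDegree (by simp) _

theorem eq_smul_oneForm {a : AltForms V} (ha : a ∈ altDegree V 0) : a = (a 0 0) • oneForm V := by
  conv_lhs => rw [eq_single_of_mem_altDegree (j := 0) (by simp) ha]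
  funext j
  cases j with
  | zero =>
    rw [AltForms.single_same, AltForms.smul_apply, oneForm, AltForms.single_same]
    ext v
    rw [Subsingleton.elim v 0]
    simp
  | succ j =>
    rw [AltForms.single_of_ne (by simp), AltForms.smul_apply, oneForm,
      AltForms.single_of_ne (by simp), smul_zero]

theorem oneForm_ne_zero : oneForm V ≠ 0 := fun h => by
  have h1 := congrArg (fun f => f 0) (congrFun h 0)
  rw [oneForm, AltForms.single_same] at h1
  simp [AltForms.zero_apply] at h1

theorem oneForm_mem_horizontal (σ : V [⋀^Fin 2]→L[ℝ] ℝ) : oneForm V ∈ horizontal σ :=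
  fun X _ => contr_eq_zero_of_degree_zero X oneForm_mem_altDegree

/-- Vectors `Yᵢ` and `Zᵢ` such that the `Yᵢ` form a basis of a complement of the kernel of `σ`, and
the covectors `ι_{Zᵢ}σ` are the dual coordinates; only the two consequences used below are
recorded. -/
structure IsFrame (σ : V [⋀^Fin 2]→L[ℝ] ℝ) (n : ℕ) (Y Z : Fin (2 * n) → V) : Prop where
  expand : ∀ v, flatL σ (∑ i, flatL σ (Z i) v • Y i) = flatL σ v
  trace : ∑ i, flatL σ (Z i) (Y i) = 2 * n

/-- The rank of `σ` is `2n`. -/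
def HasFrame (σ : V [⋀^Fin 2]→L[ℝ] ℝ) (n : ℕ) : Prop := ∃ Y Z, IsFrame σ n Y Z

variable {σ : V [⋀^Fin 2]→L[ℝ] ℝ} {n : ℕ} {Y Z : Fin (2 * n) → V}

/-- Euler's formula `∑ᵢ ι_{Zᵢ}σ ∧ ι_{Yᵢ} a = k a` for horizontal forms of degree `k`. -/
theorem IsFrame.euler (hf : IsFrame σ n Y Z) (k : ℕ) {a : AltForms V}
    (ha : a ∈ altDegree V k) (hh : a ∈ horizontal σ) :
    ∑ i, extMul (flatL σ (Z i)) (contr (Y i) a) = (k : ℝ) • a := by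
  induction k generalizing a with
  | zero =>
    rw [Finset.sum_eq_zero]
    · simp
    · intro i _
      rw [contr_eq_zero_of_degree_zero _ (by simpa using ha), map_zero]
  | succ k ih =>
    rw [← sub_eq_zero]
    refine eq_zero_of_contr_eq_zero (k := ((k + 1 : ℕ) : ℤ)) (by positivity) ?_ fun X => ?_
    · refine Submodule.sub_mem _ (Submodule.sum_mem _ fun i _ => ?_) (Submodule.smul_mem _ _ ha)
      exact extMul_mem_altDegree rfl _ (contr_mem_altDegree (by push_cast; ring) _ ha)
    · have h1 := ih (contr_mem_altDegree (l := (k : ℤ)) (by push_cast; ring) X ha)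
        (contr_mem_horizontal hh X)
      have h2 : ∑ i, flatL σ (Z i) X • contr (Y i) a = contr X a := by
        rw [sum_smul_apply contr, ← sub_eq_zero, ← LinearMap.sub_apply, ← map_sub]
        exact hh _ (by rw [map_sub, hf.expand, sub_self])
      simp only [map_sub, map_sum, contr_extMul, Finset.sum_sub_distrib, map_smul]
      have h3 : ∑ i, extMul (flatL σ (Z i)) (contr X (contr (Y i) a)) = -((k : ℝ) • contr X a) := by
        rw [← h1, ← Finset.sum_neg_distrib]
        refine Finset.sum_congr rfl fun i _ => ?_
        rw [contr_contr, map_neg]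
      rw [h2, h3]
      push_cast
      module

/-- A horizontal form of degree less than `2n` vanishes if its products with all horizontal
covectors vanish. -/
theorem HasFrame.eq_zero_of_extMul_eq_zero (hf : HasFrame σ n) {k : ℕ} (hk : k < 2 * n)
    {a : AltForms V} (ha : a ∈ altDegree V k) (hh : a ∈ horizontal σ)
    (h : ∀ X, extMul (flatL σ X) a = 0) : a = 0 := by
  obtain ⟨Y, Z, hf⟩ := hf
  have h1 : ∑ i, contr (Y i) (extMul (flatL σ (Z i)) a) = ((2 * n : ℝ) - k) • a := by
    simp only [contr_extMul, Finset.sum_sub_distrib]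
    rw [hf.euler k ha hh, ← Finset.sum_smul, hf.trace, ← sub_smul]
  simp only [h, map_zero, Finset.sum_const_zero] at h1
  refine (smul_eq_zero.1 h1.symm).resolve_left ?_
  have : (k : ℝ) < 2 * n := by exact_mod_cast hk
  linarith

theorem apply_eq_zero_of_mem_horizontal {a : AltForms V} (hh : a ∈ horizontal σ) {k : ℕ}
    {v : Fin k → V} (i : Fin k) (hi : flatL σ (v i) = 0) : a k v = 0 := by
  cases k with
  | zero => exact i.elim0
  | succ k =>
    have h1 := congrArg (fun f => f (i.removeNth v)) (congrFun (hh _ hi) k)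
    have h2 := (a (k + 1)).toAlternatingMap.map_insertNth i (v i) (i.removeNth v)
    rw [Fin.insertNth_self_removeNth] at h2
    have h3 : (a (k + 1)).toAlternatingMap (Matrix.vecCons (v i) (i.removeNth v)) = 0 := h1
    rw [h3, smul_zero] at h2
    exact h2

/-- There are no horizontal forms of degree greater than `2n`: more than `2n` vectors are linearly
dependent modulo the kernel of `σ`. -/
theorem HasFrame.eq_zero_of_lt (hf : HasFrame σ n) {k : ℤ} (hk : 2 * n < k)
    {a : AltForms V} (ha : a ∈ altDegree V k) (hh : a ∈ horizontal σ) : a = 0 := by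
  obtain ⟨Y, Z, hf⟩ := hf
  funext j
  by_cases hj : (j : ℤ) = k
  swap
  · exact ha j hj
  ext v
  have hdep : ¬ LinearIndependent ℝ (fun (j : Fin j) (i : Fin (2 * n)) => flatL σ (Z i) (v j)) := by
    intro h
    have := h.fintype_card_le_finrank
    simp at this
    omega
  rw [Fintype.not_linearIndependent_iff] at hdep
  obtain ⟨c, hc, j₀, hj₀⟩ := hdep
  have hu : flatL σ (∑ j, c j • v j) = 0 := by
    rw [← hf.expand]
    have : ∀ i, flatL σ (Z i) (∑ j, c j • v j) = 0 := fun i => by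
      have := congrFun hc i
      simpa using this
    simp only [this, zero_smul, Finset.sum_const_zero, map_zero]
  have h1 : a j (Function.update v j₀ (∑ j, c j • v j)) = 0 :=
    apply_eq_zero_of_mem_horizontal hh j₀ (by rw [Function.update_self]; exact hu)
  have h2 : a j (Function.update v j₀ (∑ j, c j • v j)) = c j₀ * a j v := by
    have h3 : a j (Function.update v j₀ (∑ j, c j • v j)) =
        ∑ i, a j (Function.update v j₀ (c i • v i)) :=
      (a j).toAlternatingMap.map_update_sum Finset.univ j₀ (fun i => c i • v i) v
    rw [h3, Finset.sum_eq_single j₀]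
    · have h4 := (a j).toAlternatingMap.map_update_smul v j₀ (c j₀) (v j₀)
      rw [Function.update_eq_self] at h4
      exact h4
    · intro i _ hi
      have h4 := (a j).toAlternatingMap.map_update_smul v j₀ (c i) (v i)
      rw [(a j).toAlternatingMap.map_update_self v hi.symm, smul_zero] at h4
      exact h4
    · simp
  rw [h2] at h1
  exact (mul_eq_zero.1 h1).resolve_left hj₀

variable [FiniteDimensional ℝ V]

theorem lef_mem_horizontal {a : AltForms V} (ha : a ∈ horizontal σ) :
    lef σ a ∈ horizontal σ := fun X hX => by
  rw [contr_lef, ha X hX, hX]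
  simp

theorem lef_pow_mem_horizontal (j : ℕ) {a : AltForms V} (ha : a ∈ horizontal σ) :
    (lef σ ^ j) a ∈ horizontal σ := by
  induction j with
  | zero => simpa using ha
  | succ j ih =>
    rw [pow_succ', Module.End.mul_apply]
    exact lef_mem_horizontal ih

/-- The powers `σ^j` with `j ≤ n` do not vanish: otherwise take the first one which does, and
contract it with all vectors. -/
theorem HasFrame.lef_pow_oneForm_ne_zero (hf : HasFrame σ n) {j : ℕ} (hj : j ≤ n) :
    (lef σ ^ j) (oneForm V) ≠ 0 := by
  induction j with
  | zero => simpa using oneForm_ne_zero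
  | succ j ih =>
    intro h
    refine ih (by omega) (hf.eq_zero_of_extMul_eq_zero (k := 2 * j) (by omega)
      (lef_pow_mem_altDegree σ j (by push_cast; ring) oneForm_mem_altDegree)
      (lef_pow_mem_horizontal j (oneForm_mem_horizontal σ)) fun X => ?_)
    have h1 := contr_lef_pow_succ σ X j (oneForm V)
    rw [h, map_zero, contr_eq_zero_of_degree_zero X oneForm_mem_altDegree, map_zero, zero_add,
      ← extMul_lef_pow] at h1
    exact (smul_eq_zero.1 h1.symm).resolve_left (by positivity)

/-- If `σⁿ ≠ 0`, then `a ↦ a ∧ σ^j` is injective on the `k`-forms, horizontal or not, for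
`k + j ≤ n`: if `a ∧ σ^j = 0`, then `ι_X a ∧ σ^(j+1) = 0`, which lowers the degree to zero. -/
theorem lef_pow_injective (hσ : (lef σ ^ n) (oneForm V) ≠ 0) {k : ℤ} {j : ℕ} (hk : k + j ≤ n)
    {a : AltForms V} (ha : a ∈ altDegree V k) (h : (lef σ ^ j) a = 0) : a = 0 := by
  have key : ∀ (k j : ℕ), k + j = n → ∀ a ∈ altDegree V k, (lef σ ^ j) a = 0 → a = 0 := by
    intro k
    induction k with
    | zero =>
      intro j hj a ha h
      obtain rfl : j = n := by omega
      have ha' := eq_smul_oneForm (by simpa using ha)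
      rw [ha'] at h ⊢
      rw [map_smul, smul_eq_zero] at h
      rw [h.resolve_right hσ, zero_smul]
    | succ k ih =>
      intro j hj a ha h
      refine eq_zero_of_contr_eq_zero (by positivity) ha fun X =>
        ih (j + 1) (by omega) _ (contr_mem_altDegree (by push_cast; ring) X ha) ?_
      have h1 := contr_lef_pow_succ σ X j a
      rw [pow_succ', Module.End.mul_apply, h, map_zero, map_zero, ← pow_succ',
        ← extMul_lef_pow, h, map_zero, smul_zero, add_zero] at h1
      exact h1.symm
  by_cases hk0 : k < 0
  · exact eq_zero_of_mem_altDegree_neg hk0 ha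
  lift k to ℕ using by omega
  refine key k (n - k) (by omega) a ha ?_
  rw [show n - k = (n - k - j) + j by omega, pow_add, Module.End.mul_apply, h, map_zero]

end Horizontal

end TransverseLefschetz

/-! ### Primitive forms and Weil's formula -/

namespace TransverseLefschetz

section Primitive

variable {V : Type*} [NormedAddCommGroup V] [NormedSpace ℝ V]

/-- The primitive `k`-forms: the horizontal forms `a` with `a ∧ σ^(n-k+1) = 0`. With the convention
that the exponent is `0` for `k > n`, there are no nonzero primitive forms in these degrees. -/
noncomputable def prim (σ : V [⋀^Fin 2]→L[ℝ] ℝ) (n : ℕ) (k : ℤ) : Submodule ℝ (AltForms V) :=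
  altDegree V k ⊓ horizontal σ ⊓ LinearMap.ker (lef σ ^ (n + 1 - k : ℤ).toNat)

variable {σ : V [⋀^Fin 2]→L[ℝ] ℝ} {n : ℕ}

theorem mem_prim {k : ℤ} {a : AltForms V} : a ∈ prim σ n k ↔
    a ∈ altDegree V k ∧ a ∈ horizontal σ ∧ (lef σ ^ (n + 1 - k : ℤ).toNat) a = 0 := by
  simp [prim, and_assoc]

theorem eq_zero_of_mem_prim {k : ℤ} (hk : n < k) {a : AltForms V} (ha : a ∈ prim σ n k) : a = 0 := by
  have h := (mem_prim.1 ha).2.2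
  rwa [show (n + 1 - k : ℤ).toNat = 0 by omega, pow_zero] at h

theorem lef_pow_eq_zero_of_mem_prim {k : ℤ} {j : ℕ} (hj : n < k + j) {a : AltForms V}
    (ha : a ∈ prim σ n k) : (lef σ ^ j) a = 0 := by
  have h := (mem_prim.1 ha).2.2
  rw [show j = (j - (n + 1 - k : ℤ).toNat) + (n + 1 - k : ℤ).toNat by omega, pow_add,
    Module.End.mul_apply, h, map_zero]

variable [FiniteDimensional ℝ V]

theorem contr_mem_prim {k l : ℤ} (hl : l + 1 = k) {a : AltForms V} (ha : a ∈ prim σ n k) (X : V) :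
    contr X a ∈ prim σ n l := by
  by_cases hk : n + 1 < k
  · rw [eq_zero_of_mem_prim (by omega) ha, map_zero]
    exact Submodule.zero_mem _
  obtain ⟨h1, h2, h3⟩ := mem_prim.1 ha
  refine mem_prim.2 ⟨contr_mem_altDegree hl X h1, contr_mem_horizontal h2 X, ?_⟩
  rw [show (n + 1 - l : ℤ).toNat = (n + 1 - k : ℤ).toNat + 1 by omega]
  have h := contr_lef_pow_succ σ X (n + 1 - k : ℤ).toNat a
  rw [pow_succ', Module.End.mul_apply, h3, map_zero, map_zero, ← pow_succ', ← extMul_lef_pow, h3,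
    map_zero, smul_zero, add_zero] at h
  exact h.symm

/-- The primitive part of `ι_X σ ∧ a`, for a primitive form `a` of degree `n - m`. -/
noncomputable def primExt (σ : V [⋀^Fin 2]→L[ℝ] ℝ) (X : V) (m : ℕ) (a : AltForms V) : AltForms V :=
  extMul (flatL σ X) a + ((m : ℝ) + 1)⁻¹ • lef σ (contr X a)

/-- By `contr_lef_pow_succ`, the correction term in `primExt` cancels `ι_X σ ∧ a ∧ σ^m`. -/
theorem primExt_mem_prim {k l : ℤ} {m : ℕ} (hl : k + 1 = l) (hm : k + m = n) {a : AltForms V}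
    (ha : a ∈ prim σ n k) (X : V) : primExt σ X m a ∈ prim σ n l := by
  obtain ⟨h1, h2, h3⟩ := mem_prim.1 ha
  refine mem_prim.2 ⟨?_, ?_, ?_⟩
  · exact Submodule.add_mem _ (extMul_mem_altDegree hl _ h1) (Submodule.smul_mem _ _
      (lef_mem_altDegree σ (k := k - 1) (by omega) (contr_mem_altDegree (by omega) X h1)))
  · exact Submodule.add_mem _ (extMul_mem_horizontal h2 X) (Submodule.smul_mem _ _
      (lef_mem_horizontal (contr_mem_horizontal h2 X)))
  · rw [show (n + 1 - k : ℤ).toNat = m + 1 by omega] at h3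
    rw [show (n + 1 - l : ℤ).toNat = m by omega]
    have h := contr_lef_pow_succ σ X m a
    rw [h3, map_zero, pow_succ, Module.End.mul_apply] at h
    have hm : (m : ℝ) + 1 ≠ 0 := by positivity
    rw [primExt, map_add, map_smul, eq_neg_of_add_eq_zero_left h.symm, smul_neg,
      smul_smul, inv_mul_cancel₀ hm, one_smul, add_neg_cancel]

theorem extMul_lef_pow_eq (X : V) (m j : ℕ) (a : AltForms V) :
    extMul (flatL σ X) ((lef σ ^ j) a) = (lef σ ^ j) (primExt σ X m a) -
      ((m : ℝ) + 1)⁻¹ • (lef σ ^ (j + 1)) (contr X a) := by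
  rw [primExt, map_add, map_smul, extMul_lef_pow, pow_succ, Module.End.mul_apply]
  abel

/-- The span of the forms `a ∧ σ^j` of degree `m` with `a` primitive. -/
noncomputable def primSpan (σ : V [⋀^Fin 2]→L[ℝ] ℝ) (n : ℕ) (m : ℤ) : Submodule ℝ (AltForms V) :=
  Submodule.span ℝ {b | ∃ (k : ℤ) (j : ℕ), k + 2 * j = m ∧ ∃ a ∈ prim σ n k, b = (lef σ ^ j) a}

theorem extMul_mem_primSpan {m l : ℤ} (hl : m + 1 = l) {b : AltForms V} (hb : b ∈ primSpan σ n m)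
    (X : V) : extMul (flatL σ X) b ∈ primSpan σ n l := by
  induction hb using Submodule.span_induction with
  | zero => rw [map_zero]; exact Submodule.zero_mem _
  | add x y _ _ hx hy => rw [map_add]; exact Submodule.add_mem _ hx hy
  | smul c x _ hx => rw [map_smul]; exact Submodule.smul_mem _ _ hx
  | mem b hb =>
    obtain ⟨k, j, hkj, a, ha, rfl⟩ := hb
    by_cases hk : n < k
    · rw [eq_zero_of_mem_prim hk ha, map_zero, map_zero]
      exact Submodule.zero_mem _
    · rw [extMul_lef_pow_eq X (n - k : ℤ).toNat]
      refine Submodule.sub_mem _ (Submodule.subset_span ?_)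
        (Submodule.smul_mem _ _ (Submodule.subset_span ?_))
      · exact ⟨k + 1, j, by omega, _, primExt_mem_prim rfl (by omega) ha X, rfl⟩
      · exact ⟨k - 1, j + 1, by push_cast; omega, _, contr_mem_prim (by omega) ha X, rfl⟩

/-- The Lefschetz decomposition of the horizontal forms: by Euler's formula, they are generated by the
functions under exterior multiplication with horizontal covectors. -/
theorem mem_primSpan (hσ : HasFrame σ n) {m : ℕ} {a : AltForms V} (ha : a ∈ altDegree V m)
    (hh : a ∈ horizontal σ) : a ∈ primSpan σ n m := by
  induction m generalizing a with
  | zero =>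
    have h0 := eq_smul_oneForm (by simpa using ha)
    rw [h0]
    refine Submodule.smul_mem _ _ (Submodule.subset_span ⟨0, 0, by simp, oneForm V, ?_, by simp⟩)
    exact mem_prim.2 ⟨oneForm_mem_altDegree, oneForm_mem_horizontal σ,
      hσ.eq_zero_of_lt (k := 2 * (n + 1)) (by omega)
        (lef_pow_mem_altDegree σ _ (by simp) oneForm_mem_altDegree)
        (lef_pow_mem_horizontal _ (oneForm_mem_horizontal σ))⟩
  | succ m ih =>
    obtain ⟨Y, Z, hf⟩ := hσ
    have h := hf.euler (m + 1) ha hh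
    have hm : ((m + 1 : ℕ) : ℝ) ≠ 0 := by positivity
    rw [← inv_smul_smul₀ hm a, ← h]
    refine Submodule.smul_mem _ _ (Submodule.sum_mem _ fun i _ => ?_)
    exact extMul_mem_primSpan (by push_cast; ring)
      (ih (contr_mem_altDegree (by push_cast; ring) _ ha) (contr_mem_horizontal hh _)) _

/-- Every horizontal form of degree `n + j` is of the form `b ∧ σ^j`. -/
theorem exists_lef_pow_eq (hσ : HasFrame σ n) {j : ℕ} {a : AltForms V}
    (ha : a ∈ altDegree V (n + j : ℕ)) (hh : a ∈ horizontal σ) :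
    ∃ b ∈ altDegree V (n - j : ℤ), b ∈ horizontal σ ∧ (lef σ ^ j) b = a := by
  have h := mem_primSpan hσ ha hh
  clear ha hh
  induction h using Submodule.span_induction with
  | zero => exact ⟨0, Submodule.zero_mem _, Submodule.zero_mem _, map_zero _⟩
  | add x y _ _ hx hy =>
    obtain ⟨b, h1, h2, rfl⟩ := hx
    obtain ⟨b', h1', h2', rfl⟩ := hy
    exact ⟨b + b', Submodule.add_mem _ h1 h1', Submodule.add_mem _ h2 h2', map_add _ _ _⟩
  | smul c x _ hx =>
    obtain ⟨b, h1, h2, rfl⟩ := hx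
    exact ⟨c • b, Submodule.smul_mem _ _ h1, Submodule.smul_mem _ _ h2, map_smul _ _ _⟩
  | mem b hb =>
    obtain ⟨k, i, hki, a, ha, rfl⟩ := hb
    by_cases hij : j ≤ i
    · obtain ⟨h1, h2, -⟩ := mem_prim.1 ha
      refine ⟨(lef σ ^ (i - j)) a, lef_pow_mem_altDegree σ _ (by push_cast at *; omega) h1,
        lef_pow_mem_horizontal _ h2, ?_⟩
      rw [← Module.End.mul_apply, ← pow_add, show j + (i - j) = i by omega]
    · refine ⟨0, Submodule.zero_mem _, Submodule.zero_mem _, ?_⟩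
      rw [lef_pow_eq_zero_of_mem_prim (by push_cast at *; omega) ha, map_zero]

end Primitive

section Star

variable {V : Type*} [NormedAddCommGroup V] [NormedSpace ℝ V]

/-- The exterior product `ι_{X₁}σ ∧ ⋯ ∧ ι_{X_K}σ ∧ ·`. -/
noncomputable def extMulVec (σ : V [⋀^Fin 2]→L[ℝ] ℝ) :
    {K : ℕ} → (Fin K → V) → AltForms V →ₗ[ℝ] AltForms V
  | 0, _ => LinearMap.id
  | _ + 1, X => extMul (flatL σ (X 0)) ∘ₗ extMulVec σ (X ∘ Fin.succ)

variable {σ : V [⋀^Fin 2]→L[ℝ] ℝ} {n : ℕ}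

theorem extMulVec_succ {K : ℕ} (X : Fin (K + 1) → V) (a : AltForms V) :
    extMulVec σ X a = extMul (flatL σ (X 0)) (extMulVec σ (X ∘ Fin.succ) a) := rfl

theorem extMul_extMulVec {K : ℕ} (X : Fin K → V) (ξ : V →L[ℝ] ℝ) (a : AltForms V) :
    extMul ξ (extMulVec σ X a) = (-1 : ℝ) ^ K • extMulVec σ X (extMul ξ a) := by
  induction K with
  | zero => simp [extMulVec]
  | succ K ih =>
    rw [extMulVec_succ, extMulVec_succ, extMul_extMul, ih, map_smul, pow_succ]
    module

theorem extMulVec_mem_altDegree {K : ℕ} (X : Fin K → V) {a : AltForms V} {k l : ℤ} (h : k + K = l)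
    (ha : a ∈ altDegree V k) : extMulVec σ X a ∈ altDegree V l := by
  induction K generalizing l with
  | zero => obtain rfl : k = l := by simpa using h
            exact ha
  | succ K ih => exact extMul_mem_altDegree (by push_cast at h; omega) _ (ih _ rfl)

theorem apply_succ_eq_contr (a : AltForms V) {K : ℕ} (X : Fin (K + 1) → V) :
    a (K + 1) X = contr (X 0) a K (X ∘ Fin.succ) := by
  conv_lhs => rw [← Matrix.cons_head_tail X]
  rfl

/-- A form is determined by its products with the forms `ι_{X₁}σ ∧ ⋯ ∧ ι_{X_K}σ` of complementary
degree. -/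
theorem HasFrame.eq_zero_of_extMulVec_eq_zero (hσ : HasFrame σ n) {K l : ℕ} (hK : K + l = 2 * n)
    {a : AltForms V} (ha : a ∈ altDegree V l) (hh : a ∈ horizontal σ)
    (h : ∀ X : Fin K → V, extMulVec σ X a = 0) : a = 0 := by
  induction K generalizing l a with
  | zero => exact h 0
  | succ K ih =>
    refine hσ.eq_zero_of_extMul_eq_zero (k := l) (by omega) ha hh fun X₀ => ?_
    refine ih (l := l + 1) (by omega) (extMul_mem_altDegree (by simp) _ ha)
      (extMul_mem_horizontal hh X₀) fun X => ?_
    have h1 := h (Fin.cons X₀ X)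
    rw [extMulVec_succ, extMul_extMulVec] at h1
    exact (smul_eq_zero.1 h1).resolve_left (pow_ne_zero _ (by norm_num))

/-- The constant in the formula for the star of a primitive `k`-form times `σ^j`. -/
noncomputable def weilCoeff (k j r : ℕ) : ℝ :=
  (-1) ^ (k + 1).choose 2 * j.factorial * (r.factorial : ℝ)⁻¹

theorem weilCoeff_succ_left (k j r : ℕ) :
    (-1) ^ (k + 1) * weilCoeff k (j + 1) r = (j + 1) * weilCoeff (k + 1) j r := by
  unfold weilCoeff
  rw [Nat.choose_succ_succ (k + 1) 1, Nat.choose_one_right, pow_add, Nat.factorial_succ]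
  push_cast
  ring

theorem weilCoeff_succ_right (k j r : ℕ) :
    (-1) ^ (k + 1) * weilCoeff (k + 1) j r = (r + 1) * weilCoeff k j (r + 1) := by
  unfold weilCoeff
  rw [Nat.choose_succ_succ (k + 1) 1, Nat.choose_one_right, pow_add, Nat.factorial_succ]
  have h : ((-1 : ℝ) ^ (k + 1)) * (-1) ^ (k + 1) = 1 := by
    rw [← pow_add]; exact Even.neg_one_pow ⟨_, rfl⟩
  have hr : (r.factorial : ℝ) ≠ 0 := by positivity
  have hr' : (r : ℝ) + 1 ≠ 0 := by positivity
  push_cast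
  field_simp
  linear_combination (-1) ^ (k + 1).choose 2 * h

variable [FiniteDimensional ℝ V]

/-- The star of `a ∧ σ^j`, for a primitive `k`-form `a`, is `weilCoeff k j r` times `a ∧ σ^r`, where
`k + j + r = n`. Contraction with a vector on one side corresponds to exterior multiplication on the
other side. -/
theorem extMulVec_weil {K k j r : ℕ} (hK : k + 2 * j = K) (hn : k + j + r = n) {a : AltForms V}
    (ha : a ∈ prim σ n k) (X : Fin K → V) :
    extMulVec σ X (weilCoeff k j r • (lef σ ^ r) a) =
      (lef σ ^ j) a K X • (n.factorial : ℝ)⁻¹ • (lef σ ^ n) (oneForm V) := by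
  induction K generalizing k j r a with
  | zero =>
    obtain rfl : k = 0 := by omega
    obtain rfl : j = 0 := by omega
    obtain rfl : r = n := by omega
    have h := eq_smul_oneForm (a := a) (mem_prim.1 ha).1
    rw [Subsingleton.elim X 0]
    change weilCoeff 0 0 r • (lef σ ^ r) a = a 0 0 • _
    conv_lhs => rw [h]
    rw [map_smul, smul_comm]
    simp [weilCoeff]
  | succ K ih =>
    have hk := (mem_prim.1 ha).1
    set W := (n.factorial : ℝ)⁻¹ • (lef σ ^ n) (oneForm V) with hW
    set X₀ := X 0
    set X' := X ∘ Fin.succ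
    set P := extMulVec σ X' ((lef σ ^ r) (primExt σ X₀ (j + r) a)) with hP
    set Q := extMulVec σ X' ((lef σ ^ (r + 1)) (contr X₀ a)) with hQ
    -- `K + 1 = k + 2 * j`, so that only the parity of `k` matters.
    have hsign : (-1 : ℝ) ^ K = (-1) ^ (k + 1) := by
      have h : (-1 : ℝ) ^ (K + 2) = (-1) ^ (k + 1 + 2 * j) := by
        rw [show K + 2 = k + 1 + 2 * j by omega]
      simpa [pow_add, pow_mul] using h
    have hL : extMulVec σ X (weilCoeff k j r • (lef σ ^ r) a) =
        ((-1) ^ (k + 1) * weilCoeff k j r) • (P - ((j + r : ℕ) + 1 : ℝ)⁻¹ • Q) := by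
      rw [extMulVec_succ, extMul_extMulVec, map_smul, extMul_lef_pow_eq X₀ (j + r), map_smul,
        map_sub, map_smul, hsign, smul_smul]
    have hPr := primExt_mem_prim (l := (k + 1 : ℕ)) (m := j + r) (by simp) (by push_cast; omega) ha X₀
    -- `ι_X a` is primitive of degree `k - 1`, with exponents `j` and `r + 1`.
    have hq : ((-1) ^ (k + 1) * weilCoeff k j r) • Q =
        -((r : ℝ) + 1) • (lef σ ^ j) (contr X₀ a) K X' • W := by
      cases k with
      | zero =>
        have h0 := contr_eq_zero_of_degree_zero X₀ hk
        rw [hQ, h0]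
        simp [AltForms.zero_apply]
      | succ k =>
        have h := ih (k := k) (j := j) (r := r + 1) (by omega) (by omega)
          (contr_mem_prim (by push_cast; ring) ha X₀) X'
        rw [← h, map_smul, smul_smul, pow_succ, mul_neg_one, neg_mul, weilCoeff_succ_right, neg_mul]
    rw [hL, smul_sub, smul_comm _ _ Q, hq, apply_succ_eq_contr]
    have hjr : ((j + r : ℕ) + 1 : ℝ) ≠ 0 := by positivity
    cases j with
    | zero =>
      have h1 : P = 0 := by
        rw [hP, lef_pow_eq_zero_of_mem_prim (by push_cast; omega) hPr, map_zero]
      rw [h1]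
      simp only [smul_zero, zero_sub, neg_smul, smul_neg, neg_neg, pow_zero, Module.End.one_apply]
      rw [smul_smul, ← Nat.cast_succ, zero_add, Nat.succ_eq_add_one]
      push_cast
      rw [inv_mul_cancel₀ (by positivity), one_smul]
    | succ j =>
      -- `primExt σ X₀ _ a` is primitive of degree `k + 1`, with exponents `j` and `r`.
      have h := ih (k := k + 1) (j := j) (r := r) (by omega) (by omega) hPr X'
      rw [map_smul] at h
      rw [weilCoeff_succ_left, mul_smul, h, contr_lef_pow_succ, ← extMul_lef_pow,
        extMul_lef_pow_eq X₀ (j + 1 + r)]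
      simp only [AltForms.add_apply, AltForms.smul_apply, sub_eq_add_neg, ← neg_smul,
        ContinuousAlternatingMap.add_apply, ContinuousAlternatingMap.smul_apply, smul_eq_mul,
        smul_smul, ← add_smul]
      congr 1
      push_cast at hjr ⊢
      field_simp
      ring

end Star

end TransverseLefschetz

/-! ### The symplectic Hodge star in linear algebra -/

namespace TransverseLefschetz

section HodgeStar

variable {V : Type*} [NormedAddCommGroup V] [NormedSpace ℝ V]
variable {σ : V [⋀^Fin 2]→L[ℝ] ℝ} {n : ℕ}

theorem flatWedge_apply {K : ℕ} (X v : Fin K → V) :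
    flatWedge σ X v = altSum (fun w => ∏ i, flatL σ (X i) (w i)) v := by
  change Matrix.det (Matrix.of fun j i => flat σ (X i) (v j)) = _
  rw [Matrix.det_apply]
  unfold altSum
  refine Finset.sum_congr rfl fun τ _ => ?_
  rw [Units.smul_def, zsmul_eq_mul]
  rfl

theorem extMulVec_single {K l N : ℕ} (h : K + l = N) (X : Fin K → V) (γ : V [⋀^Fin l]→L[ℝ] ℝ)
    (v : Fin N → V) : extMulVec σ X (AltForms.single l γ) N v = (l.factorial : ℝ)⁻¹ *
      altSum (fun w => (∏ i, flatL σ (X i) (w (Fin.cast h (Fin.castAdd l i)))) *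
        γ fun i => w (Fin.cast h (Fin.natAdd K i))) v := by
  have hl : (l.factorial : ℝ) ≠ 0 := by positivity
  induction K generalizing N with
  | zero =>
    obtain rfl : l = N := by omega
    have h1 : (fun w : Fin l → V => (∏ i : Fin 0, flatL σ (X i) (w (Fin.cast h (Fin.castAdd l i)))) *
        γ fun i => w (Fin.cast h (Fin.natAdd 0 i))) = γ := by
      ext w
      rw [Finset.univ_eq_empty, Finset.prod_empty, one_mul]
      congr 1
      ext1 i
      congr 1
      ext
      simp
    rw [h1, altSum_alt, inv_mul_cancel_left₀ hl]
    change AltForms.single l γ l v = _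
    rw [AltForms.single_same]
  | succ K ih =>
    obtain ⟨N, rfl⟩ : ∃ N', N = N' + 1 := ⟨K + l, by omega⟩
    have hN : K + l = N := by omega
    have hN' : (N.factorial : ℝ) ≠ 0 := by positivity
    rw [extMulVec_succ, extMul_eq_altSum]
    have h1 : (fun w : Fin (N + 1) → V => flatL σ (X 0) (w 0) *
        extMulVec σ (X ∘ Fin.succ) (AltForms.single l γ) N (w ∘ Fin.succ)) = fun w =>
        (l.factorial : ℝ)⁻¹ * altSum (fun u : Fin N → V => flatL σ (X 0) (w 0) *
          ((∏ i, flatL σ (X (Fin.succ i)) (u (Fin.cast hN (Fin.castAdd l i)))) *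
            γ fun i => u (Fin.cast hN (Fin.natAdd K i)))) (w ∘ Fin.succ) := by
      ext w
      rw [ih hN, altSum_mul]
      simp only [Function.comp_apply]
      ring
    rw [h1, altSum_mul, altSum_succ (fun x u => flatL σ (X 0) x *
          ((∏ i, flatL σ (X (Fin.succ i)) (u (Fin.cast hN (Fin.castAdd l i)))) *
            γ fun i => u (Fin.cast hN (Fin.natAdd K i)))), mul_left_comm,
      inv_mul_cancel_left₀ hN']
    congr 2
    ext w
    rw [Fin.prod_univ_succ, mul_assoc]
    congr 2
    · congr 1
      ext1 i
      simp only [Function.comp_apply]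
      congr 1
      ext
      simp
      omega

theorem wedge_flatWedge_apply {K l N : ℕ} (h : K + l = N) (X : Fin K → V)
    (γ : V [⋀^Fin l]→L[ℝ] ℝ) (v : Fin N → V) :
    wedge (flatWedge σ X) γ (v ∘ Fin.cast h) = extMulVec σ X (AltForms.single l γ) N v := by
  subst h
  have hK : (K.factorial : ℝ) ≠ 0 := by positivity
  rw [extMulVec_single rfl, wedge_apply]
  simp only [flatWedge_apply]
  rw [altSum_castAdd (fun w : Fin K → V => ∏ i, flatL σ (X i) (w i)) (fun u : Fin l → V => γ u)]
  field_simp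
  rfl

theorem lef_pow_oneForm (j : ℕ) :
    (lef σ ^ j) (oneForm V) = AltForms.single (2 * j) (wedgePow σ j) := by
  induction j with
  | zero => rfl
  | succ j ih =>
    rw [pow_succ', Module.End.mul_apply, ih,
      eq_single_of_mem_altDegree (j := 2 * (j + 1)) (by rfl)
        (lef_mem_altDegree σ (k := 2 * j) (by push_cast; ring) (single_mem_altDegree (by simp) _))]
    congr 1
    change wedge (AltForms.single (2 * j) (wedgePow σ j) (2 * j)) σ = _
    rw [AltForms.single_same]
    rfl

theorem isHorizontalFor_iff {k : ℕ} {α : V [⋀^Fin k]→L[ℝ] ℝ} :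
    IsHorizontalFor σ α ↔ AltForms.single k α ∈ horizontal σ := by
  constructor
  · intro h X hX
    funext j
    ext v
    change AltForms.single k α (j + 1) (Matrix.vecCons X v) = 0
    by_cases hj : j + 1 = k
    · subst hj
      rw [AltForms.single_same]
      exact h _ ⟨0, fun Y => by
        rw [Matrix.cons_val_zero, ← flatL_apply, hX]
        rfl⟩
    · rw [AltForms.single_of_ne hj]
      rfl
  · rintro h v ⟨i, hi⟩
    have h1 := apply_eq_zero_of_mem_horizontal h (v := v) i (by
      ext Y
      rw [flatL_apply]
      exact hi Y)
    rwa [AltForms.single_same] at h1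

/-- The defining property of the star, as an identity between sequences of forms. -/
theorem isHodgeStar_iff {k l : ℕ} (h : k + l = 2 * n) {α : V [⋀^Fin k]→L[ℝ] ℝ}
    {α' : V [⋀^Fin l]→L[ℝ] ℝ} : IsHodgeStar n h σ α α' ↔
      AltForms.single l α' ∈ horizontal σ ∧ ∀ X : Fin k → V,
        extMulVec σ X (AltForms.single l α') =
          α X • (n.factorial : ℝ)⁻¹ • (lef σ ^ n) (oneForm V) := by
  unfold IsHodgeStar
  rw [isHorizontalFor_iff]
  refine and_congr_right fun _ => forall_congr' fun X => ?_
  constructor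
  · intro hv
    rw [eq_single_of_mem_altDegree (j := 2 * n) (k := (2 * n : ℕ)) rfl
      (extMulVec_mem_altDegree X (k := l) (by exact_mod_cast (add_comm l k).trans h)
        (single_mem_altDegree (by simp) _))]
    funext j
    by_cases hj : j = 2 * n
    · subst hj
      ext v
      rw [AltForms.single_same, ← wedge_flatWedge_apply h, hv, lef_pow_oneForm]
      simp only [AltForms.smul_apply, AltForms.single_same]
      rfl
    · rw [AltForms.single_of_ne hj, lef_pow_oneForm]
      simp only [AltForms.smul_apply, AltForms.single_of_ne hj, smul_zero]
  · intro hX v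
    rw [wedge_flatWedge_apply h, hX, lef_pow_oneForm]
    simp only [AltForms.smul_apply, AltForms.single_same]
    rfl

theorem IsHodgeStar.unique (hσ : HasFrame σ n) {k l : ℕ} {h : k + l = 2 * n}
    {α : V [⋀^Fin k]→L[ℝ] ℝ} {α' α'' : V [⋀^Fin l]→L[ℝ] ℝ} (h1 : IsHodgeStar n h σ α α')
    (h2 : IsHodgeStar n h σ α α'') : α' = α'' := by
  rw [isHodgeStar_iff] at h1 h2
  have h3 : AltForms.single l α' - AltForms.single l α'' = 0 :=
    hσ.eq_zero_of_extMulVec_eq_zero h (Submodule.sub_mem _ (single_mem_altDegree rfl _)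
      (single_mem_altDegree rfl _)) (Submodule.sub_mem _ h1.1 h2.1) fun X => by
        rw [map_sub, h1.2, h2.2, sub_self]
  have h4 := congrFun (sub_eq_zero.1 h3) l
  rwa [AltForms.single_same, AltForms.single_same] at h4

theorem IsHodgeStar.add {k l : ℕ} {h : k + l = 2 * n} {α β : V [⋀^Fin k]→L[ℝ] ℝ}
    {α' β' : V [⋀^Fin l]→L[ℝ] ℝ} (h1 : IsHodgeStar n h σ α α') (h2 : IsHodgeStar n h σ β β') :
    IsHodgeStar n h σ (α + β) (α' + β') :=
  ⟨fun v hv => by rw [ContinuousAlternatingMap.add_apply, h1.1 v hv, h2.1 v hv, add_zero],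
    fun X v => by
      rw [wedge_add_right, ContinuousAlternatingMap.add_apply, h1.2, h2.2,
        ContinuousAlternatingMap.add_apply, add_mul]⟩

theorem IsHodgeStar.smul (c : ℝ) {k l : ℕ} {h : k + l = 2 * n} {α : V [⋀^Fin k]→L[ℝ] ℝ}
    {α' : V [⋀^Fin l]→L[ℝ] ℝ} (h1 : IsHodgeStar n h σ α α') :
    IsHodgeStar n h σ (c • α) (c • α') :=
  ⟨fun v hv => by rw [ContinuousAlternatingMap.smul_apply, h1.1 v hv, smul_zero],
    fun X v => by
      rw [wedge_smul_right, ContinuousAlternatingMap.smul_apply, h1.2,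
        ContinuousAlternatingMap.smul_apply, smul_eq_mul, smul_eq_mul, mul_assoc]⟩

theorem IsHodgeStar.zero {k l : ℕ} {h : k + l = 2 * n} :
    IsHodgeStar n h σ (0 : V [⋀^Fin k]→L[ℝ] ℝ) (0 : V [⋀^Fin l]→L[ℝ] ℝ) :=
  isHodgeStar_iff h |>.2 ⟨by
    rw [show AltForms.single l (0 : V [⋀^Fin l]→L[ℝ] ℝ) = 0 from Pi.single_zero l]
    exact Submodule.zero_mem _, fun X => by
    rw [show AltForms.single l (0 : V [⋀^Fin l]→L[ℝ] ℝ) = 0 from Pi.single_zero l, map_zero]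
    simp⟩

theorem hodgeStar_eq (hσ : HasFrame σ n) {k l : ℕ} {h : k + l = 2 * n} {α : V [⋀^Fin k]→L[ℝ] ℝ}
    {α' : V [⋀^Fin l]→L[ℝ] ℝ} (h1 : IsHodgeStar n h σ α α') : hodgeStar n h σ α = α' := by
  have hex : ∃ α', IsHodgeStar n h σ α α' := ⟨α', h1⟩
  rw [hodgeStar, dif_pos hex]
  exact hex.choose_spec.unique hσ h1

variable [FiniteDimensional ℝ V]

/-- The star of a primitive `k`-form times `σ^j`. -/
theorem isHodgeStar_weil {k j r K l : ℕ} (hn : k + j + r = n) (hK : k + 2 * j = K)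
    (hl : k + 2 * r = l) (h : K + l = 2 * n) {a : AltForms V} (ha : a ∈ prim σ n k) :
    IsHodgeStar n h σ ((lef σ ^ j) a K) (weilCoeff k j r • (lef σ ^ r) a l) := by
  obtain ⟨h1, h2, -⟩ := mem_prim.1 ha
  have h3 : AltForms.single l (weilCoeff k j r • (lef σ ^ r) a l) =
      weilCoeff k j r • (lef σ ^ r) a := by
    rw [eq_single_of_mem_altDegree (j := l) (k := l) rfl (a := weilCoeff k j r • (lef σ ^ r) a)
      (Submodule.smul_mem _ _ (lef_pow_mem_altDegree σ r (by rw [← hl]; push_cast; ring) h1))]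
    rw [AltForms.smul_apply]
  rw [isHodgeStar_iff, h3]
  exact ⟨Submodule.smul_mem _ _ (lef_pow_mem_horizontal r h2), extMulVec_weil hK hn ha⟩

/-- The star exists, by Weil's formula and the Lefschetz decomposition. -/
theorem exists_isHodgeStar (hσ : HasFrame σ n) {k l : ℕ} (h : k + l = 2 * n)
    {α : V [⋀^Fin k]→L[ℝ] ℝ} (hα : IsHorizontalFor σ α) : ∃ α', IsHodgeStar n h σ α α' := by
  have key : ∀ a ∈ primSpan σ n k, ∃ α', IsHodgeStar n h σ (a k) α' := by
    intro a ha
    induction ha using Submodule.span_induction with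
    | zero => exact ⟨0, IsHodgeStar.zero⟩
    | add x y _ _ hx hy =>
      obtain ⟨x', hx⟩ := hx
      obtain ⟨y', hy⟩ := hy
      exact ⟨x' + y', hx.add hy⟩
    | smul c x _ hx =>
      obtain ⟨x', hx⟩ := hx
      exact ⟨c • x', hx.smul c⟩
    | mem b hb =>
      obtain ⟨k', j, hkj, a, ha, rfl⟩ := hb
      by_cases hk : k' < 0
      · rw [eq_zero_of_mem_altDegree_neg hk (mem_prim.1 ha).1, map_zero]
        exact ⟨0, IsHodgeStar.zero⟩
      · lift k' to ℕ using by omega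
        by_cases hj : k' + j ≤ n
        · exact ⟨_, isHodgeStar_weil (r := n - k' - j) (by omega) (by exact_mod_cast hkj) (by omega)
            h ha⟩
        · rw [lef_pow_eq_zero_of_mem_prim (by omega) ha]
          exact ⟨0, IsHodgeStar.zero⟩
  have h1 := key (AltForms.single k α) (mem_primSpan hσ (single_mem_altDegree rfl _)
    (isHorizontalFor_iff.1 hα))
  rwa [AltForms.single_same] at h1

/-- The star is injective. -/
theorem eq_zero_of_hodgeStar_eq_zero (hσ : HasFrame σ n) {k l : ℕ} (h : k + l = 2 * n)
    {α : V [⋀^Fin k]→L[ℝ] ℝ} (hα : IsHorizontalFor σ α) (h0 : hodgeStar n h σ α = 0) : α = 0 := by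
  obtain ⟨α', h1⟩ := exists_isHodgeStar hσ h hα
  rw [hodgeStar_eq hσ h1] at h0
  subst h0
  ext X
  have h2 := (isHodgeStar_iff h).1 h1 |>.2 X
  rw [show AltForms.single l (0 : V [⋀^Fin l]→L[ℝ] ℝ) = 0 from Pi.single_zero l, map_zero] at h2
  refine (smul_eq_zero.1 h2.symm).resolve_right fun h3 => ?_
  exact hσ.lef_pow_oneForm_ne_zero le_rfl ((smul_eq_zero.1 h3).resolve_left (by positivity))

/-- If the kernel of `σ` has codimension `2n`, a basis of a complement and its dual basis with respect
to `σ` form a frame. -/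
theorem hasFrame_of_finrank {p : ℕ} (hV : Module.finrank ℝ V = p + 2 * n)
    (hker : Module.finrank ℝ (LinearMap.ker (flatL σ)) = p) : HasFrame σ n := by
  obtain ⟨W, hW⟩ := Submodule.exists_isCompl (LinearMap.ker (flatL σ))
  have hdim : Module.finrank ℝ W = 2 * n := by
    have := Submodule.finrank_add_eq_of_isCompl hW
    omega
  let B : LinearMap.BilinForm ℝ W :=
    LinearMap.mk₂ ℝ (fun w w' => flatL σ w w') (fun _ _ _ => by simp) (fun _ _ _ => by simp)
      (fun _ _ _ => by simp) (fun _ _ _ => by simp)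
  have hB : ∀ w w', B w w' = flatL σ w w' := fun _ _ => rfl
  have hdec : ∀ v : V, ∃ u ∈ LinearMap.ker (flatL σ), ∃ w ∈ W, v = u + w := fun v => by
    obtain ⟨u, hu, w, hw, h⟩ := Submodule.mem_sup.1 (hW.sup_eq_top ▸ Submodule.mem_top : v ∈ _)
    exact ⟨u, hu, w, hw, h.symm⟩
  have hker0 : ∀ u ∈ LinearMap.ker (flatL σ), ∀ v, flatL σ v u = 0 := fun u hu v => by
    rw [flatL_swap, LinearMap.mem_ker.1 hu]
    simp
  have hsep : ∀ w : W, (∀ w' : W, flatL σ w w' = 0) → w = 0 := by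
    intro w hw
    have h1 : (w : V) ∈ LinearMap.ker (flatL σ) := by
      rw [LinearMap.mem_ker]
      ext v
      obtain ⟨u, hu, w', hw', rfl⟩ := hdec v
      rw [map_add, hker0 u hu, hw ⟨w', hw'⟩]
      simp
    exact Subtype.ext (Submodule.disjoint_def.1 hW.disjoint _ h1 w.2)
  have hnd : B.Nondegenerate :=
    ⟨fun w hw => hsep w fun w' => hw w', fun w hw => hsep w fun w' => by
      rw [flatL_swap, ← hB, hw w', neg_zero]⟩
  let b := Module.finBasisOfFinrankEq ℝ W hdim
  refine ⟨fun i => b i, fun i => B.dualBasis hnd b i, fun v => ?_, ?_⟩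
  · obtain ⟨u, hu, w, hw, rfl⟩ := hdec v
    have h1 : ∀ i, flatL σ (B.dualBasis hnd b i) (u + w) = b.repr ⟨w, hw⟩ i := fun i => by
      rw [map_add, hker0 u hu, zero_add]
      change B (B.dualBasis hnd b i) ⟨w, hw⟩ = _
      conv_lhs => rw [← b.sum_repr ⟨w, hw⟩]
      simp only [map_sum, map_smul, LinearMap.BilinForm.apply_dualBasis_left]
      simp
    simp only [h1]
    have h2 := congrArg Subtype.val (b.sum_repr ⟨w, hw⟩)
    simp only [Submodule.coe_sum, Submodule.coe_smul] at h2
    rw [h2, map_add, LinearMap.mem_ker.1 hu, zero_add]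
  · have h1 : ∀ i, flatL σ (B.dualBasis hnd b i) (b i) = 1 := fun i => by
      rw [← hB, LinearMap.BilinForm.apply_dualBasis_left, if_pos rfl]
    simp [h1]

end HodgeStar

end TransverseLefschetz

/-! ### The exterior derivative and leafwise vector fields -/

namespace TransverseLefschetz

section ExteriorDerivative

variable {m k : ℕ} {M : Type*} [TopologicalSpace M] [ChartedSpace (Coord m) M]
  [IsManifold (𝓡 m) ∞ M]

/-- The expressions of a form in two charts are related by the pullback under the change of
coordinates. -/
theorem Form.inChart_eq_pullback (α : Form m k M) (x₀ x₁ : M) {y : Coord m}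
    (hy : y ∈ (extChartAt (𝓡 m) x₀).target)
    (hy₁ : (extChartAt (𝓡 m) x₀).symm y ∈ (extChartAt (𝓡 m) x₁).source) :
    α.inChart x₀ y = (α.inChart x₁ ((extChartAt (𝓡 m) x₁ ∘ (extChartAt (𝓡 m) x₀).symm) y)
      ).compContinuousLinearMap
        (fderiv ℝ (extChartAt (𝓡 m) x₁ ∘ (extChartAt (𝓡 m) x₀).symm) y) := by
  set z := (extChartAt (𝓡 m) x₀).symm y with hz
  have hz₀ : z ∈ (extChartAt (𝓡 m) x₀).source := (extChartAt (𝓡 m) x₀).map_target hy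
  have hd : fderiv ℝ (extChartAt (𝓡 m) x₁ ∘ (extChartAt (𝓡 m) x₀).symm) y =
      tangentCoordChange (𝓡 m) x₀ x₁ z := by
    rw [tangentCoordChange_def, ModelWithCorners.Boundaryless.range_eq_univ, fderivWithin_univ,
      (extChartAt (𝓡 m) x₀).right_inv hy]
  rw [hd]
  unfold Form.inChart
  rw [Function.comp_apply, ← hz, (extChartAt (𝓡 m) x₁).left_inv hy₁]
  ext v
  simp only [ContinuousAlternatingMap.compContinuousLinearMap_apply]
  congr 1
  ext1 i
  exact (tangentCoordChange_comp ⟨⟨hz₀, hy₁⟩, mem_extChartAt_source z⟩).symm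

theorem two_le_minSmoothness : minSmoothness ℝ 2 ≤ (∞ : WithTop ℕ∞) := by
  rw [minSmoothness_of_isRCLikeNormedField]
  exact WithTop.coe_le_coe.2 (le_top : (2 : ℕ∞) ≤ ⊤)

/-- In any chart, the exterior derivative is the exterior derivative of the expression of the form
in this chart. -/
theorem Form.Smooth.inChart_d {α : Form m k M} (hα : α.Smooth) (x₀ : M) {y : Coord m}
    (hy : y ∈ (extChartAt (𝓡 m) x₀).target) :
    α.d.inChart x₀ y = extDeriv (α.inChart x₀) y := by
  set z := (extChartAt (𝓡 m) x₀).symm y with hz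
  set f := extChartAt (𝓡 m) z ∘ (extChartAt (𝓡 m) x₀).symm with hf
  have hz₀ : z ∈ (extChartAt (𝓡 m) x₀).source := (extChartAt (𝓡 m) x₀).map_target hy
  have hfy : f y = extChartAt (𝓡 m) z z := rfl
  have hnhds : (extChartAt (𝓡 m) x₀).target ∩
      (extChartAt (𝓡 m) x₀).symm ⁻¹' (extChartAt (𝓡 m) z).source ∈ nhds y :=
    ((continuousOn_extChartAt_symm x₀).isOpen_inter_preimage (isOpen_extChartAt_target x₀)
      (isOpen_extChartAt_source z)).mem_nhds ⟨hy, mem_extChartAt_source z⟩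
  have hev : α.inChart x₀ =ᶠ[nhds y] fun y' =>
      (α.inChart z (f y')).compContinuousLinearMap (fderiv ℝ f y') :=
    Filter.mem_of_superset hnhds fun y' hy' => α.inChart_eq_pullback x₀ z hy'.1 hy'.2
  have hsm : ContDiffAt ℝ ∞ f y := by
    have h := contDiffWithinAt_ext_coord_change (I := 𝓡 m) (n := ∞) z x₀ (y := y) (by
      rw [PartialEquiv.trans_source'', PartialEquiv.symm_symm, PartialEquiv.symm_target]
      exact ⟨z, ⟨hz₀, mem_extChartAt_source z⟩, (extChartAt (𝓡 m) x₀).right_inv hy⟩)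
    rw [ModelWithCorners.Boundaryless.range_eq_univ, contDiffWithinAt_univ] at h
    exact h
  have hd : fderiv ℝ f y = tangentCoordChange (𝓡 m) x₀ z z := by
    rw [tangentCoordChange_def, ModelWithCorners.Boundaryless.range_eq_univ, fderivWithin_univ,
      (extChartAt (𝓡 m) x₀).right_inv hy]
  rw [hev.extDeriv_eq, extDeriv_pullback (r := ∞) (by rw [hfy]; exact hα.differentiableAt z) hsm
    two_le_minSmoothness, hd, hfy]
  rfl

theorem Form.Smooth.d {α : Form m k M} (hα : α.Smooth) : α.d.Smooth := fun x₀ => by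
  have h : ContDiffOn ℝ ∞ (extDeriv (α.inChart x₀)) (extChartAt (𝓡 m) x₀).target := by
    have h1 := (hα x₀).fderiv_of_isOpen (m := ∞) (isOpen_extChartAt_target x₀) (by simp)
    exact (ContinuousAlternatingMap.alternatizeUncurryFinCLM ℝ (Coord m) ℝ).contDiff.comp_contDiffOn
      h1
  exact h.congr fun y hy => hα.inChart_d x₀ hy

theorem Form.Smooth.d_d {α : Form m k M} (hα : α.Smooth) : α.d.d = 0 := funext fun x => by
  have h : α.d.inChart x =ᶠ[nhds (extChartAt (𝓡 m) x x)] extDeriv (α.inChart x) :=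
    Filter.mem_of_superset (extChartAt_target_mem_nhds x) fun y hy => hα.inChart_d x hy
  change extDeriv (α.d.inChart x) _ = 0
  rw [h.extDeriv_eq]
  exact extDeriv_extDeriv_apply ((hα x).contDiffAt (extChartAt_target_mem_nhds x))
    two_le_minSmoothness

end ExteriorDerivative

section TangentFields

theorem mdifferentiable_of_mem_maximalAtlas {m : ℕ} {M : Type*} [TopologicalSpace M]
    [ChartedSpace (Coord m) M] {e : OpenPartialHomeomorph M (Coord m)}
    (he : e ∈ IsManifold.maximalAtlas (𝓡 m) ∞ M) : e.MDifferentiable (𝓡 m) (𝓡 m) :=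
  ⟨(contMDiffOn_of_mem_maximalAtlas he).mdifferentiableOn (by simp),
    (contMDiffOn_symm_of_mem_maximalAtlas he).mdifferentiableOn (by simp)⟩

variable {p q : ℕ} {M : Type*} [TopologicalSpace M] [ChartedSpace (Coord (p + q)) M]
  [IsManifold (𝓡 (p + q)) ∞ M] (F : Foliation p q M)

/-- The tangent spaces of the leaves have dimension `p`. -/
theorem Foliation.finrank_eq (x : M) {W : Submodule ℝ (Coord (p + q))}
    (hW : ∀ v, v ∈ W ↔ v ∈ F.tangent x) : Module.finrank ℝ W = p := by
  obtain ⟨e, he, hx, h⟩ := F.exists_chart x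
  let E : Coord (p + q) ≃L[ℝ] Coord (p + q) := (mdifferentiable_of_mem_maximalAtlas he).mfderiv hx
  let f : Coord (p + q) →ₗ[ℝ] (Fin q → ℝ) :=
    LinearMap.pi fun i => (EuclideanSpace.proj (𝕜 := ℝ) (Fin.natAdd p i)).toLinearMap ∘ₗ E.toLinearMap
  have hf : ∀ v : Coord (p + q), v ∈ LinearMap.ker f ↔
      ∀ i : Fin q, EuclideanSpace.proj (𝕜 := ℝ) (Fin.natAdd p i) (E v) = 0 := fun v => by
    rw [LinearMap.mem_ker, funext_iff]
    rfl
  have hker : W = LinearMap.ker f :=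
    Submodule.ext fun v => (hW v).trans ((h x hx v).trans (hf v).symm)
  have hsurj : Function.Surjective f := by
    intro c
    refine ⟨E.symm (WithLp.toLp 2 (Fin.append 0 c)), ?_⟩
    ext i
    change (E (E.symm (WithLp.toLp 2 (Fin.append 0 c)))) (Fin.natAdd p i) = c i
    rw [E.apply_symm_apply]
    simp
  have h1 := LinearMap.finrank_range_add_finrank_ker f
  rw [LinearMap.range_eq_top.2 hsurj, finrank_top, ← hker] at h1
  simp at h1
  omega

variable [T2Space M]

/-- Every tangent vector of a leaf is the value of a global vector field tangent to the leaves: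
cut off a vector field which is constant in a foliation chart. -/
theorem Foliation.exists_isTangentField {x : M} {v : Coord (p + q)} (hv : v ∈ F.tangent x) :
    ∃ X, F.IsTangentField X ∧ X x = v := by
  obtain ⟨e, he, hx, h⟩ := F.exists_chart x
  have hinv : ∀ z ∈ e.source, (mfderiv (𝓡 (p + q)) (𝓡 (p + q)) e z).IsInvertible := fun z hz =>
    ⟨(mdifferentiable_of_mem_maximalAtlas he).mfderiv hz, rfl⟩
  let w : Coord (p + q) := mfderiv (𝓡 (p + q)) (𝓡 (p + q)) e x v
  let S : (z : M) → TangentSpace (𝓡 (p + q)) z :=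
    VectorField.mpullback (𝓡 (p + q)) (𝓡 (p + q)) e fun _ => w
  have hS : ContMDiffOn (𝓡 (p + q)) (𝓡 (p + q)).tangent ∞
      (fun z => (⟨z, S z⟩ : TangentBundle (𝓡 (p + q)) M)) e.source := by
    intro z hz
    refine (ContMDiffAt.mpullback_vectorField_preimage (n := ∞) ?_
      (contMDiffAt_of_mem_maximalAtlas he hz) (hinv z hz) (by simp)).contMDiffWithinAt
    exact contMDiffAt_vectorSpace_iff_contDiffAt.2 contDiffAt_const
  have hSe : ∀ z ∈ e.source, mfderiv (𝓡 (p + q)) (𝓡 (p + q)) e z (S z) = w := fun z hz =>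
    (hinv z hz).self_apply_inverse w
  obtain ⟨χ, -, hχ⟩ := (SmoothBumpFunction.nhds_basis_tsupport (I := 𝓡 (p + q)) x).mem_iff.1
    (e.open_source.mem_nhds hx)
  refine ⟨fun z => χ z • S z, ⟨?_, fun z => ?_⟩, ?_⟩
  · exact ContMDiffOn.smul_section_of_tsupport (V := fun z : M => TangentSpace (𝓡 (p + q)) z)
      χ.contMDiff.contMDiffOn e.open_source hχ hS
  · by_cases hz : z ∈ e.source
    · refine Submodule.smul_mem _ _ ((h z hz _).2 fun i => ?_)
      rw [hSe z hz]
      exact (h x hx v).1 hv i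
    · have h0 : χ z • S z = 0 := by
        rw [image_eq_zero_of_notMem_tsupport fun h' => hz (hχ h'), zero_smul]
      change χ z • S z ∈ F.tangent z
      rw [h0]
      exact Submodule.zero_mem _
  · have h1 : χ x • S x = S x := by rw [χ.eq_one, one_smul]
    exact h1.trans ((hinv x hx).inverse_apply_self v)

end TangentFields

end TransverseLefschetz

/-! ### Forms on a transversely symplectic foliation -/

namespace TransverseLefschetz

section SmoothInverse

/-- If `A y` is an injective operator which depends smoothly on `y`, then `f` is smooth as soon as
`y ↦ A y (f y)` is. -/
theorem contDiffOn_of_clm_apply {X E F : Type*} [NormedAddCommGroup X] [NormedSpace ℝ X]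
    [NormedAddCommGroup E] [NormedSpace ℝ E] [FiniteDimensional ℝ E]
    [NormedAddCommGroup F] [NormedSpace ℝ F] [FiniteDimensional ℝ F] {U : Set X}
    {A : X → E →L[ℝ] F} {f : X → E} (hA : ContDiffOn ℝ ∞ A U)
    (hinj : ∀ y ∈ U, ∀ v, A y v = 0 → v = 0) (hf : ContDiffOn ℝ ∞ (fun y => A y (f y)) U) :
    ContDiffOn ℝ ∞ f U := by
  -- With a left inverse `B` of `A y`, the operators `B ∘ A z` are invertible for `z` close to `y`.
  have : CompleteSpace E := FiniteDimensional.complete ℝ E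
  intro y hy
  obtain ⟨B, hB⟩ := (A y).toLinearMap.exists_leftInverse_of_injective
    (LinearMap.ker_eq_bot'.2 (hinj y hy))
  let B' : F →L[ℝ] E := LinearMap.toContinuousLinearMap B
  have hC : ContDiffWithinAt ℝ ∞ (fun z => B'.comp (A z)) U y :=
    contDiffWithinAt_const.clm_comp (hA y hy)
  have hCy : B'.comp (A y) = (ContinuousLinearEquiv.refl ℝ E : E →L[ℝ] E) := by
    ext v
    exact congrArg (fun g : E →ₗ[ℝ] E => g v) hB
  have hinv : ContDiffWithinAt ℝ ∞ (fun z => (B'.comp (A z)).inverse) U y := by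
    have h1 : ContDiffAt ℝ ∞ ContinuousLinearMap.inverse (B'.comp (A y)) := by
      rw [hCy]
      exact contDiffAt_map_inverse _
    exact h1.comp_contDiffWithinAt y hC
  have hg : ContDiffWithinAt ℝ ∞ (fun z => (B'.comp (A z)).inverse (B' (A z (f z)))) U y :=
    hinv.clm_apply (contDiffWithinAt_const.clm_apply (hf y hy))
  have hev : ∀ᶠ z in nhdsWithin y U, (B'.comp (A z)).IsInvertible := by
    refine hC.continuousWithinAt.eventually ?_
    change ∀ᶠ g in nhds (B'.comp (A y)), g.IsInvertible
    rw [hCy]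
    exact ContinuousLinearEquiv.nhds (ContinuousLinearEquiv.refl ℝ E)
  refine hg.congr_of_eventuallyEq_of_mem (hev.mono fun z hz => ?_) hy
  exact (hz.inverse_apply_self (f z)).symm

end SmoothInverse

section Pullback

variable {V W : Type*} [NormedAddCommGroup V] [NormedSpace ℝ V] [NormedAddCommGroup W]
  [NormedSpace ℝ W]

/-- The pullback of forms under a linear map. -/
noncomputable def AltForms.pullback (g : W →L[ℝ] V) : AltForms V →ₗ[ℝ] AltForms W where
  toFun a k := (a k).compContinuousLinearMap g
  map_add' _ _ := rfl
  map_smul' _ _ := rfl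

theorem lef_pullback (g : W →L[ℝ] V) (σ : V [⋀^Fin 2]→L[ℝ] ℝ) (a : AltForms V) :
    lef (σ.compContinuousLinearMap g) (AltForms.pullback g a) = AltForms.pullback g (lef σ a) := by
  funext k
  match k with
  | 0 => rfl
  | 1 => rfl
  | k + 2 => exact (wedge_comp _ _ _).symm

theorem lef_pow_pullback (g : W →L[ℝ] V) (σ : V [⋀^Fin 2]→L[ℝ] ℝ) (j : ℕ) (a : AltForms V) :
    (lef (σ.compContinuousLinearMap g) ^ j) (AltForms.pullback g a) =
      AltForms.pullback g ((lef σ ^ j) a) := by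
  induction j with
  | zero => rfl
  | succ j ih =>
    rw [pow_succ', pow_succ', Module.End.mul_apply, Module.End.mul_apply, ih, lef_pullback]

theorem lef_pow_oneForm_pullback_ne_zero {g : W →L[ℝ] V} {g' : V → W} (hg : ∀ v, g (g' v) = v)
    {σ : V [⋀^Fin 2]→L[ℝ] ℝ} {n : ℕ} (h : (lef σ ^ n) (oneForm V) ≠ 0) :
    (lef (σ.compContinuousLinearMap g) ^ n) (oneForm W) ≠ 0 := by
  intro h0
  refine h (funext fun k => ?_)
  ext v
  have h1 : AltForms.pullback g (oneForm V) = oneForm W := by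
    funext k
    cases k with
    | zero => rfl
    | succ k =>
      ext w
      change oneForm V (k + 1) (g ∘ w) = oneForm W (k + 1) w
      rw [oneForm, oneForm, AltForms.single_of_ne (by simp), AltForms.single_of_ne (by simp)]
      rfl
  rw [← h1, lef_pow_pullback] at h0
  have h2 := congrArg (fun f => f (g' ∘ v)) (congrFun h0 k)
  change ((lef σ ^ n) (oneForm V) k) (g ∘ g' ∘ v) = 0 at h2
  rwa [show g ∘ g' ∘ v = v from funext fun i => hg _] at h2

/-- The operator `α ↦ α ∧ σ^j` on `k`-forms. -/
noncomputable def wedgePowL [FiniteDimensional ℝ V] (σ : V [⋀^Fin 2]→L[ℝ] ℝ) (k : ℕ) :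
    (j : ℕ) → (V [⋀^Fin k]→L[ℝ] ℝ) →L[ℝ] V [⋀^Fin (k + 2 * j)]→L[ℝ] ℝ
  | 0 => ContinuousLinearMap.id ℝ _
  | j + 1 => ((wedgeL V (k + 2 * j) 2).flip σ).comp (wedgePowL σ k j)

theorem wedgePowL_eq [FiniteDimensional ℝ V] (σ : V [⋀^Fin 2]→L[ℝ] ℝ) (k j : ℕ) (a : AltForms V) :
    wedgePowL σ k j (a k) = (lef σ ^ j) a (k + 2 * j) := by
  induction j with
  | zero => rfl
  | succ j ih =>
    rw [pow_succ', Module.End.mul_apply]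
    change wedge (wedgePowL σ k j (a k)) σ = wedge ((lef σ ^ j) a (k + 2 * j)) σ
    rw [ih]

theorem contDiffOn_wedgePowL [FiniteDimensional ℝ V] {X : Type*} [NormedAddCommGroup X]
    [NormedSpace ℝ X] {U : Set X} {s : X → V [⋀^Fin 2]→L[ℝ] ℝ} (hs : ContDiffOn ℝ ∞ s U)
    (k j : ℕ) : ContDiffOn ℝ ∞ (fun y => wedgePowL (s y) k j) U := by
  induction j with
  | zero => exact contDiffOn_const
  | succ j ih =>
    have h1 : ContDiffOn ℝ ∞ (fun y => (wedgeL V (k + 2 * j) 2).flip (s y)) U :=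
      (ContinuousLinearMap.contDiff _).comp_contDiffOn hs
    exact h1.clm_comp ih

end Pullback

section Forms

/-- Sequences of differential forms, with one form in each degree; the analogue of `AltForms` on a
manifold. -/
def Forms (m : ℕ) (M : Type*) : Type _ := (k : ℕ) → Form m k M

noncomputable instance (m : ℕ) (M : Type*) : AddCommGroup (Forms m M) :=
  inferInstanceAs (AddCommGroup ((k : ℕ) → Form m k M))

noncomputable instance (m : ℕ) (M : Type*) : Module ℝ (Forms m M) :=
  inferInstanceAs (Module ℝ ((k : ℕ) → Form m k M))

namespace Forms

variable {m : ℕ} {M : Type*}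

/-- The value of a sequence of forms at a point. -/
noncomputable def valueAt (x : M) : Forms m M →ₗ[ℝ] AltForms (Coord m) where
  toFun a k := a k x
  map_add' _ _ := rfl
  map_smul' _ _ := rfl

theorem valueAt_apply (x : M) (a : Forms m M) (k : ℕ) : valueAt x a k = a k x := rfl

theorem ext_valueAt {a b : Forms m M} (h : ∀ x, valueAt x a = valueAt x b) : a = b :=
  funext fun k => funext fun x => congrFun (h x) k

/-- The form `α` of degree `k`, as a sequence of forms. -/
noncomputable def single (k : ℕ) (α : Form m k M) : Forms m M := Pi.single k α

theorem single_same (k : ℕ) (α : Form m k M) : single k α k = α :=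
  Pi.single_eq_same (M := fun k => Form m k M) k α

theorem single_of_ne {k l : ℕ} (h : l ≠ k) (α : Form m k M) : single k α l = 0 :=
  Pi.single_eq_of_ne (M := fun k => Form m k M) h α

/-- The forms of degree `k`. -/
noncomputable def degree (m : ℕ) (M : Type*) (k : ℤ) : Submodule ℝ (Forms m M) :=
  ⨅ x, (altDegree (Coord m) k).comap (valueAt x)

theorem mem_degree {k : ℤ} {a : Forms m M} :
    a ∈ degree m M k ↔ ∀ x, valueAt x a ∈ altDegree (Coord m) k := by
  simp [degree]

theorem apply_eq_zero_of_mem_degree {k : ℤ} {j : ℕ} (h : (j : ℤ) ≠ k) {a : Forms m M}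
    (ha : a ∈ degree m M k) : a j = 0 :=
  funext fun x => mem_degree.1 ha x j h

theorem single_mem_degree {j : ℕ} {k : ℤ} (h : (j : ℤ) = k) (α : Form m j M) :
    single j α ∈ degree m M k := mem_degree.2 fun x i hi => by
  rw [valueAt_apply, single_of_ne (fun h' => hi (by rw [h', h]))]
  rfl

theorem eq_single_of_mem_degree {j : ℕ} {k : ℤ} (h : (j : ℤ) = k) {a : Forms m M}
    (ha : a ∈ degree m M k) : a = single j (a j) := by
  funext i
  by_cases hi : i = j
  · subst hi; rw [single_same]
  · rw [single_of_ne hi]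
    exact apply_eq_zero_of_mem_degree (fun h' => hi (by omega)) ha

theorem eq_zero_of_apply_eq_zero {k : ℕ} {a : Forms m M} (ha : a ∈ degree m M k)
    (h : a k = 0) : a = 0 := by
  rw [eq_single_of_mem_degree rfl ha, h]
  exact Pi.single_zero k

theorem eq_zero_of_mem_degree_neg {k : ℤ} (hk : k < 0) {a : Forms m M}
    (ha : a ∈ degree m M k) : a = 0 :=
  funext fun _ => apply_eq_zero_of_mem_degree (by omega) ha

variable [TopologicalSpace M] [ChartedSpace (Coord m) M] [IsManifold (𝓡 m) ∞ M]

/-- The exterior derivative. -/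
noncomputable def d (a : Forms m M) : Forms m M
  | 0 => 0
  | k + 1 => (a k).d

theorem d_succ (a : Forms m M) (k : ℕ) : a.d (k + 1) = (a k).d := rfl

/-- Smoothness of all forms in a sequence. -/
def Smooth (a : Forms m M) : Prop := ∀ k, (a k).Smooth

theorem d_zero : (0 : Forms m M).d = 0 := funext fun k => by
  cases k with
  | zero => rfl
  | succ k => exact Form.d_zero

theorem d_add {a b : Forms m M} (ha : a.Smooth) (hb : b.Smooth) : (a + b).d = a.d + b.d :=
  funext fun k => by
    cases k with
    | zero => exact (add_zero _).symm
    | succ k => exact Form.d_add (ha k) (hb k)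

theorem d_smul (c : ℝ) (a : Forms m M) : (c • a).d = c • a.d := funext fun k => by
  cases k with
  | zero => exact (smul_zero c).symm
  | succ k => exact Form.d_smul c _

theorem d_sub {a b : Forms m M} (ha : a.Smooth) (hb : b.Smooth) :
    (a - b).d = a.d - b.d := by
  have hb' : ((-1 : ℝ) • b).Smooth := fun k => (hb k).smul _
  rw [show a - b = a + (-1 : ℝ) • b by module, d_add ha hb', d_smul]
  module

theorem d_mem_degree {k l : ℤ} (h : k + 1 = l) {a : Forms m M} (ha : a ∈ degree m M k) :
    a.d ∈ degree m M l := mem_degree.2 fun x j hj => by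
  cases j with
  | zero => rfl
  | succ j =>
    rw [valueAt_apply, d_succ, apply_eq_zero_of_mem_degree (by push_cast at hj; omega) ha,
      Form.d_zero]
    rfl

end Forms

end Forms

namespace TransverselySymplecticFoliation

open Forms

variable {p n : ℕ} {M : Type*} [TopologicalSpace M] [ChartedSpace (Coord (p + 2 * n)) M]
  [IsManifold (𝓡 (p + 2 * n)) ∞ M] (T : TransverselySymplecticFoliation p n M)

theorem flatL_sympl_eq_zero {x : M} {X : Coord (p + 2 * n)} :
    flatL (T.sympl x) X = 0 ↔ X ∈ T.tangent x := by
  refine Iff.trans ?_ (T.ker_sympl x X).symm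
  constructor
  · intro h Y
    exact (flatL_apply _ _ _).symm.trans (congrArg (fun f => f Y) h)
  · intro h
    ext Y
    exact (flatL_apply _ _ _).trans (h Y)

/-- The transversely symplectic form has rank `2n` at each point. -/
theorem hasFrame (x : M) : HasFrame (T.sympl x) n :=
  hasFrame_of_finrank (p := p) (by simp) (T.finrank_eq x fun v => by
    rw [LinearMap.mem_ker, T.flatL_sympl_eq_zero])

/-- The operator `α ↦ α ∧ ω` on sequences of forms. -/
noncomputable def lefF : Forms (p + 2 * n) M →ₗ[ℝ] Forms (p + 2 * n) M where
  toFun a k x := lef (T.sympl x) (valueAt x a) k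
  map_add' a b := by
    funext k x
    rw [map_add, map_add]
    rfl
  map_smul' c a := by
    funext k x
    rw [map_smul, map_smul]
    rfl

theorem valueAt_lefF (x : M) (a : Forms (p + 2 * n) M) :
    valueAt x (T.lefF a) = lef (T.sympl x) (valueAt x a) := rfl

theorem valueAt_lefF_pow (x : M) (j : ℕ) (a : Forms (p + 2 * n) M) :
    valueAt x ((T.lefF ^ j) a) = (lef (T.sympl x) ^ j) (valueAt x a) := by
  induction j with
  | zero => rfl
  | succ j ih =>
    rw [pow_succ', pow_succ', Module.End.mul_apply, Module.End.mul_apply, valueAt_lefF, ih]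

theorem lefF_pow_mem_degree {k l : ℤ} (j : ℕ) (h : k + 2 * j = l) {a : Forms (p + 2 * n) M}
    (ha : a ∈ degree _ M k) : (T.lefF ^ j) a ∈ degree _ M l :=
  mem_degree.2 fun x => by
    rw [valueAt_lefF_pow]
    exact lef_pow_mem_altDegree _ j h (mem_degree.1 ha x)

theorem lefF_smooth {a : Forms (p + 2 * n) M} (ha : a.Smooth) : (T.lefF a).Smooth := fun k => by
  match k with
  | 0 => exact Form.Smooth.zero
  | 1 => exact Form.Smooth.zero
  | k + 2 => exact (ha k).wedge T.smooth_sympl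

theorem d_lefF {a : Forms (p + 2 * n) M} (ha : a.Smooth) : (T.lefF a).d = T.lefF a.d :=
  funext fun k => by
    match k with
    | 0 => rfl
    | 1 => exact Form.d_zero
    | 2 =>
      change Form.d 0 = T.L 0 0
      rw [Form.d_zero, map_zero]
    | k + 3 => exact Form.d_wedge (ha k) T.smooth_sympl T.closed_sympl

theorem lefF_pow_smooth (j : ℕ) {a : Forms (p + 2 * n) M} (ha : a.Smooth) :
    ((T.lefF ^ j) a).Smooth := by
  induction j with
  | zero => exact ha
  | succ j ih =>
    rw [pow_succ', Module.End.mul_apply]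
    exact T.lefF_smooth ih

theorem d_lefF_pow (j : ℕ) {a : Forms (p + 2 * n) M} (ha : a.Smooth) :
    ((T.lefF ^ j) a).d = (T.lefF ^ j) a.d := by
  induction j with
  | zero => rfl
  | succ j ih =>
    rw [pow_succ', Module.End.mul_apply, Module.End.mul_apply, d_lefF _ (T.lefF_pow_smooth j ha), ih]

/-- The sequences of forms which are horizontal at each point. -/
noncomputable def hor : Submodule ℝ (Forms (p + 2 * n) M) :=
  ⨅ x, (horizontal (T.sympl x)).comap (valueAt x)

theorem mem_hor {a : Forms (p + 2 * n) M} :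
    a ∈ T.hor ↔ ∀ x, valueAt x a ∈ horizontal (T.sympl x) := by
  simp [hor]

theorem lefF_pow_mem_hor (j : ℕ) {a : Forms (p + 2 * n) M} (ha : a ∈ T.hor) :
    (T.lefF ^ j) a ∈ T.hor := T.mem_hor.2 fun x => by
  rw [valueAt_lefF_pow]
  exact lef_pow_mem_horizontal j (T.mem_hor.1 ha x)

theorem mem_hor_iff_isHorizontalFor {a : Forms (p + 2 * n) M} :
    a ∈ T.hor ↔ ∀ k x, IsHorizontalFor (T.sympl x) (a k x) := by
  rw [mem_hor]
  constructor
  · rintro h k x v ⟨i, hi⟩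
    exact apply_eq_zero_of_mem_horizontal (h x) i (by
      ext Y
      rw [flatL_apply]
      exact hi Y)
  · intro h x X hX
    funext k
    ext v
    refine h (k + 1) x (Matrix.vecCons X v) ⟨0, fun Y => ?_⟩
    rw [Matrix.cons_val_zero, ← flatL_apply, hX]
    rfl

/-- The sequences of basic forms. -/
noncomputable def basic : Submodule ℝ (Forms (p + 2 * n) M) where
  carrier := {a | ∀ k, T.IsBasic (a k)}
  zero_mem' := fun _ => Foliation.IsBasic.zero
  add_mem' := fun ha hb k => (ha k).add (hb k)
  smul_mem' := fun c _ ha k => (ha k).smul c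

theorem smooth_of_mem_basic {a : Forms (p + 2 * n) M} (ha : a ∈ T.basic) : a.Smooth :=
  fun k => (ha k).1

theorem lefF_pow_mem_basic (j : ℕ) {a : Forms (p + 2 * n) M} (ha : a ∈ T.basic) :
    (T.lefF ^ j) a ∈ T.basic := by
  induction j with
  | zero => exact ha
  | succ j ih =>
    rw [pow_succ', Module.End.mul_apply]
    intro k
    match k with
    | 0 => exact Foliation.IsBasic.zero
    | 1 => exact Foliation.IsBasic.zero
    | k + 2 => exact T.isBasic_L (ih k)

theorem d_d {a : Forms (p + 2 * n) M} (ha : a ∈ T.basic) : a.d.d = 0 := funext fun k => by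
  match k with
  | 0 => rfl
  | 1 => exact Form.d_zero
  | k + 2 => exact (ha k).1.d_d

section T2

variable [T2Space M]

theorem contract_eq_zero_iff_isHorizontalFor {k : ℕ} {α : Form (p + 2 * n) k M} :
    (∀ X, T.IsTangentField X → α.contract X = 0) ↔ ∀ x, IsHorizontalFor (T.sympl x) (α x) := by
  simp only [Foliation.contract_eq_zero_iff]
  constructor
  · rintro h x v ⟨i, hi⟩
    obtain ⟨X, hX, hXx⟩ := T.exists_isTangentField ((T.ker_sympl x (v i)).2 hi)
    exact h X hX x v ⟨i, hXx.symm⟩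
  · rintro h X hX x v ⟨i, hi⟩
    exact h x v ⟨i, fun Y => by
      rw [hi]
      exact (T.ker_sympl x (X x)).1 (hX.2 x) Y⟩

/-- Since leafwise vector fields attain all leafwise tangent vectors, a smooth form `α` is basic if and
only if `α` and `d α` are pointwise horizontal. -/
theorem isBasic_iff_isHorizontalFor {k : ℕ} {α : Form (p + 2 * n) k M} :
    T.IsBasic α ↔ α.Smooth ∧ (∀ x, IsHorizontalFor (T.sympl x) (α x)) ∧
      ∀ x, IsHorizontalFor (T.sympl x) (α.d x) := by
  rw [Foliation.isBasic_iff, ← contract_eq_zero_iff_isHorizontalFor,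
    ← contract_eq_zero_iff_isHorizontalFor]
  refine and_congr_right fun _ => ?_
  exact ⟨fun h => ⟨fun X hX => (h X hX).1, fun X hX => (h X hX).2⟩,
    fun h X hX => ⟨h.1 X hX, h.2 X hX⟩⟩

theorem isBasic_d {k : ℕ} {α : Form (p + 2 * n) k M} (hα : T.IsBasic α) : T.IsBasic α.d := by
  rw [isBasic_iff_isHorizontalFor] at *
  refine ⟨hα.1.d, hα.2.2, fun x => ?_⟩
  rw [hα.1.d_d]
  exact fun _ _ => rfl

theorem mem_basic_iff {a : Forms (p + 2 * n) M} :
    a ∈ T.basic ↔ a.Smooth ∧ a ∈ T.hor ∧ a.d ∈ T.hor := by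
  rw [mem_hor_iff_isHorizontalFor, mem_hor_iff_isHorizontalFor]
  change (∀ k, T.IsBasic (a k)) ↔ _
  simp only [isBasic_iff_isHorizontalFor]
  constructor
  · intro h
    refine ⟨fun k => (h k).1, fun k => (h k).2.1, fun k => ?_⟩
    cases k with
    | zero => exact fun _ _ _ => rfl
    | succ k => exact (h k).2.2
  · exact fun h k => ⟨h.1 k, h.2.1 k, h.2.2 (k + 1)⟩

theorem d_mem_basic {a : Forms (p + 2 * n) M} (ha : a ∈ T.basic) : a.d ∈ T.basic := fun k => by
  cases k with
  | zero => exact Foliation.IsBasic.zero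
  | succ k => exact T.isBasic_d (ha k)

theorem mem_hor_of_mem_basic {a : Forms (p + 2 * n) M} (ha : a ∈ T.basic) : a ∈ T.hor :=
  (T.mem_basic_iff.1 ha).2.1

end T2

/-- The operator `a ↦ a ∧ ω^j` is injective on `k`-forms for `k + j ≤ n`. -/
theorem lefF_pow_injective {k : ℤ} {j : ℕ} (hk : k + j ≤ n) {a : Forms (p + 2 * n) M}
    (ha : a ∈ degree _ M k) (h : (T.lefF ^ j) a = 0) : a = 0 :=
  ext_valueAt fun x => lef_pow_injective ((T.hasFrame x).lef_pow_oneForm_ne_zero le_rfl) hk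
    (mem_degree.1 ha x) (by rw [← valueAt_lefF_pow, h]; rfl)

/-- If `a ∧ ω^j` is smooth, so is the `k`-form `a`, for `k + j ≤ n`. In a chart, `a` is recovered from
`a ∧ ω^j` by inverting an injective operator with smooth coefficients; the form need not be horizontal
for this operator to be injective. -/
theorem smooth_of_lefF_pow {k : ℤ} {j : ℕ} (hk : k + j ≤ n) {a : Forms (p + 2 * n) M}
    (ha : a ∈ degree _ M k) (h : ((T.lefF ^ j) a).Smooth) : a.Smooth := by
  intro i
  by_cases hi : (i : ℤ) = k
  swap
  · rw [apply_eq_zero_of_mem_degree hi ha]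
    exact Form.Smooth.zero
  intro x₀
  have hfd := finiteDimensional_continuousAlternatingMap (V := Coord (p + 2 * n)) i
  have hfd' := finiteDimensional_continuousAlternatingMap (V := Coord (p + 2 * n)) (i + 2 * j)
  refine contDiffOn_of_clm_apply (contDiffOn_wedgePowL (T.smooth_sympl x₀) i j) (fun y hy α hα => ?_)
    ?_
  · set z := (extChartAt (𝓡 (p + 2 * n)) x₀).symm y with hz
    have hz₀ : z ∈ (extChartAt (𝓡 (p + 2 * n)) x₀).source :=
      (extChartAt (𝓡 (p + 2 * n)) x₀).map_target hy
    have hne : (lef (T.sympl.inChart x₀ y) ^ n) (oneForm _) ≠ 0 := by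
      refine lef_pow_oneForm_pullback_ne_zero (g' := tangentCoordChange (𝓡 (p + 2 * n)) z x₀ z)
        (fun v => ?_) ((T.hasFrame z).lef_pow_oneForm_ne_zero le_rfl)
      have h1 := tangentCoordChange_comp (I := 𝓡 (p + 2 * n)) (w := z) (x := x₀) (y := z) (z := z)
        (v := v) ⟨⟨mem_extChartAt_source z, hz₀⟩, mem_extChartAt_source z⟩
      exact h1.trans (tangentCoordChange_self (mem_extChartAt_source z))
    have hs := single_mem_altDegree hi α
    have h1 := lef_pow_injective hne hk hs (by
      rw [eq_single_of_mem_altDegree (j := i + 2 * j) (k := (i + 2 * j : ℕ)) rfl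
        (lef_pow_mem_altDegree _ j (by rw [← hi]; push_cast; ring) hs), ← wedgePowL_eq,
        AltForms.single_same, hα]
      exact Pi.single_zero _)
    have h2 := congrFun h1 i
    rwa [AltForms.single_same] at h2
  · refine (h (i + 2 * j) x₀).congr fun y _ => ?_
    have h1 := lef_pow_pullback (tangentCoordChange (𝓡 (p + 2 * n)) x₀
      ((extChartAt (𝓡 (p + 2 * n)) x₀).symm y) ((extChartAt (𝓡 (p + 2 * n)) x₀).symm y))
      (T.sympl ((extChartAt (𝓡 (p + 2 * n)) x₀).symm y)) j
      (valueAt ((extChartAt (𝓡 (p + 2 * n)) x₀).symm y) a)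
    rw [← valueAt_lefF_pow] at h1
    exact (wedgePowL_eq _ _ _ _).trans (congrFun h1 (i + 2 * j))

/-- Every horizontal form of degree `n + j` is of the form `b ∧ ω^j`. -/
theorem exists_lefF_pow_eq {j : ℕ} {a : Forms (p + 2 * n) M} (ha : a ∈ degree _ M (n + j : ℕ))
    (hh : a ∈ T.hor) : ∃ b ∈ degree _ M (n - j : ℤ), b ∈ T.hor ∧ (T.lefF ^ j) b = a := by
  choose b h1 h2 h3 using fun x =>
    exists_lef_pow_eq (T.hasFrame x) (mem_degree.1 ha x) (T.mem_hor.1 hh x)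
  let B : Forms (p + 2 * n) M := fun k x => b x k
  exact ⟨B, mem_degree.2 h1, T.mem_hor.2 h2,
    ext_valueAt fun x => (T.valueAt_lefF_pow x j B).trans (h3 x)⟩

theorem eq_zero_of_degree_gt {k : ℤ} (hk : 2 * n < k) {a : Forms (p + 2 * n) M}
    (ha : a ∈ degree _ M k) (hh : a ∈ T.hor) : a = 0 :=
  ext_valueAt fun x => (T.hasFrame x).eq_zero_of_lt hk (mem_degree.1 ha x) (T.mem_hor.1 hh x)

variable [T2Space M]

/-- If `a ∧ ω^j` is basic, so is the horizontal `k`-form `a`, for `k + j ≤ n`: for `X` in the kernel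
of `ω`, the `k`-form `ι_X d a` is annihilated by `ω^j`. -/
theorem mem_basic_of_lefF_pow {k : ℤ} {j : ℕ} (hk : k + j ≤ n) {a : Forms (p + 2 * n) M}
    (ha : a ∈ degree _ M k) (hh : a ∈ T.hor) (h : (T.lefF ^ j) a ∈ T.basic) : a ∈ T.basic := by
  have hs := T.smooth_of_lefF_pow hk ha (T.smooth_of_mem_basic h)
  refine T.mem_basic_iff.2 ⟨hs, hh, T.mem_hor.2 fun x X hX => ?_⟩
  refine lef_pow_injective ((T.hasFrame x).lef_pow_oneForm_ne_zero le_rfl) hk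
    (contr_mem_altDegree rfl X (mem_degree.1 (d_mem_degree rfl ha) x)) ?_
  have h1 := T.mem_hor.1 (T.mem_basic_iff.1 h).2.2 x X hX
  rw [T.d_lefF_pow j hs, valueAt_lefF_pow] at h1
  cases j with
  | zero => exact h1
  | succ j =>
    rw [contr_lef_pow_succ, hX] at h1
    simpa using h1

/-- Every basic form of degree `n + j` is of the form `b ∧ ω^j` with a basic form `b`. -/
theorem exists_basic_lefF_pow_eq {j : ℕ} {a : Forms (p + 2 * n) M}
    (ha : a ∈ degree _ M (n + j : ℕ)) (hb : a ∈ T.basic) :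
    ∃ b ∈ degree _ M (n - j : ℤ), b ∈ T.basic ∧ (T.lefF ^ j) b = a := by
  obtain ⟨b, h1, h2, h3⟩ := T.exists_lefF_pow_eq ha (T.mem_hor_of_mem_basic hb)
  exact ⟨b, h1, T.mem_basic_of_lefF_pow (by omega) h1 h2 (h3 ▸ hb), h3⟩

end TransverselySymplecticFoliation

end TransverseLefschetz

/-! ### Primitive decomposition and the star of basic forms -/

namespace TransverseLefschetz

namespace TransverselySymplecticFoliation

open Forms

variable {p n : ℕ} {M : Type*} [TopologicalSpace M] [ChartedSpace (Coord (p + 2 * n)) M]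
  [IsManifold (𝓡 (p + 2 * n)) ∞ M] (T : TransverselySymplecticFoliation p n M)

/-- The primitive forms of degree `k`: the horizontal forms with `a ∧ ω^(n + 1 - k) = 0`. With
`k : ℤ`, they vanish for `k < 0` and, since the exponent is then `0`, also for `n < k`. -/
noncomputable def primF (k : ℤ) : Submodule ℝ (Forms (p + 2 * n) M) :=
  degree _ M k ⊓ T.hor ⊓ LinearMap.ker (T.lefF ^ (n + 1 - k : ℤ).toNat)

theorem mem_primF {k : ℤ} {a : Forms (p + 2 * n) M} : a ∈ T.primF k ↔
    a ∈ degree _ M k ∧ a ∈ T.hor ∧ (T.lefF ^ (n + 1 - k : ℤ).toNat) a = 0 := by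
  simp [primF, and_assoc]

theorem valueAt_mem_prim {k : ℤ} {a : Forms (p + 2 * n) M} (ha : a ∈ T.primF k) (x : M) :
    valueAt x a ∈ prim (T.sympl x) n k := by
  obtain ⟨h1, h2, h3⟩ := T.mem_primF.1 ha
  refine mem_prim.2 ⟨mem_degree.1 h1 x, T.mem_hor.1 h2 x, ?_⟩
  rw [← valueAt_lefF_pow, h3, map_zero]

theorem lefF_pow_eq_zero_of_mem_primF {k : ℤ} {j : ℕ} (hj : n < k + j)
    {a : Forms (p + 2 * n) M} (ha : a ∈ T.primF k) : (T.lefF ^ j) a = 0 := ext_valueAt fun x => by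
  rw [valueAt_lefF_pow, lef_pow_eq_zero_of_mem_prim hj (T.valueAt_mem_prim ha x), map_zero]

theorem eq_zero_of_mem_primF_neg {k : ℤ} (hk : k < 0) {a : Forms (p + 2 * n) M}
    (ha : a ∈ T.primF k) : a = 0 := eq_zero_of_mem_degree_neg hk (T.mem_primF.1 ha).1

theorem single_mem_basic {k : ℕ} {α : Form (p + 2 * n) k M} (hα : T.IsBasic α) :
    single k α ∈ T.basic := fun i => by
  by_cases hi : i = k
  · subst hi
    rwa [single_same]
  · rw [single_of_ne hi]
    exact Foliation.IsBasic.zero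

theorem lefF_pow_succ (j : ℕ) (a : Forms (p + 2 * n) M) :
    (T.lefF ^ (j + 1)) a = T.lefF ((T.lefF ^ j) a) := by
  rw [pow_succ', Module.End.mul_apply]

theorem lefF_pow_succ' (j : ℕ) (a : Forms (p + 2 * n) M) :
    (T.lefF ^ (j + 1)) a = (T.lefF ^ j) (T.lefF a) := by
  rw [pow_succ, Module.End.mul_apply]

theorem lefF_pow_add (i j : ℕ) (a : Forms (p + 2 * n) M) :
    (T.lefF ^ (i + j)) a = (T.lefF ^ i) ((T.lefF ^ j) a) := by
  rw [pow_add, Module.End.mul_apply]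

theorem lefF_mem_degree {k l : ℤ} (h : k + 2 = l) {a : Forms (p + 2 * n) M}
    (ha : a ∈ degree _ M k) : T.lefF a ∈ degree _ M l :=
  T.lefF_pow_mem_degree 1 (by simpa using h) ha

theorem lefF_mem_basic {a : Forms (p + 2 * n) M} (ha : a ∈ T.basic) : T.lefF a ∈ T.basic :=
  T.lefF_pow_mem_basic 1 ha

theorem d_sum {ι : Type*} (s : Finset ι) {f : ι → Forms (p + 2 * n) M} (hf : ∀ i, f i ∈ T.basic) :
    (∑ i ∈ s, f i).d = ∑ i ∈ s, (f i).d := by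
  classical
  induction s using Finset.induction_on with
  | empty => exact d_zero
  | insert i s hi ih =>
    rw [Finset.sum_insert hi, Finset.sum_insert hi, d_add (T.smooth_of_mem_basic (hf i))
      (T.smooth_of_mem_basic (Submodule.sum_mem _ fun i _ => hf i)), ih]

/-- A primitive form and a multiple of `ω` are linearly independent, even after multiplication by
the power of `ω` that annihilates the primitive form. -/
theorem eq_zero_of_lefF_pow_primF_add {m : ℤ} {j : ℕ} (hj : m + j = n + 1)
    {a Q : Forms (p + 2 * n) M} (ha : a ∈ T.primF m) (hQ : Q ∈ degree _ M (m - 2))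
    (h : (T.lefF ^ j) (a + T.lefF Q) = 0) : Q = 0 := by
  rw [map_add, T.lefF_pow_eq_zero_of_mem_primF (by omega) ha, zero_add, ← lefF_pow_succ'] at h
  exact T.lefF_pow_injective (by push_cast; omega) hQ h

theorem sum_lefF_pow_mem_degree {m : ℤ} (N : ℕ) {f : ℕ → Forms (p + 2 * n) M}
    (hf : ∀ r : ℕ, f r ∈ T.primF (m - 2 * r)) :
    ∑ r ∈ Finset.range N, (T.lefF ^ r) (f r) ∈ degree _ M m :=
  Submodule.sum_mem _ fun r _ => T.lefF_pow_mem_degree r (by ring) (T.mem_primF.1 (hf r)).1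

theorem sum_lefF_pow_succ (N : ℕ) (f : ℕ → Forms (p + 2 * n) M) :
    ∑ r ∈ Finset.range (N + 1), (T.lefF ^ r) (f r) =
      f 0 + T.lefF (∑ r ∈ Finset.range N, (T.lefF ^ r) (f (r + 1))) := by
  rw [Finset.sum_range_succ', map_sum]
  simp only [lefF_pow_succ]
  exact add_comm _ _

/-- Uniqueness of the primitive decomposition. -/
theorem primF_eq_zero_of_sum_eq_zero {m : ℤ} (hm : m ≤ n) {N : ℕ} {f : ℕ → Forms (p + 2 * n) M}
    (hf : ∀ r : ℕ, f r ∈ T.primF (m - 2 * r))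
    (h : ∑ r ∈ Finset.range N, (T.lefF ^ r) (f r) = 0) : ∀ r < N, f r = 0 := by
  induction N generalizing m f with
  | zero => intro r hr; omega
  | succ N ih =>
    rw [sum_lefF_pow_succ] at h
    have hf' : ∀ r : ℕ, f (r + 1) ∈ T.primF (m - 2 - 2 * r) := fun r => by
      have := hf (r + 1)
      rwa [show m - 2 * ((r + 1 : ℕ) : ℤ) = m - 2 - 2 * r by push_cast; ring] at this
    have h0 : f 0 ∈ T.primF m := by simpa using hf 0
    have hQ := T.eq_zero_of_lefF_pow_primF_add (j := (n + 1 - m).toNat) (by omega) h0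
      (T.sum_lefF_pow_mem_degree N hf') (by rw [h, map_zero])
    rw [hQ, map_zero, add_zero] at h
    intro r hr
    cases r with
    | zero => exact h
    | succ r => exact ih (by omega) hf' hQ r (by omega)

/-- If `∑ (a_r + b_r ∧ ω) ∧ ω^r` is annihilated by the power of `ω` that annihilates primitive forms
of the degree of `a_0`, with all `a_r` and `b_r` primitive, then the terms cancel in pairs. -/
theorem add_eq_zero_of_lefF_pow_sum {m : ℤ} (hm : m ≤ n) {j N : ℕ} (hj : m + j = n + 1)
    {a b : ℕ → Forms (p + 2 * n) M} (ha : ∀ r : ℕ, a r ∈ T.primF (m - 2 * r))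
    (hb : ∀ r : ℕ, b r ∈ T.primF (m - 2 - 2 * r)) (haN : a N = 0)
    (h : (T.lefF ^ j) (∑ r ∈ Finset.range N, (T.lefF ^ r) (a r + T.lefF (b r))) = 0) :
    ∀ r < N, a (r + 1) + b r = 0 := by
  have hab : ∀ r : ℕ, a (r + 1) + b r ∈ T.primF (m - 2 - 2 * r) := fun r =>
    Submodule.add_mem _ (by
      have := ha (r + 1)
      rwa [show m - 2 * ((r + 1 : ℕ) : ℤ) = m - 2 - 2 * r by push_cast; ring] at this) (hb r)
  have hsum : ∑ r ∈ Finset.range N, (T.lefF ^ r) (a r + T.lefF (b r)) =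
      a 0 + T.lefF (∑ r ∈ Finset.range N, (T.lefF ^ r) (a (r + 1) + b r)) := by
    have h1 := T.sum_lefF_pow_succ N a
    rw [Finset.sum_range_succ, haN, map_zero, add_zero] at h1
    simp only [map_add, Finset.sum_add_distrib] at h1 ⊢
    rw [h1, map_sum T.lefF (fun r => (T.lefF ^ r) (b r))]
    simp only [← lefF_pow_succ, ← lefF_pow_succ', add_assoc]
  rw [hsum] at h
  exact T.primF_eq_zero_of_sum_eq_zero (by omega) hab
    (T.eq_zero_of_lefF_pow_primF_add hj (by simpa using ha 0) (T.sum_lefF_pow_mem_degree N hab) h)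

/-- Weil's formula for the star of `∑ f_r ∧ ω^(j+r)` with primitive `f_r` of degree `k - 2r`. -/
theorem sum_star {k j t K l : ℕ} (hn : k + j + t = n) (hK : k + 2 * j = K) (hl : k + 2 * t = l)
    (h : K + l = 2 * n) {N : ℕ} {f : ℕ → Forms (p + 2 * n) M}
    (hf : ∀ r : ℕ, f r ∈ T.primF (k - 2 * r : ℤ)) :
    T.star h ((∑ r ∈ Finset.range N, (T.lefF ^ (j + r)) (f r)) K) =
      (∑ r ∈ Finset.range N,
        weilCoeff (k - 2 * r) (j + r) (t + r) • (T.lefF ^ (t + r)) (f r)) l := by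
  funext x
  refine hodgeStar_eq (T.hasFrame x) ?_
  induction N with
  | zero => exact IsHodgeStar.zero
  | succ N ih =>
    rw [Finset.sum_range_succ, Finset.sum_range_succ]
    refine ih.add ?_
    by_cases hN : 2 * N ≤ k
    · have h1 := T.valueAt_mem_prim (hf N) x
      rw [show (k : ℤ) - 2 * N = (k - 2 * N : ℕ) by omega] at h1
      have h2 := isHodgeStar_weil (j := j + N) (r := t + N) (K := K) (l := l) (by omega) (by omega)
        (by omega) h h1
      rw [← valueAt_lefF_pow, ← valueAt_lefF_pow] at h2
      exact h2
    · -- Here `k - 2 * N` truncates, and the primitive form has negative degree.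
      rw [T.eq_zero_of_mem_primF_neg (by omega) (hf N), map_zero, map_zero]
      have h0 : weilCoeff (k - 2 * N) (j + N) (t + N) • (0 : Forms (p + 2 * n) M) = 0 :=
        smul_zero _
      rw [h0]
      exact IsHodgeStar.zero

section T2

variable [T2Space M]

/-- Basic forms have a primitive decomposition with basic components. -/
theorem exists_sum_lefF_pow {k : ℤ} (hk : k ≤ n) {N : ℕ} (hN : k < 2 * N)
    {a : Forms (p + 2 * n) M} (ha : a ∈ degree _ M k) (hb : a ∈ T.basic) :
    ∃ f : ℕ → Forms (p + 2 * n) M, (∀ r : ℕ, f r ∈ T.primF (k - 2 * r)) ∧ (∀ r, f r ∈ T.basic) ∧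
      a = ∑ r ∈ Finset.range N, (T.lefF ^ r) (f r) := by
  induction N generalizing k a with
  | zero =>
    exact ⟨0, fun _ => Submodule.zero_mem _, fun _ => Submodule.zero_mem _,
      eq_zero_of_mem_degree_neg (by simpa using hN) ha⟩
  | succ N ih =>
    obtain ⟨m, hm⟩ := Int.eq_ofNat_of_zero_le (show 0 ≤ n - k by omega)
    obtain ⟨b, hb1, hb2, hb3⟩ := T.exists_basic_lefF_pow_eq (j := m + 2)
      (T.lefF_pow_mem_degree (l := (n + (m + 2) : ℕ)) (m + 1) (by push_cast; omega) ha)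
      (T.lefF_pow_mem_basic (m + 1) hb)
    rw [show (n : ℤ) - (m + 2 : ℕ) = k - 2 by push_cast; omega] at hb1
    obtain ⟨f, hf1, hf2, hf3⟩ := ih (by omega) (by push_cast at hN; omega) hb1 hb2
    -- The component `a - b ∧ ω` of degree `k` is primitive by the choice of `b`.
    have hp : a - T.lefF b ∈ T.basic := Submodule.sub_mem _ hb (T.lefF_mem_basic hb2)
    have hp' : a - T.lefF b ∈ T.primF k := by
      refine T.mem_primF.2 ⟨Submodule.sub_mem _ ha (T.lefF_mem_degree (by omega) hb1),
        T.mem_hor_of_mem_basic hp, ?_⟩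
      rw [show (n + 1 - k : ℤ).toNat = m + 1 by omega, map_sub, ← lefF_pow_succ', hb3, sub_self]
    refine ⟨fun r => Nat.casesOn r (a - T.lefF b) f, fun r => ?_, fun r => ?_, ?_⟩
    · cases r with
      | zero => simpa using hp'
      | succ r =>
        have := hf1 r
        rwa [show k - 2 - 2 * (r : ℤ) = k - 2 * (r + 1 : ℕ) by push_cast; ring] at this
    · cases r with
      | zero => exact hp
      | succ r => exact hf2 r
    · rw [sum_lefF_pow_succ, ← hf3]
      exact (sub_add_cancel _ _).symm

/-- The exterior derivative of a primitive `k`-form has only two primitive components, because it is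
annihilated by `ω^(n + 1 - k)`. -/
theorem exists_d_eq_add {k : ℤ} (hk : k < n) {α : Forms (p + 2 * n) M} (hα : α ∈ T.primF k)
    (hb : α ∈ T.basic) : ∃ a ∈ T.primF (k + 1), ∃ b ∈ T.primF (k - 1),
      α.d = a + T.lefF b ∧ (α = 0 → a = 0 ∧ b = 0) := by
  by_cases h0 : α = 0
  · refine ⟨0, Submodule.zero_mem _, 0, Submodule.zero_mem _, ?_, fun _ => ⟨rfl, rfl⟩⟩
    rw [h0, d_zero, map_zero, add_zero]
  obtain ⟨m, hm⟩ := Int.eq_ofNat_of_zero_le (show 0 ≤ n - k - 1 by omega)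
  have hd : α.d ∈ degree _ M (k + 1) := d_mem_degree rfl (T.mem_primF.1 hα).1
  have hdb := T.mem_hor_of_mem_basic (T.d_mem_basic hb)
  obtain ⟨b, hb1, hb2, hb3⟩ := T.exists_lefF_pow_eq (j := m + 2)
    (T.lefF_pow_mem_degree (l := (n + (m + 2) : ℕ)) (m + 1) (by push_cast; omega) hd)
    (T.lefF_pow_mem_hor (m + 1) hdb)
  rw [show (n : ℤ) - (m + 2 : ℕ) = k - 1 by push_cast; omega] at hb1
  have h1 : (T.lefF ^ (m + 2)) α.d = 0 := by
    rw [← T.d_lefF_pow _ (T.smooth_of_mem_basic hb),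
      T.lefF_pow_eq_zero_of_mem_primF (by push_cast; omega) hα, d_zero]
  refine ⟨α.d - T.lefF b, T.mem_primF.2 ⟨Submodule.sub_mem _ hd (T.lefF_mem_degree (by omega) hb1),
    Submodule.sub_mem _ hdb (T.lefF_pow_mem_hor 1 hb2), ?_⟩, b, T.mem_primF.2 ⟨hb1, hb2, ?_⟩,
    (sub_add_cancel _ _).symm, fun h => absurd h h0⟩
  · rw [show (n + 1 - (k + 1) : ℤ).toNat = m + 1 by omega, map_sub, ← lefF_pow_succ', hb3, sub_self]
  · rw [show (n + 1 - (k - 1) : ℤ).toNat = m + 3 by omega, lefF_pow_succ, hb3, ← lefF_pow_succ, h1]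

/-- Every basic form of degree `K ≤ 2 n` is a sum of terms to which Weil's formula applies. -/
theorem exists_sum_lefF_pow_add {K l : ℕ} (h : K + l = 2 * n) {a : Forms (p + 2 * n) M}
    (ha : a ∈ degree _ M K) (hb : a ∈ T.basic) :
    ∃ k j t : ℕ, k + j + t = n ∧ k + 2 * j = K ∧ k + 2 * t = l ∧
      ∃ (N : ℕ) (f : ℕ → Forms (p + 2 * n) M), (∀ r : ℕ, f r ∈ T.primF (k - 2 * r : ℤ)) ∧
        (∀ r, f r ∈ T.basic) ∧ a = ∑ r ∈ Finset.range N, (T.lefF ^ (j + r)) (f r) := by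
  rcases le_total K n with hK | hK
  · obtain ⟨f, h1, h2, h3⟩ := T.exists_sum_lefF_pow (k := K) (N := K + 1) (by omega) (by omega) ha hb
    exact ⟨K, 0, n - K, by omega, by omega, by omega, K + 1, f, h1, h2, by simpa using h3⟩
  · obtain ⟨j, rfl⟩ := Nat.exists_eq_add_of_le hK
    obtain ⟨b, hb1, hb2, rfl⟩ := T.exists_basic_lefF_pow_eq ha hb
    rw [show (n : ℤ) - j = (n - j : ℕ) by omega] at hb1
    obtain ⟨f, h1, h2, rfl⟩ := T.exists_sum_lefF_pow (N := n - j + 1) (by omega) (by omega) hb1 hb2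
    refine ⟨n - j, j, 0, by omega, by omega, by omega, n - j + 1, f, h1, h2, ?_⟩
    rw [map_sum]
    simp only [lefF_pow_add]

/-- The star of a basic form is basic, as the primitive components of a basic form are. -/
theorem isBasic_star {K l : ℕ} (h : K + l = 2 * n) {α : Form (p + 2 * n) K M} (hα : T.IsBasic α) :
    T.IsBasic (T.star h α) := by
  obtain ⟨k, j, t, hn, hK, hl, N, f, hf1, hf2, hf3⟩ := T.exists_sum_lefF_pow_add h
    (single_mem_degree rfl α) (T.single_mem_basic hα)
  have h1 := T.sum_star hn hK hl h hf1 (N := N)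
  rw [← hf3, single_same] at h1
  rw [h1]
  have h2 := Submodule.sum_mem T.basic (t := Finset.range N) fun r _ =>
    Submodule.smul_mem _ (weilCoeff (k - 2 * r) (j + r) (t + r))
      (T.lefF_pow_mem_basic (t + r) (hf2 r))
  exact h2 l

theorem eq_zero_of_isBasic {k : ℕ} (hk : 2 * n < k) {α : Form (p + 2 * n) k M}
    (hα : T.IsBasic α) : α = 0 := by
  have h := T.eq_zero_of_degree_gt (k := k) (by omega) (single_mem_degree rfl α)
    (T.mem_hor_of_mem_basic (T.single_mem_basic hα))
  rw [← single_same k α, h]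
  rfl

/-- A closed basic form is symplectic harmonic if and only if its star is closed. In degree zero, where
`δ` is zero, the star has degree `2n` and is closed for degree reasons. -/
theorem isHarmonic_iff {K l : ℕ} (h : K + l = 2 * n) {α : Form (p + 2 * n) K M} :
    T.IsHarmonic α ↔ T.IsBasic α ∧ α.d = 0 ∧ (T.star h α).d = 0 := by
  refine and_congr_right fun hα => and_congr_right fun _ => ?_
  have hb := T.isBasic_d (T.isBasic_star h hα)
  cases K with
  | zero => exact ⟨fun _ => T.eq_zero_of_isBasic (by omega) hb, fun _ => rfl⟩
  | succ k =>
    obtain rfl : l = 2 * n - (k + 1) := by omega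
    have hk : k + 1 ≤ 2 * n := by omega
    have hs : ∀ β : Form (p + 2 * n) (2 * n - (k + 1) + 1) M, T.IsBasic β →
        (T.star (l := k) (by omega) β = 0 ↔ β = 0) := by
      intro β hβ
      constructor
      · intro h0
        funext x
        exact eq_zero_of_hodgeStar_eq_zero (T.hasFrame x) _
          ((T.isBasic_iff_isHorizontalFor.1 hβ).2.1 x) (congrFun h0 x)
      · rintro rfl
        funext x
        exact hodgeStar_eq (T.hasFrame x) IsHodgeStar.zero
    rw [← hs _ hb]
    rw [show T.δ α = (-1 : ℝ) ^ (k + 1 + 1) • T.star (l := k) (by omega) (T.star h α).d from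
      dif_pos hk]
    exact smul_eq_zero_iff_right (pow_ne_zero _ (by norm_num))

end T2

end TransverselySymplecticFoliation

end TransverseLefschetz

/-! ### Harmonic representatives and the Lefschetz property -/

namespace TransverseLefschetz

/-- The coefficients of Weil's formula alternate in sign along a primitive decomposition. -/
theorem weilCoeff_mul_neg (k j r : ℕ) :
    weilCoeff k (j + 1) (r + 1) * weilCoeff (k + 2) j r < 0 := by
  have h : ((-1 : ℝ) ^ (k + 1).choose 2) * (-1) ^ (k + 3).choose 2 = -1 := by
    rw [← pow_add, show (k + 1).choose 2 + (k + 3).choose 2 =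
      2 * ((k + 1).choose 2 + k + 1) + 1 by
        rw [Nat.choose_succ_succ (k + 2) 1, Nat.choose_succ_succ (k + 1) 1, Nat.choose_one_right,
          Nat.choose_one_right]
        ring]
    exact Odd.neg_one_pow ⟨_, rfl⟩
  have h2 : weilCoeff k (j + 1) (r + 1) * weilCoeff (k + 2) j r =
      ((-1 : ℝ) ^ (k + 1).choose 2 * (-1) ^ (k + 3).choose 2) * ((j + 1).factorial *
        ((r + 1).factorial : ℝ)⁻¹ * (j.factorial * (r.factorial : ℝ)⁻¹)) := by
    unfold weilCoeff
    ring
  rw [h2, h, neg_one_mul, neg_lt_zero]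
  positivity

theorem weilCoeff_ne_zero (k j r : ℕ) : weilCoeff k j r ≠ 0 := by
  unfold weilCoeff
  have : (-1 : ℝ) ^ (k + 1).choose 2 ≠ 0 := pow_ne_zero _ (by norm_num)
  positivity

namespace TransverselySymplecticFoliation

open Forms

variable {p n : ℕ} {M : Type*} [TopologicalSpace M] [ChartedSpace (Coord (p + 2 * n)) M]
  [IsManifold (𝓡 (p + 2 * n)) ∞ M] (T : TransverselySymplecticFoliation p n M)

/-- Suppose that `∑ (a_r + b_r ∧ ω) ∧ ω^r`, with primitive `a_r` and `b_r`, is annihilated by `ω^j`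
and that the same sum weighted with the coefficients of Weil's formula vanishes. The two conditions
relate `a_(r+1)` to `b_r` by coefficients of opposite signs, so that all terms vanish. -/
theorem sum_eq_zero_of_weilCoeff {k j : ℕ} (hj : k + j = n) (hj0 : 0 < j)
    {a b : ℕ → Forms (p + 2 * n) M} (ha : ∀ r : ℕ, a r ∈ T.primF ((k + 1 : ℤ) - 2 * r))
    (hb : ∀ r : ℕ, b r ∈ T.primF ((k + 1 : ℤ) - 2 - 2 * r)) (h0 : ∀ r, k < 2 * r → a r = 0)
    (e1 : (T.lefF ^ j) (∑ r ∈ Finset.range (k + 1), (T.lefF ^ r) (a r + T.lefF (b r))) = 0)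
    (e2 : ∑ r ∈ Finset.range (k + 1), (T.lefF ^ r) (weilCoeff (k - 2 * r) (j + r) r • a r +
      T.lefF (weilCoeff (k - 2 * r) (j + r) r • b r)) = 0) :
    ∑ r ∈ Finset.range (k + 1), (T.lefF ^ r) (a r + T.lefF (b r)) = 0 := by
  let c : ℕ → ℝ := fun r => weilCoeff (k - 2 * r) (j + r) r
  change ∑ r ∈ Finset.range (k + 1), (T.lefF ^ r) (c r • a r + T.lefF (c r • b r)) = 0 at e2
  have haN : a (k + 1) = 0 := h0 _ (by omega)
  have f1 := T.add_eq_zero_of_lefF_pow_sum (m := k + 1) (j := j) (by omega) (by omega) ha hb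
    haN e1
  have f2 := T.add_eq_zero_of_lefF_pow_sum (m := k + 1) (j := j) (by omega) (by omega)
    (fun r => Submodule.smul_mem _ (c r) (ha r)) (fun r => Submodule.smul_mem _ (c r) (hb r))
    (by rw [haN, smul_zero]) (by rw [e2, map_zero])
  have f3 : ∀ r < k + 1, a (r + 1) = 0 := by
    intro r hr
    by_cases hr2 : k < 2 * (r + 1)
    · exact h0 _ hr2
    have hc := weilCoeff_mul_neg (k - 2 * (r + 1)) (j + r) r
    rw [show k - 2 * (r + 1) + 2 = k - 2 * r by omega] at hc
    have hc' : c (r + 1) * c r < 0 := hc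
    have g2 := f2 r hr
    have g1 : b r = -a (r + 1) := (neg_eq_of_add_eq_zero_right (f1 r hr)).symm
    rw [g1] at g2
    -- The factor is nonzero, as the two coefficients have opposite signs.
    have g3 : (c (r + 1) - c r) • a (r + 1) = 0 := by
      rw [← g2]
      module
    refine (smul_eq_zero.1 g3).resolve_left fun h => ?_
    rw [sub_eq_zero.1 h] at hc'
    exact absurd hc' (not_lt.2 (mul_self_nonneg _))
  have f4 : ∀ r < k + 1, b r = 0 := fun r hr => by
    have := f1 r hr
    rwa [f3 r hr, zero_add] at this
  have f5 : a 0 = 0 := by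
    rw [sum_lefF_pow_succ] at e2
    have hz : ∑ r ∈ Finset.range k, (T.lefF ^ r) (c (r + 1) • a (r + 1) +
        T.lefF (c (r + 1) • b (r + 1))) = 0 := Finset.sum_eq_zero fun r hr => by
      have := Finset.mem_range.1 hr
      rw [f3 r (by omega), f4 (r + 1) (by omega), smul_zero, map_zero, add_zero, map_zero]
    rw [hz, f4 0 (by omega), smul_zero, map_zero, add_zero, add_zero] at e2
    exact (smul_eq_zero.1 e2).resolve_left (weilCoeff_ne_zero _ _ _)
  refine Finset.sum_eq_zero fun r hr => ?_
  rw [f4 r (Finset.mem_range.1 hr), map_zero, add_zero]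
  cases r with
  | zero => exact f5
  | succ r => rw [f3 r (by have := Finset.mem_range.1 hr; omega), map_zero]

section T2

variable [T2Space M]

/-- If `β ∧ ω^(n - k)` is symplectic harmonic, for a basic `k`-form `β` with `k < n`, then `β` is
closed. -/
theorem d_eq_zero_of_isHarmonic {k j : ℕ} (hj : k + j = n) (hj0 : 0 < j)
    {β : Forms (p + 2 * n) M} (hβ : β ∈ degree _ M k) (hb : β ∈ T.basic)
    (h : T.IsHarmonic ((T.lefF ^ j) β (k + 2 * j))) : β.d = 0 := by
  obtain ⟨α, hα1, hα2, hα3⟩ := T.exists_sum_lefF_pow (N := k + 1) (by omega) (by omega) hβ hb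
  choose a ha b hb' hd h0 using fun r : ℕ => T.exists_d_eq_add (by omega) (hα1 r) (hα2 r)
  have ha' : ∀ r : ℕ, a r ∈ T.primF ((k + 1 : ℤ) - 2 * r) := fun r => by
    have := ha r
    rwa [show (k : ℤ) - 2 * r + 1 = k + 1 - 2 * r by ring] at this
  have hb'' : ∀ r : ℕ, b r ∈ T.primF ((k + 1 : ℤ) - 2 - 2 * r) := fun r => by
    have := hb' r
    rwa [show (k : ℤ) - 2 * r - 1 = k + 1 - 2 - 2 * r by ring] at this
  have hα0 : ∀ r : ℕ, k < 2 * r → α r = 0 := fun r hr =>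
    T.eq_zero_of_mem_primF_neg (by omega) (hα1 r)
  have hβd : β.d = ∑ r ∈ Finset.range (k + 1), (T.lefF ^ r) (a r + T.lefF (b r)) := by
    conv_lhs => rw [hα3]
    rw [T.d_sum _ fun r => T.lefF_pow_mem_basic r (hα2 r)]
    refine Finset.sum_congr rfl fun r _ => ?_
    rw [T.d_lefF_pow r (T.smooth_of_mem_basic (hα2 r)), hd]
  rw [T.isHarmonic_iff (l := k) (by omega)] at h
  obtain ⟨-, h1, h2⟩ := h
  have hdeg : (T.lefF ^ j) β ∈ degree _ M (k + 2 * j : ℕ) :=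
    T.lefF_pow_mem_degree j (by push_cast; ring) hβ
  have e1 : (T.lefF ^ j) (∑ r ∈ Finset.range (k + 1), (T.lefF ^ r) (a r + T.lefF (b r))) = 0 := by
    rw [← hβd, ← T.d_lefF_pow j (T.smooth_of_mem_basic hb)]
    exact eq_zero_of_apply_eq_zero (k := k + 2 * j + 1)
      (d_mem_degree (Nat.cast_succ (k + 2 * j)).symm hdeg) h1
  have e2 : ∑ r ∈ Finset.range (k + 1), (T.lefF ^ r)
      (weilCoeff (k - 2 * r) (j + r) r • a r +
        T.lefF (weilCoeff (k - 2 * r) (j + r) r • b r)) = 0 := by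
    have hs := T.sum_star (k := k) (j := j) (t := 0) (K := k + 2 * j) (l := k) hj rfl rfl
      (by omega) (N := k + 1) hα1
    simp only [lefF_pow_add, ← map_sum] at hs
    simp only [pow_zero, Module.End.one_apply, zero_add] at hs
    rw [← hα3] at hs
    rw [hs] at h2
    have hB : ∀ r, weilCoeff (k - 2 * r) (j + r) r • (T.lefF ^ r) (α r) ∈ T.basic := fun r =>
      Submodule.smul_mem _ _ (T.lefF_pow_mem_basic r (hα2 r))
    have hD : ∑ r ∈ Finset.range (k + 1), weilCoeff (k - 2 * r) (j + r) r • (T.lefF ^ r) (α r) ∈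
        degree _ M k := Submodule.sum_mem _ fun r _ => Submodule.smul_mem _ _
        (T.lefF_pow_mem_degree r (by ring) (T.mem_primF.1 (hα1 r)).1)
    have h3 := eq_zero_of_apply_eq_zero (k := k + 1)
      (d_mem_degree (Nat.cast_succ k).symm hD) h2
    rw [T.d_sum _ hB] at h3
    rw [← h3]
    refine Finset.sum_congr rfl fun r _ => ?_
    rw [d_smul, T.d_lefF_pow r (T.smooth_of_mem_basic (hα2 r)), hd, map_smul, ← smul_add, map_smul]
  rw [hβd]
  exact T.sum_eq_zero_of_weilCoeff hj hj0 ha' hb'' (fun r hr => (h0 _ (hα0 r hr)).1) e1 e2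

end T2

/-- The span of the forms `a ∧ ω^j` of degree `m`, where `a` is a closed basic primitive form. -/
noncomputable def harSpan (m : ℤ) : Submodule ℝ (Forms (p + 2 * n) M) :=
  Submodule.span ℝ {u | ∃ (k j : ℕ), k + 2 * j = m ∧ ∃ a ∈ T.primF k, a ∈ T.basic ∧ a.d = 0 ∧
    u = (T.lefF ^ j) a}

theorem lefF_pow_mem_harSpan {m l : ℤ} (i : ℕ) (h : m + 2 * i = l) {u : Forms (p + 2 * n) M}
    (hu : u ∈ T.harSpan m) : (T.lefF ^ i) u ∈ T.harSpan l := by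
  induction hu using Submodule.span_induction with
  | zero => rw [map_zero]; exact Submodule.zero_mem _
  | add x y _ _ hx hy => rw [map_add]; exact Submodule.add_mem _ hx hy
  | smul c x _ hx => rw [map_smul]; exact Submodule.smul_mem _ _ hx
  | mem u hu =>
    obtain ⟨k, j, hkj, a, h1, h2, h3, rfl⟩ := hu
    rw [← lefF_pow_add]
    exact Submodule.subset_span ⟨k, i + j, by push_cast; omega, a, h1, h2, h3, rfl⟩

theorem mem_of_mem_harSpan {m : ℤ} {u : Forms (p + 2 * n) M} (hu : u ∈ T.harSpan m) :
    u ∈ degree _ M m ∧ u ∈ T.basic ∧ u.d = 0 := by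
  induction hu using Submodule.span_induction with
  | zero => exact ⟨Submodule.zero_mem _, Submodule.zero_mem _, d_zero⟩
  | add x y _ _ hx hy =>
    exact ⟨Submodule.add_mem _ hx.1 hy.1, Submodule.add_mem _ hx.2.1 hy.2.1, by
      rw [d_add (T.smooth_of_mem_basic hx.2.1) (T.smooth_of_mem_basic hy.2.1), hx.2.2, hy.2.2,
        add_zero]⟩
  | smul c x _ hx =>
    exact ⟨Submodule.smul_mem _ _ hx.1, Submodule.smul_mem _ _ hx.2.1, by
      rw [d_smul, hx.2.2, smul_zero]⟩
  | mem u hu =>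
    obtain ⟨k, j, hkj, a, h1, h2, h3, rfl⟩ := hu
    exact ⟨T.lefF_pow_mem_degree j hkj (T.mem_primF.1 h1).1, T.lefF_pow_mem_basic j h2, by
      rw [T.d_lefF_pow j (T.smooth_of_mem_basic h2), h3, map_zero]⟩

/-- By Weil's formula, the elements of `harSpan` have closed stars. -/
theorem exists_star_of_mem_harSpan {K l : ℕ} (h : K + l = 2 * n) {u : Forms (p + 2 * n) M}
    (hu : u ∈ T.harSpan K) : ∃ v : Forms (p + 2 * n) M, v ∈ T.basic ∧ v.d = 0 ∧
      ∀ x, IsHodgeStar n h (T.sympl x) (u K x) (v l x) := by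
  induction hu using Submodule.span_induction with
  | zero => exact ⟨0, Submodule.zero_mem _, d_zero, fun _ => IsHodgeStar.zero⟩
  | add x y _ _ hx hy =>
    obtain ⟨v, h1, h2, h3⟩ := hx
    obtain ⟨w, g1, g2, g3⟩ := hy
    exact ⟨v + w, Submodule.add_mem _ h1 g1, by
      rw [d_add (T.smooth_of_mem_basic h1) (T.smooth_of_mem_basic g1), h2, g2, add_zero],
      fun x => (h3 x).add (g3 x)⟩
  | smul c x _ hx =>
    obtain ⟨v, h1, h2, h3⟩ := hx
    exact ⟨c • v, Submodule.smul_mem _ _ h1, by rw [d_smul, h2, smul_zero],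
      fun x => (h3 x).smul c⟩
  | mem u hu =>
    obtain ⟨k, j, hkj, a, h1, h2, h3, rfl⟩ := hu
    by_cases hn : n < k + j
    · rw [T.lefF_pow_eq_zero_of_mem_primF (by omega) h1]
      exact ⟨0, Submodule.zero_mem _, d_zero, fun _ => IsHodgeStar.zero⟩
    refine ⟨weilCoeff k j (n - k - j) • (T.lefF ^ (n - k - j)) a,
      Submodule.smul_mem _ _ (T.lefF_pow_mem_basic _ h2), ?_, fun x => ?_⟩
    · rw [d_smul, T.d_lefF_pow _ (T.smooth_of_mem_basic h2), h3, map_zero, smul_zero]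
    · have := isHodgeStar_weil (j := j) (r := n - k - j) (K := K) (l := l) (by omega) (by omega)
        (by omega) h (T.valueAt_mem_prim h1 x)
      rw [← valueAt_lefF_pow, ← valueAt_lefF_pow] at this
      exact this

variable [T2Space M]

theorem isHarmonic_of_mem_harSpan {K : ℕ} (hK : K ≤ 2 * n) {u : Forms (p + 2 * n) M}
    (hu : u ∈ T.harSpan K) : T.IsHarmonic (u K) := by
  obtain ⟨-, h2, h3⟩ := T.mem_of_mem_harSpan hu
  obtain ⟨v, h4, h5, h6⟩ := T.exists_star_of_mem_harSpan (l := 2 * n - K) (by omega) hu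
  rw [T.isHarmonic_iff (l := 2 * n - K) (by omega)]
  refine ⟨h2 K, congrFun h3 (K + 1), ?_⟩
  rw [show T.star (l := 2 * n - K) (by omega) (u K) = v (2 * n - K) from
    funext fun x => hodgeStar_eq (T.hasFrame x) (h6 x)]
  exact congrFun h5 (2 * n - K + 1)

/-- Surjectivity of `L^(n - k)` on basic cohomology, in terms of forms. An integer degree `k` lets
inductions in steps of two run past zero. -/
def LefschetzSurj (k : ℤ) : Prop :=
  ∀ β ∈ degree _ M (2 * n - k : ℤ), β ∈ T.basic → β.d = 0 →
    ∃ b ∈ degree _ M k, b ∈ T.basic ∧ b.d = 0 ∧ ∃ γ ∈ degree _ M (2 * n - k - 1 : ℤ),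
      γ ∈ T.basic ∧ β = (T.lefF ^ (n - k : ℤ).toNat) b + γ.d

/-- For `k < 0`, the target consists of forms of degree greater than `2n`. -/
theorem lefschetzSurj_of_neg {k : ℤ} (hk : k < 0) : T.LefschetzSurj k := by
  intro β h1 h2 _
  refine ⟨0, Submodule.zero_mem _, Submodule.zero_mem _, d_zero, 0, Submodule.zero_mem _,
    Submodule.zero_mem _, ?_⟩
  rw [T.eq_zero_of_degree_gt (by omega) h1 (T.mem_hor_of_mem_basic h2), map_zero, d_zero, add_zero]

/-- Under the Lefschetz property in degrees at most `s`, the closed basic forms of degree at most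
`s + 2` are cohomologous to sums of closed primitive forms multiplied by powers of `ω`. -/
theorem exists_eq_harSpan_add {s : ℤ} (hs : ∀ k ≤ s, T.LefschetzSurj k) {N : ℕ} {k : ℤ}
    (hN : k < N) (hk : k ≤ s + 2) (hkn : k ≤ n) {α : Forms (p + 2 * n) M}
    (hα : α ∈ degree _ M k) (hb : α ∈ T.basic) (hd : α.d = 0) :
    ∃ u ∈ T.harSpan k, ∃ θ ∈ degree _ M (k - 1), θ ∈ T.basic ∧ α = u + θ.d := by
  induction N generalizing k α with
  | zero =>
    refine ⟨0, Submodule.zero_mem _, 0, Submodule.zero_mem _, Submodule.zero_mem _, ?_⟩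
    rw [eq_zero_of_mem_degree_neg (by simpa using hN) hα, d_zero, add_zero]
  | succ N ih =>
    rcases lt_or_ge k 0 with hk0 | hk0
    · refine ⟨0, Submodule.zero_mem _, 0, Submodule.zero_mem _, Submodule.zero_mem _, ?_⟩
      rw [eq_zero_of_mem_degree_neg hk0 hα, d_zero, add_zero]
    obtain ⟨m, hm⟩ := Int.eq_ofNat_of_zero_le (show 0 ≤ n - k by omega)
    -- `α ∧ ω^(m+1) = b ∧ ω^(m+2) + d γ` and `γ = θ ∧ ω^(m+1)`, so that `α - b ∧ ω - d θ` is primitive.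
    obtain ⟨b, hb1, hb2, hb3, γ, hγ1, hγ2, hγ3⟩ := hs (k - 2) (by omega) ((T.lefF ^ (m + 1)) α)
      (T.lefF_pow_mem_degree _ (by push_cast; omega) hα) (T.lefF_pow_mem_basic _ hb)
      (by rw [T.d_lefF_pow _ (T.smooth_of_mem_basic hb), hd, map_zero])
    rw [show (n - (k - 2) : ℤ).toNat = m + 2 by omega] at hγ3
    rw [show (2 * n - (k - 2) - 1 : ℤ) = (n + (m + 1) : ℕ) by push_cast; omega] at hγ1
    obtain ⟨θ, hθ1, hθ2, rfl⟩ := T.exists_basic_lefF_pow_eq hγ1 hγ2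
    rw [show (n : ℤ) - (m + 1 : ℕ) = k - 1 by push_cast; omega] at hθ1
    rw [T.d_lefF_pow _ (T.smooth_of_mem_basic hθ2), T.lefF_pow_succ' (m + 1) b, ← map_add] at hγ3
    obtain ⟨u, hu, η, hη1, hη2, rfl⟩ := ih (by push_cast at hN; omega) (by omega) (by omega)
      hb1 hb2 hb3
    have hη3 := T.smooth_of_mem_basic hη2
    have hLu := T.lefF_pow_mem_harSpan 1 (l := k) (by push_cast; ring) hu
    have hLη := T.lefF_mem_basic hη2
    have hz : α - (T.lefF (u + η.d) + θ.d) ∈ T.basic := Submodule.sub_mem _ hb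
      (Submodule.add_mem _ (T.lefF_mem_basic hb2) (T.d_mem_basic hθ2))
    have hz0 : α - (T.lefF (u + η.d) + θ.d) ∈ degree _ M k := Submodule.sub_mem _ hα
      (Submodule.add_mem _ (T.lefF_mem_degree (by ring) hb1) (d_mem_degree (by ring) hθ1))
    have hz1 : α - (T.lefF (u + η.d) + θ.d) ∈ T.primF k :=
      T.mem_primF.2 ⟨hz0, T.mem_hor_of_mem_basic hz, by
        rw [show (n + 1 - k : ℤ).toNat = m + 1 by omega, map_sub, hγ3, sub_self]⟩
    have hz2 : (α - (T.lefF (u + η.d) + θ.d)).d = 0 := by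
      rw [d_sub (T.smooth_of_mem_basic hb) (T.smooth_of_mem_basic (Submodule.add_mem _
        (T.lefF_mem_basic hb2) (T.d_mem_basic hθ2))), d_add (T.lefF_smooth
        (T.smooth_of_mem_basic hb2)) (T.smooth_of_mem_basic (T.d_mem_basic hθ2)),
        T.d_lefF (T.smooth_of_mem_basic hb2), hb3, hd, T.d_d hθ2, map_zero, add_zero, sub_zero]
    obtain ⟨k, rfl⟩ := Int.eq_ofNat_of_zero_le hk0
    refine ⟨α - (T.lefF (u + η.d) + θ.d) + T.lefF u, Submodule.add_mem _
      (Submodule.subset_span ⟨k, 0, by simp, _, hz1, hz, hz2, rfl⟩) hLu, T.lefF η + θ,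
      Submodule.add_mem _ (T.lefF_mem_degree (by ring) hη1) hθ1, Submodule.add_mem _ hLη hθ2, ?_⟩
    rw [d_add (T.smooth_of_mem_basic hLη) (T.smooth_of_mem_basic hθ2), T.d_lefF hη3, map_add]
    abel

/-- Existence of symplectic harmonic representatives of basic cohomology classes, in terms of
forms. -/
def HarmonicRep (K : ℕ) : Prop :=
  ∀ β ∈ degree _ M (K : ℤ), β ∈ T.basic → β.d = 0 →
    ∃ γ ∈ degree _ M (K - 1 : ℤ), γ ∈ T.basic ∧ T.IsHarmonic ((β - γ.d) K)

theorem harmonicRep_of_lefschetzSurj {s k : ℕ} (hs : ∀ i ≤ (s : ℤ), T.LefschetzSurj i)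
    (hk : k ≤ s + 2) (hkn : k ≤ n) : T.HarmonicRep k := by
  intro β h1 h2 h3
  obtain ⟨u, hu, θ, hθ1, hθ2, rfl⟩ := T.exists_eq_harSpan_add hs (N := k + 1) (by omega) (by omega)
    (by omega) h1 h2 h3
  refine ⟨θ, hθ1, hθ2, ?_⟩
  rw [add_sub_cancel_right]
  exact T.isHarmonic_of_mem_harSpan (by omega) hu

theorem harmonicRep_sub_of_lefschetzSurj {s k : ℕ} (hs : ∀ i ≤ (s : ℤ), T.LefschetzSurj i)
    (hk : k ≤ s) (hkn : k ≤ n) : T.HarmonicRep (2 * n - k) := by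
  intro β h1 h2 h3
  rw [show ((2 * n - k : ℕ) : ℤ) = 2 * n - k by omega] at h1
  obtain ⟨b, hb1, hb2, hb3, γ, hγ1, hγ2, rfl⟩ := hs k (by omega) β h1 h2 h3
  obtain ⟨u, hu, θ, hθ1, hθ2, rfl⟩ := T.exists_eq_harSpan_add hs (N := k + 1) (by omega) (by omega)
    (by omega) hb1 hb2 hb3
  have hL := T.lefF_pow_mem_basic (n - k : ℤ).toNat hθ2
  refine ⟨(T.lefF ^ (n - k : ℤ).toNat) θ + γ, Submodule.add_mem _
    (T.lefF_pow_mem_degree _ (by omega) hθ1) ?_, Submodule.add_mem _ hL hγ2, ?_⟩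
  · rwa [show ((2 * n - k : ℕ) : ℤ) - 1 = 2 * n - k - 1 by omega]
  · have he : (T.lefF ^ (n - k : ℤ).toNat) (u + θ.d) + γ.d -
        ((T.lefF ^ (n - k : ℤ).toNat) θ + γ).d = (T.lefF ^ (n - k : ℤ).toNat) u := by
      rw [d_add (T.smooth_of_mem_basic hL) (T.smooth_of_mem_basic hγ2),
        T.d_lefF_pow _ (T.smooth_of_mem_basic hθ2), map_add]
      abel
    rw [he]
    exact T.isHarmonic_of_mem_harSpan (by omega) (T.lefF_pow_mem_harSpan _ (by omega) hu)

theorem lefschetzSurj_of_harmonicRep {k : ℕ} (hk : k < n) (h : T.HarmonicRep (2 * n - k)) :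
    T.LefschetzSurj k := by
  intro β h1 h2 h3
  have hK : (2 * n - k : ℤ) = (2 * n - k : ℕ) := by omega
  rw [hK] at h1
  obtain ⟨γ, hγ1, hγ2, hγ3⟩ := h β h1 h2 h3
  have hδ : β - γ.d ∈ T.basic := Submodule.sub_mem _ h2 (T.d_mem_basic hγ2)
  have hδ' : β - γ.d ∈ degree _ M (n + (n - k) : ℕ) := by
    rw [show n + (n - k) = 2 * n - k by omega]
    exact Submodule.sub_mem _ h1 (d_mem_degree (by ring) hγ1)
  obtain ⟨b, hb1, hb2, hb3⟩ := T.exists_basic_lefF_pow_eq hδ' hδ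
  rw [show (n : ℤ) - (n - k : ℕ) = k by omega] at hb1
  refine ⟨b, hb1, hb2, ?_, γ, ?_, hγ2, ?_⟩
  · refine T.d_eq_zero_of_isHarmonic (j := n - k) (by omega) (by omega) hb1 hb2 ?_
    rwa [hb3, show k + 2 * (n - k) = 2 * n - k by omega]
  · rwa [hK]
  · rw [show (n - k : ℤ).toNat = n - k by omega, hb3]
    exact (sub_add_cancel _ _).symm

end TransverselySymplecticFoliation

end TransverseLefschetz

/-! ### Cohomology classes -/

namespace TransverseLefschetz

namespace TransverselySymplecticFoliation

open Forms

variable {p n : ℕ} {M : Type*} [TopologicalSpace M] [ChartedSpace (Coord (p + 2 * n)) M]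
  [IsManifold (𝓡 (p + 2 * n)) ∞ M] (T : TransverselySymplecticFoliation p n M)

/-- The basic cohomology class of the component of degree `K` of a closed sequence of basic
forms. -/
noncomputable def classOf (K : ℕ) {a : Forms (p + 2 * n) M} (hb : a ∈ T.basic) (hd : a.d = 0) :
    T.HB K :=
  Submodule.Quotient.mk ⟨a K, hb K, congrFun hd (K + 1)⟩

theorem d_single {m k : ℕ} {M : Type*} [TopologicalSpace M] [ChartedSpace (Coord m) M]
    [IsManifold (𝓡 m) ∞ M] (α : Form m k M) : (single k α).d = single (k + 1) α.d := by
  have h := eq_single_of_mem_degree (j := k + 1) rfl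
    (d_mem_degree (l := (k + 1 : ℕ)) (Nat.cast_succ k).symm (single_mem_degree rfl α))
  rw [h, d_succ, single_same]

/-- In degree zero there is no exact form other than zero, in agreement with the absence of forms of
degree `-1`. -/
theorem mem_exactBasic_iff {K : ℕ} {a : Forms (p + 2 * n) M} (ha : a ∈ degree _ M K) :
    a K ∈ T.exactBasic K ↔ ∃ γ ∈ degree _ M (K - 1 : ℤ), γ ∈ T.basic ∧ a = γ.d := by
  cases K with
  | zero =>
    constructor
    · intro h
      refine ⟨0, Submodule.zero_mem _, Submodule.zero_mem _, ?_⟩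
      rw [d_zero]
      exact eq_zero_of_apply_eq_zero ha h
    · rintro ⟨γ, h1, -, rfl⟩
      exact Submodule.zero_mem _
  | succ K =>
    constructor
    · rintro ⟨γ, h1, h2⟩
      refine ⟨single K γ, single_mem_degree (by push_cast; ring) γ, T.single_mem_basic h1, ?_⟩
      rw [d_single, h2]
      exact eq_single_of_mem_degree rfl ha
    · rintro ⟨γ, -, h2, rfl⟩
      exact ⟨γ K, h2 K, rfl⟩

theorem classOf_eq_iff {K : ℕ} {a b : Forms (p + 2 * n) M} (ha : a ∈ degree _ M K)
    (hb : b ∈ degree _ M K) (ha1 : a ∈ T.basic) (ha2 : a.d = 0) (hb1 : b ∈ T.basic)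
    (hb2 : b.d = 0) : T.classOf K ha1 ha2 = T.classOf K hb1 hb2 ↔
      ∃ γ ∈ degree _ M (K - 1 : ℤ), γ ∈ T.basic ∧ a = b + γ.d := by
  unfold classOf
  rw [Submodule.Quotient.eq]
  refine (T.mem_exactBasic_iff (Submodule.sub_mem _ ha hb)).trans ?_
  simp only [sub_eq_iff_eq_add']

theorem exists_classOf_eq {K : ℕ} (c : T.HB K) : ∃ a ∈ degree _ M (K : ℤ),
    ∃ (h1 : a ∈ T.basic) (h2 : a.d = 0), T.classOf K h1 h2 = c := by
  obtain ⟨⟨α, hα1, hα2⟩, rfl⟩ := Submodule.Quotient.mk_surjective _ c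
  refine ⟨single K α, single_mem_degree rfl α, T.single_mem_basic hα1, ?_, ?_⟩
  · rw [d_single, hα2]
    exact Pi.single_zero _
  · unfold classOf
    congr 2
    exact single_same K α

theorem lefschetzPow_classOf (k j : ℕ) {a : Forms (p + 2 * n) M} (h1 : a ∈ T.basic)
    (h2 : a.d = 0) (h3 : ((T.lefF ^ j) a).d = 0) : T.lefschetzPow k j (T.classOf k h1 h2) =
      T.classOf (k + 2 * j) (T.lefF_pow_mem_basic j h1) h3 := by
  induction j with
  | zero => rfl
  | succ j ih =>
    have h4 : ((T.lefF ^ j) a).d = 0 := by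
      rw [T.d_lefF_pow j (T.smooth_of_mem_basic h1), h2, map_zero]
    change T.lefschetzStep (k + 2 * j) (T.lefschetzPow k j _) = _
    rw [ih h4]
    unfold classOf
    simp only [lefF_pow_succ]
    rfl

theorem castHB_classOf {k l : ℕ} (h : k = l) {a : Forms (p + 2 * n) M} (h1 : a ∈ T.basic)
    (h2 : a.d = 0) : T.castHB h (T.classOf k h1 h2) = T.classOf l h1 h2 := by
  subst h
  rfl

theorem lefschetz_classOf {k : ℕ} (hk : k ≤ n) {a : Forms (p + 2 * n) M} (h1 : a ∈ T.basic)
    (h2 : a.d = 0) (h3 : ((T.lefF ^ (n - k)) a).d = 0) : T.lefschetz k hk (T.classOf k h1 h2) =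
      T.classOf (2 * n - k) (T.lefF_pow_mem_basic _ h1) h3 :=
  (congrArg _ (T.lefschetzPow_classOf k (n - k) h1 h2 h3)).trans (T.castHB_classOf _ _ _)

theorem surjective_lefschetz_iff {k : ℕ} (hk : k ≤ n) :
    Function.Surjective (T.lefschetz k hk) ↔ T.LefschetzSurj k := by
  have hK : (2 * n - k : ℤ) = (2 * n - k : ℕ) := by omega
  have hj : (n - k : ℤ).toNat = n - k := by omega
  have hL : ∀ {a : Forms (p + 2 * n) M}, a ∈ degree _ M k →
      (T.lefF ^ (n - k)) a ∈ degree _ M (2 * n - k : ℕ) := fun ha =>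
    T.lefF_pow_mem_degree _ (by omega) ha
  have hd : ∀ {a : Forms (p + 2 * n) M}, a ∈ T.basic → a.d = 0 → ((T.lefF ^ (n - k)) a).d = 0 :=
    fun h1 h2 => by rw [T.d_lefF_pow _ (T.smooth_of_mem_basic h1), h2, map_zero]
  unfold LefschetzSurj
  rw [hK, hj]
  constructor
  · intro h β h1 h2 h3
    obtain ⟨c, hc⟩ := h (T.classOf _ h2 h3)
    obtain ⟨a, ha1, ha2, ha3, rfl⟩ := T.exists_classOf_eq c
    rw [T.lefschetz_classOf hk ha2 ha3 (hd ha2 ha3)] at hc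
    exact ⟨a, ha1, ha2, ha3, (T.classOf_eq_iff h1 (hL ha1) h2 h3 _ _).1 hc.symm⟩
  · intro h c
    obtain ⟨β, h1, h2, h3, rfl⟩ := T.exists_classOf_eq c
    obtain ⟨a, ha1, ha2, ha3, hγ⟩ := h β h1 h2 h3
    refine ⟨T.classOf k ha2 ha3, ?_⟩
    rw [T.lefschetz_classOf hk ha2 ha3 (hd ha2 ha3)]
    exact ((T.classOf_eq_iff h1 (hL ha1) h2 h3 _ _).2 hγ).symm

theorem hhr_eq_univ_iff [T2Space M] {K : ℕ} : T.Hhr K = Set.univ ↔ T.HarmonicRep K := by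
  rw [Set.eq_univ_iff_forall]
  constructor
  · intro h β h1 h2 h3
    obtain ⟨⟨α, hα1, hα2⟩, hα3, hα4⟩ := h (T.classOf K h2 h3)
    have hs2 : (single K α).d = 0 := by
      rw [d_single, hα2]
      exact Pi.single_zero _
    have hc : T.classOf K h2 h3 = T.classOf K (T.single_mem_basic hα1) hs2 := by
      rw [← hα4]
      unfold classOf
      congr 2
      exact (single_same K α).symm
    obtain ⟨γ, hγ1, hγ2, rfl⟩ :=
      (T.classOf_eq_iff h1 (single_mem_degree rfl α) h2 h3 _ hs2).1 hc
    refine ⟨γ, hγ1, hγ2, ?_⟩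
    rw [add_sub_cancel_right, single_same]
    exact hα3
  · intro h c
    obtain ⟨β, h1, h2, h3, rfl⟩ := T.exists_classOf_eq c
    obtain ⟨γ, hγ1, hγ2, hγ3⟩ := h β h1 h2 h3
    have hdγ := d_mem_degree (l := K) (by ring) hγ1
    have hb := Submodule.sub_mem _ h2 (T.d_mem_basic hγ2)
    have hd : (β - γ.d).d = 0 := by
      rw [d_sub (T.smooth_of_mem_basic h2) (T.smooth_of_mem_basic (T.d_mem_basic hγ2)), h3,
        T.d_d hγ2, sub_zero]
    refine ⟨⟨(β - γ.d) K, hb K, congrFun hd (K + 1)⟩, hγ3, ?_⟩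
    exact ((T.classOf_eq_iff h1 (Submodule.sub_mem _ h1 hdγ) h2 h3 hb hd).2
      ⟨γ, hγ1, hγ2, (sub_add_cancel _ _).symm⟩).symm

end TransverselySymplecticFoliation

end TransverseLefschetz

theorem theorem4p1 (p n : ℕ) (M : Type*) [TopologicalSpace M] [T2Space M]
    [SecondCountableTopology M] [ChartedSpace (TransverseLefschetz.Coord (p + 2 * n)) M]
    [IsManifold (𝓡 (p + 2 * n)) ∞ M]
    (T : TransverseLefschetz.TransverselySymplecticFoliation p n M) (s : ℕ) (hs : s < n) :
    ((∀ (k : ℕ) (hk : k ≤ s), Function.Surjective (T.lefschetz k (hk.trans hs.le))) ↔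
      ((∀ k ≤ s + 2, T.Hhr k = Set.univ) ∧ (∀ k ≤ s, T.Hhr (2 * n - k) = Set.univ))) ∧
    ((∀ (k : ℕ) (hk : k ≤ s), Function.Surjective (T.lefschetz k (hk.trans hs.le))) ↔
      (∀ k ≤ s, T.Hhr (2 * n - k) = Set.univ)) := by
  simp only [T.surjective_lefschetz_iff, T.hhr_eq_univ_iff]
  have h20 : (∀ k ≤ s, T.HarmonicRep (2 * n - k)) → ∀ k ≤ s, T.LefschetzSurj (k : ℕ) :=
    fun h k hk => T.lefschetzSurj_of_harmonicRep (by omega) (h k hk)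
  have h01 : (∀ k ≤ s, T.LefschetzSurj (k : ℕ)) → (∀ k ≤ s + 2, T.HarmonicRep k) ∧
      ∀ k ≤ s, T.HarmonicRep (2 * n - k) := by
    intro h
    have hS : ∀ i ≤ (s : ℤ), T.LefschetzSurj i := by
      intro i hi
      rcases lt_or_ge i 0 with h0 | h0
      · exact T.lefschetzSurj_of_neg h0
      · obtain ⟨k, rfl⟩ := Int.eq_ofNat_of_zero_le h0
        exact h k (by omega)
    have h2 : ∀ k ≤ s, T.HarmonicRep (2 * n - k) := fun k hk =>
      T.harmonicRep_sub_of_lefschetzSurj hS hk (by omega)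
    refine ⟨fun k hk => ?_, h2⟩
    by_cases hkn : k ≤ n
    · exact T.harmonicRep_of_lefschetzSurj hS hk hkn
    · -- Here `s = n - 1` and `k = n + 1 = 2 n - s`.
      rw [show k = 2 * n - s by omega]
      exact h2 s le_rfl
  exact ⟨⟨h01, fun h => h20 h.2⟩, ⟨fun h => (h01 h).2, h20⟩⟩
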